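/- Let $K$ be a field and $H$ a Hopf algebra over $K$ with coproduct $\Delta h=\sum_j h^{(1)}_j\otimes h^{(2)}_j$, counit $\varepsilon$, antipode $S$ and right adjoint action $\mathrm{ad}(h)g=\sum_j S(h^{(1)}_j)\,g\,h^{(2)}_j$. Algebras are unital and associative, graded algebras are $\mathbb N$-graded, and a graded differential algebra is a graded algebra with an antiderivation $d$ of degree $1$ with $d^2=0$. **Operations.** An $H$-operation $(i,\Omega)$ is a graded differential algebra $\Omega$ with a linear map $h\mapsto i_h$ from $H$ to the endomorphisms of degree $-1$ of $\Omega$ such that $i_{1}=0$ and, with $L_h=d\,i_h+i_h\,d+\varepsilon(h)I_\Omega$, $$i_h(\alpha\beta)=\sum_j i_{h^{(1)}_j}(\alpha)\,L_{h^{(2)}_j}(\beta)+(-1)^a\alpha\, i_h(\beta)\quad(\alpha\in\Omega^a,\ \beta\in\Omega),$$ $$i_gL_h=\sum_j L_{h^{(1)}_j}\,i_{\mathrm{ad}(h^{(2)}_j)g},\qquad L_hL_g=L_{hg}\qquad(g,h\in H).$$ **The algebra $C(H)$.** Let $C(H)=\bigoplus_n C^n(H)$, $C^n(H)=(H^{\otimes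 n})^*$, be the graded algebra of multilinear forms on $H$ with the tensor product of forms as product. It carries the differential $d\omega=d_0\omega+\varepsilon\omega+(-1)^{n+1}\omega\varepsilon$ for $\omega\in C^n(H)$, where $d_0\omega(h_0,\dots,h_n)=\sum_{k=1}^n(-1)^k\omega(h_0,\dots,h_{k-1}h_k,\dots,h_n)$, and the contractions $i_h:C^n(H)\to C^{n-1}(H)$ with $i_h=0$ on $C^0(H)$ and, for $n\ge1$, $$i_h(\Psi)(g_1,\dots,g_{n-1})=\sum_{p=0}^{n-1}(-1)^p\sum\Psi\big(g_1,\dots,g_p,\;h^{(1)}-\varepsilon(h^{(1)})1,\;\mathrm{ad}(h^{(2)})g_{p+1},\dots,\mathrm{ad}(h^{(n-p)})g_{n-1}\big)$$ (inner sums over iterated coproducts of $h$; for $p=n-1$ the summand is $\Psi(g_1,\dots,g_{n-1},h-\varepsilon(h)1)$). Put $L_h=d\,i_h+i_h\,d+\varepsilon(h)I$ on $C(H)$. **Connections.** A connection on an $H$-operation $(i,\Omega)$ is a homomorphism of graded algebras $\alpha:C(H)\to\Omega$ with $i_h(\alpha(\Psi))=\alpha(i_h(\Psi))$ and $L_h(\alpha(\Psi))=\alpha(L_h(\Psi))$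 for all $h\in H$, $\Psi\in C(H)$. A morphism of $H$-operations with connections $(i,\Omega,\alpha)\to(i',\Omega',\alpha')$ is a homomorphism $f:\Omega\to\Omega'$ of graded differential algebras with $f\circ i_h=i'_h\circ f$ for all $h\in H$ and $f\circ\alpha=\alpha'$. **The Weil algebra.** For a graded algebra $A=\bigoplus_n A^n$ let $\Omega^1_{gr}(A)\subset A\otimes A$ be the kernel of $a\otimes b\mapsto(-1)^s ab$ ($b\in A^s$), an $A$-bimodule by $x(a\otimes b)y=xa\otimes by$, whose component of degree $n+1$ is its intersection with $\bigoplus_{r+s=n}A^r\otimes A^s$, and let $d:A\to\Omega^1_{gr}(A)$, $dx=1\otimes x-(-1)^n x\otimes1$ for $x\in A^n$. Let $\Omega_{gr}(A)=T_A(\Omega^1_{gr}(A))$ be the tensor algebra over $A$ of this bimodule, with the induced grading and with the unique differential extending $d$. Put $W(H)=\Omega_{gr}(C(H))$ and let $\alpha_W:C(H)\to W(H)$ be the canonical injection. **Theorem.** There is exactly one operation of $H$ in the graded differential algebra $W(H)$ for which $\alpha_W$ is a connection. With this operation and this connection, for every $H$-operation with connection $(i,\Omega,\alpha)$ there is a unique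 morphism of $H$-operations with connections from $W(H)$ to $\Omega$. In other words, $W(H)$ is an initial object of the category of $H$-operations with connections. -/

import Mathlib

set_option maxSynthPendingDepth 3

universe u v w w'

open scoped TensorProduct DirectSum Coalgebra

noncomputable section

/-! ### The graded algebra of multilinear forms -/

section Cochains

variable (K : Type*) [Field K] (H : Type*) [Ring H]

/-- `C^n(H)`: the space of `n`-linear forms on `H`, i.e. the dual of `H^{⊗ n}`. -/
abbrev Cochain [Algebra K H] (n : ℕ) : Type _ := MultilinearMap K (fun _ : Fin n => H) K

variable {K H} [Algebra K H]

namespace Cochain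

/-- The tensor product of multilinear forms,
`(f ⊗ g)(x₁, …, x_{m+n}) = f(x₁, …, x_m) g(x_{m+1}, …, x_{m+n})`. -/
def tensor {m n : ℕ} (f : Cochain K H m) (g : Cochain K H n) : Cochain K H (m + n) :=
  ((LinearMap.mul' K K).compMultilinearMap (f.domCoprod g)).domDomCongr finSumFinEquiv

@[simp] theorem tensor_apply {m n : ℕ} (f : Cochain K H m) (g : Cochain K H n)
    (x : Fin (m + n) → H) :
    tensor f g x = f (fun i => x (Fin.castAdd n i)) * g (fun j => x (Fin.natAdd m j)) := by
  simp [tensor]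

theorem mk_eq_mk {m n : ℕ} (h : m = n) (f : Cochain K H m) (g : Cochain K H n)
    (h' : ∀ x : Fin n → H, f (fun i => x (Fin.cast h i)) = g x) :
    GradedMonoid.mk (A := Cochain K H) m f = GradedMonoid.mk n g := by
  subst h
  congr 1
  ext x
  exact h' x

/-- The scalar `c`, seen as an element of `C⁰(H)`. -/
def const (c : K) : Cochain K H 0 := MultilinearMap.constOfIsEmpty K _ c

@[simp] theorem const_apply (c : K) (x : Fin 0 → H) : (const c : Cochain K H 0) x = c := rfl

instance : GradedMonoid.GOne (Cochain K H) where
  one := const 1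

instance : GradedMonoid.GMul (Cochain K H) where
  mul f g := tensor f g

theorem gOne_apply (x : Fin 0 → H) : (GradedMonoid.GOne.one : Cochain K H 0) x = 1 := rfl

theorem gMul_apply {m n : ℕ} (f : Cochain K H m) (g : Cochain K H n) (x : Fin (m + n) → H) :
    (GradedMonoid.GMul.mul f g : Cochain K H (m + n)) x =
      f (fun i => x (Fin.castAdd n i)) * g (fun j => x (Fin.natAdd m j)) :=
  tensor_apply f g x

instance : GradedMonoid.GMonoid (Cochain K H) where
  one_mul := fun ⟨n, f⟩ => mk_eq_mk (zero_add n)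
      (GradedMonoid.GMul.mul (GradedMonoid.GOne.one : Cochain K H 0) f) f fun x => by
    rw [gMul_apply, gOne_apply, one_mul]
    congr 1; funext i; congr 1; ext; simp
  mul_one := fun ⟨n, f⟩ => mk_eq_mk (add_zero n)
      (GradedMonoid.GMul.mul f (GradedMonoid.GOne.one : Cochain K H 0)) f fun x => by
    rw [gMul_apply, gOne_apply, mul_one]
    rfl
  mul_assoc := fun ⟨l, f⟩ ⟨m, g⟩ ⟨n, k⟩ => mk_eq_mk (add_assoc l m n)
      (GradedMonoid.GMul.mul (GradedMonoid.GMul.mul f g) k)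
      (GradedMonoid.GMul.mul f (GradedMonoid.GMul.mul g k)) fun x => by
    rw [gMul_apply, gMul_apply, gMul_apply, gMul_apply, mul_assoc]
    congr 2
    congr 1; funext i; congr 1; ext; simp [add_assoc]

instance : DirectSum.GRing (Cochain K H) where
  mul_zero f := by ext x; simp [gMul_apply]
  zero_mul f := by ext x; simp [gMul_apply]
  mul_add f g h := by ext x; simp [gMul_apply, mul_add]
  add_mul f g h := by ext x; simp [gMul_apply, add_mul]
  natCast n := const (n : K)
  natCast_zero := by ext x; simp
  natCast_succ n := by ext x; simp [gOne_apply]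
  intCast n := const (n : K)
  intCast_ofNat n := by ext x; simp
  intCast_negSucc_ofNat n := by ext x; simp

instance : DirectSum.GAlgebra K (Cochain K H) where
  toFun :=
    { toFun := const
      map_zero' := by ext x; simp
      map_add' := fun a b => by ext x; simp }
  map_one := rfl
  map_mul r s := mk_eq_mk (add_zero 0).symm _
      (GradedMonoid.GMul.mul (const r) (const s)) fun x => by
    rw [gMul_apply]
    simp
  commutes := fun r ⟨n, f⟩ => mk_eq_mk (add_comm 0 n)
      (GradedMonoid.GMul.mul (const r) f) (GradedMonoid.GMul.mul f (const r)) fun x => by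
    rw [gMul_apply, gMul_apply, const_apply, const_apply, mul_comm]
    congr 2; funext i; congr 1; ext; simp
  smul_def := fun r ⟨n, f⟩ => mk_eq_mk (zero_add n).symm (r • f)
      (GradedMonoid.GMul.mul (const r) f) fun x => by
    rw [gMul_apply, const_apply, smul_apply, smul_eq_mul]
    congr 2; funext i; congr 1; ext; simp

end Cochain

variable (K H)

/-- The graded algebra `C(H) = ⨁ n, C^n(H)` of multilinear forms on `H`, with the tensor product
of multilinear forms as product. -/
def MultilinearForms : Type _ := ⨁ n, Cochain K H n

namespace MultilinearForms

instance : Ring (MultilinearForms K H) := inferInstanceAs (Ring (⨁ n, Cochain K H n))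

instance : Algebra K (MultilinearForms K H) :=
  inferInstanceAs (Algebra K (⨁ n, Cochain K H n))

/-- `C(H)` is, as a vector space, the direct sum of the `C^n(H)`. -/
def equivDirectSum : MultilinearForms K H ≃ₗ[K] ⨁ n, Cochain K H n where
  toFun f := f
  invFun f := f
  map_add' _ _ := rfl
  map_smul' _ _ := rfl
  left_inv _ := rfl
  right_inv _ := rfl

/-- The inclusion of `C^n(H)` in `C(H)`. -/
def of (n : ℕ) : Cochain K H n →ₗ[K] MultilinearForms K H :=
  (equivDirectSum K H).symm.toLinearMap ∘ₗ DirectSum.lof K ℕ (Cochain K H) n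

variable {K H}

/-- The linear map on `C(H)` with prescribed restrictions to the `C^n(H)`. -/
def lift {M : Type*} [AddCommMonoid M] [Module K M] (φ : ∀ n, Cochain K H n →ₗ[K] M) :
    MultilinearForms K H →ₗ[K] M :=
  DirectSum.toModule K ℕ M φ ∘ₗ (equivDirectSum K H).toLinearMap

@[simp] theorem lift_of {M : Type*} [AddCommMonoid M] [Module K M]
    (φ : ∀ n, Cochain K H n →ₗ[K] M) (n : ℕ) (f : Cochain K H n) :
    lift φ (of K H n f) = φ n f :=
  DirectSum.toModule_lof K n f

theorem hom_ext {M : Type*} [AddCommMonoid M] [Module K M] {φ ψ : MultilinearForms K H →ₗ[K] M}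
    (h : ∀ n f, φ (of K H n f) = ψ (of K H n f)) : φ = ψ :=
  DirectSum.linearMap_ext K (ψ := φ) (ψ' := ψ) fun n => LinearMap.ext (h n)

theorem one_def : (1 : MultilinearForms K H) = of K H 0 (Cochain.const 1) := rfl

theorem of_mul_of {m n : ℕ} (f : Cochain K H m) (g : Cochain K H n) :
    of K H m f * of K H n g = of K H (m + n) (Cochain.tensor f g) :=
  DirectSum.of_mul_of f g

variable (K H) in
/-- The homogeneous elements of degree `n` of `C(H)`. -/
def grading (n : ℕ) : Submodule K (MultilinearForms K H) := LinearMap.range (of K H n)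

theorem of_mem_grading (n : ℕ) (f : Cochain K H n) : of K H n f ∈ grading K H n := ⟨f, rfl⟩

instance : SetLike.GradedMonoid (grading K H) where
  one_mem := ⟨Cochain.const 1, rfl⟩
  mul_mem := by
    rintro m n _ _ ⟨f, rfl⟩ ⟨g, rfl⟩
    exact ⟨Cochain.tensor f g, (of_mul_of f g).symm⟩

instance : DirectSum.Decomposition (grading K H) :=
  DirectSum.Decomposition.ofLinearMap (grading K H)
    (lift fun n => DirectSum.lof K ℕ (fun n => grading K H n) n ∘ₗ (of K H n).rangeRestrict)
    (hom_ext fun n f => by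
      rw [LinearMap.comp_apply, lift_of]
      exact DirectSum.coeLinearMap_lof _ _ _)
    (by
      refine DirectSum.linearMap_ext K fun n => LinearMap.ext ?_
      rintro ⟨_, f, rfl⟩
      simp [DirectSum.coeLinearMap_lof]
      rfl)

instance : GradedAlgebra (grading K H) where

end MultilinearForms

/-! ### The Hochschild differential of `C(H)` -/

namespace Cochain

variable {K H}

theorem contractNth_update {n : ℕ} (k : Fin n) (g : Fin (n + 1) → H) (i : Fin (n + 1)) :
    ∃ (j : Fin n) (u : H →ₗ[K] H), ∀ x : H,
      Fin.contractNth k.castSucc (· * ·) (Function.update g i x) =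
        Function.update (Fin.contractNth k.castSucc (· * ·) g) j (u x) := by
  have hk := k.2
  have hi := i.2
  rcases lt_or_ge (i : ℕ) k with h | h
  · refine ⟨⟨i, by omega⟩, LinearMap.id, fun x => funext fun l => ?_⟩
    simp only [Fin.contractNth, Function.update_apply, Fin.ext_iff, LinearMap.id_apply,
      Fin.val_castSucc, Fin.val_succ]
    split_ifs <;> first | rfl | omega
  · obtain h | h | h : (i : ℕ) = k ∨ (i : ℕ) = k + 1 ∨ (k : ℕ) + 1 < i := by omega
    · refine ⟨k, LinearMap.mulRight K (g k.succ), fun x => funext fun l => ?_⟩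
      simp only [Fin.contractNth, Function.update_apply, Fin.ext_iff, LinearMap.mulRight_apply,
        Fin.val_castSucc, Fin.val_succ]
      rcases eq_or_ne l k with rfl | hl
      · simp [h]
      · have := Fin.val_ne_of_ne hl
        split_ifs <;> first | rfl | omega
    · refine ⟨k, LinearMap.mulLeft K (g k.castSucc), fun x => funext fun l => ?_⟩
      simp only [Fin.contractNth, Function.update_apply, Fin.ext_iff, LinearMap.mulLeft_apply,
        Fin.val_castSucc, Fin.val_succ]
      rcases eq_or_ne l k with rfl | hl
      · simp [h]
      · have := Fin.val_ne_of_ne hl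
        split_ifs <;> first | rfl | omega
    · refine ⟨⟨i - 1, by omega⟩, LinearMap.id, fun x => funext fun l => ?_⟩
      simp only [Fin.contractNth, Function.update_apply, Fin.ext_iff, LinearMap.id_apply,
        Fin.val_castSucc, Fin.val_succ]
      split_ifs <;> first | rfl | omega

/-- `(h₀, …, hₙ) ↦ Ψ(h₀, …, h_{k-1}, h_k h_{k+1}, h_{k+2}, …, hₙ)`. -/
def face {n : ℕ} (k : Fin n) : Cochain K H n →ₗ[K] Cochain K H (n + 1) where
  toFun Ψ :=
    { toFun := fun h => Ψ (Fin.contractNth k.castSucc (· * ·) h)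
      map_update_add' := by
        intro inst g i x y
        obtain rfl : inst = instDecidableEqFin (n + 1) := Subsingleton.elim _ _
        obtain ⟨j, u, hu⟩ := contractNth_update (K := K) k g i
        simp [hu]
      map_update_smul' := by
        intro inst g i c x
        obtain rfl : inst = instDecidableEqFin (n + 1) := Subsingleton.elim _ _
        obtain ⟨j, u, hu⟩ := contractNth_update (K := K) k g i
        simp [hu] }
  map_add' _ _ := rfl
  map_smul' _ _ := rfl

@[simp] theorem face_apply {n : ℕ} (k : Fin n) (Ψ : Cochain K H n) (h : Fin (n + 1) → H) :
    face k Ψ h = Ψ (Fin.contractNth k.castSucc (· * ·) h) := rfl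

/-- The part `d₀` of the differential coming from the product of `H`:
`(d₀ Ψ)(h₀, …, hₙ) = ∑_{1 ≤ k ≤ n} (-1)^k Ψ(h₀, …, h_{k-2}, h_{k-1} h_k, h_{k+1}, …, hₙ)`
(below `k : Fin n` is shifted by one). -/
def barDiff (n : ℕ) : Cochain K H n →ₗ[K] Cochain K H (n + 1) :=
  ∑ k : Fin n, (-1 : K) ^ ((k : ℕ) + 1) • face k

end Cochain
end Cochains

section HopfCochains

variable {K : Type*} [Field K] {H : Type*} [Ring H] [HopfAlgebra K H]

/-- `∑ⱼ B(h⁽¹⁾ⱼ, h⁽²⁾ⱼ)`, where `Δ h = ∑ⱼ h⁽¹⁾ⱼ ⊗ h⁽²⁾ⱼ`. -/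
def sweedler {M : Type*} [AddCommMonoid M] [Module K M] (B : H →ₗ[K] H →ₗ[K] M) : H →ₗ[K] M :=
  TensorProduct.lift B ∘ₗ Coalgebra.comul

theorem sweedler_apply {M : Type*} [AddCommMonoid M] [Module K M] (B : H →ₗ[K] H →ₗ[K] M)
    {h : H} {ι : Type*} (r : Coalgebra.Repr K h ι) :
    sweedler B h = ∑ j ∈ r.index, B (r.left j) (r.right j) := by
  simp [sweedler, ← r.eq]

variable (K) in
/-- The right adjoint action `ad(h) g = ∑ⱼ S(h⁽¹⁾ⱼ) g h⁽²⁾ⱼ` of `H` on itself. -/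
def rightAd : H →ₗ[K] Module.End K H :=
  sweedler <| LinearMap.mk₂ K
    (fun x y => LinearMap.mulLeft K (HopfAlgebra.antipode K x) ∘ₗ LinearMap.mulRight K y)
    (fun _ _ _ => by ext; simp [add_mul])
    (fun _ _ _ => by ext; simp)
    (fun _ _ _ => by ext; simp [mul_add])
    (fun _ _ _ => by ext; simp)

theorem rightAd_apply {h : H} {ι : Type*} (r : Coalgebra.Repr K h ι) (g : H) :
    rightAd K h g =
      ∑ j ∈ r.index, HopfAlgebra.antipode K (r.left j) * g * r.right j := by
  simp [rightAd, sweedler_apply _ r, mul_assoc]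

variable (K) in
/-- `h ↦ h - ε(h) 1`. -/
def reduced : H →ₗ[K] H :=
  LinearMap.id - Algebra.linearMap K H ∘ₗ Coalgebra.counit

theorem reduced_apply (h : H) :
    reduced K h = h - algebraMap K H (Coalgebra.counit h) := rfl

namespace Cochain

/-- `Ψ ↦ (x ↦ Ψ(x, ·))`. -/
def curry (n : ℕ) : Cochain K H (n + 1) →ₗ[K] H →ₗ[K] Cochain K H n :=
  (multilinearCurryLeftEquiv K (fun _ : Fin (n + 1) => H) K).toLinearMap

@[simp] theorem curry_apply {n : ℕ} (Ψ : Cochain K H (n + 1)) (x : H) (g : Fin n → H) :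
    curry n Ψ x g = Ψ (Fin.cons x g) := rfl

/-- The inverse of `curry`. -/
def uncurry (n : ℕ) : (H →ₗ[K] Cochain K H n) →ₗ[K] Cochain K H (n + 1) :=
  (multilinearCurryLeftEquiv K (fun _ : Fin (n + 1) => H) K).symm.toLinearMap

@[simp] theorem uncurry_apply {n : ℕ} (f : H →ₗ[K] Cochain K H n) (g : Fin (n + 1) → H) :
    uncurry n f g = f (g 0) (Fin.tail g) := rfl

/-- Acting with `a` on the first argument and with `b` on the other ones:
`Ψ ↦ ((g₁, g₂, …) ↦ (b (Ψ(a g₁, ·)))(g₂, …))`. -/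
def headTail {m n : ℕ} (a : H →ₗ[K] H) (b : Cochain K H m →ₗ[K] Cochain K H n) :
    Cochain K H (m + 1) →ₗ[K] Cochain K H (n + 1) where
  toFun Ψ := uncurry n (b ∘ₗ curry m Ψ ∘ₗ a)
  map_add' _ _ := by ext; simp
  map_smul' _ _ := by ext; simp

@[simp] theorem headTail_apply {m n : ℕ} (a : H →ₗ[K] H) (b : Cochain K H m →ₗ[K] Cochain K H n)
    (Ψ : Cochain K H (m + 1)) (g : Fin (n + 1) → H) :
    headTail a b Ψ g = b (curry m Ψ (a (g 0))) (Fin.tail g) := rfl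

/-- Acting on all arguments but the first: `(tailMap b Ψ)(g₁, g₂, …) = (b (Ψ(g₁, ·)))(g₂, …)`. -/
def tailMap {m n : ℕ} : (Cochain K H m →ₗ[K] Cochain K H n) →ₗ[K]
    Cochain K H (m + 1) →ₗ[K] Cochain K H (n + 1) where
  toFun b := headTail LinearMap.id b
  map_add' _ _ := by ext; simp
  map_smul' _ _ := by ext; simp

@[simp] theorem tailMap_apply {m n : ℕ} (b : Cochain K H m →ₗ[K] Cochain K H n)
    (Ψ : Cochain K H (m + 1)) (g : Fin (n + 1) → H) :
    tailMap b Ψ g = b (curry m Ψ (g 0)) (Fin.tail g) := rfl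

/-- The diagonal adjoint action
`(coad h Ψ)(g₁, …, gₙ) = ∑ Ψ(ad(h⁽¹⁾) g₁, …, ad(h⁽ⁿ⁾) gₙ)`, with the iterated coproduct of `h`,
by recursion on `n`; for `n = 0` it is multiplication by `ε(h)`. -/
def coad : ∀ n : ℕ, H →ₗ[K] Cochain K H n →ₗ[K] Cochain K H n
  | 0 => (Coalgebra.counit (R := K) (A := H)).smulRight LinearMap.id
  | n + 1 => sweedler <| LinearMap.mk₂ K
      (fun x y => headTail (rightAd K x) (coad n y))
      (fun _ _ _ => by ext; simp)
      (fun _ _ _ => by ext; simp)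
      (fun _ _ _ => by ext; simp)
      (fun _ _ _ => by ext; simp)

theorem coad_zero_apply (h : H) (Ψ : Cochain K H 0) :
    coad 0 h Ψ = (Coalgebra.counit h : K) • Ψ := rfl

theorem coad_succ_apply {n : ℕ} {h : H} {ι : Type*} (r : Coalgebra.Repr K h ι)
    (Ψ : Cochain K H (n + 1)) (g : Fin (n + 1) → H) :
    coad (n + 1) h Ψ g = ∑ j ∈ r.index,
      coad n (r.right j) (curry _ Ψ (rightAd K (r.left j) (g 0))) (Fin.tail g) := by
  rw [coad, sweedler_apply _ r]
  simp

/-- The term `p = 0` of the contraction: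
`Ψ ↦ ((g₁, …, gₙ) ↦ ∑ Ψ(h⁽¹⁾ - ε(h⁽¹⁾) 1, ad(h⁽²⁾) g₁, …, ad(h⁽ⁿ⁺¹⁾) gₙ))`. -/
def contractHead (n : ℕ) : H →ₗ[K] Cochain K H (n + 1) →ₗ[K] Cochain K H n :=
  sweedler <| LinearMap.mk₂ K
    (fun x y => coad n y ∘ₗ (curry n).flip (reduced K x))
    (fun _ _ _ => by ext; simp)
    (fun _ _ _ => by ext; simp)
    (fun _ _ _ => by ext; simp)
    (fun _ _ _ => by ext; simp)

theorem contractHead_apply {n : ℕ} {h : H} {ι : Type*} (r : Coalgebra.Repr K h ι)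
    (Ψ : Cochain K H (n + 1)) :
    contractHead n h Ψ =
      ∑ j ∈ r.index, coad n (r.right j) (curry _ Ψ (reduced K (r.left j))) := by
  simp [contractHead, sweedler_apply _ r]

/-- The contraction `i_h : C^{n+1}(H) → C^n(H)`,
`(i_h Ψ)(g₁, …, gₙ) = ∑_{0 ≤ p ≤ n} (-1)^p ∑ Ψ(g₁, …, g_p, h⁽¹⁾ - ε(h⁽¹⁾) 1, ad(h⁽²⁾) g_{p+1}, …,
ad(h⁽ⁿ⁻ᵖ⁺¹⁾) gₙ)`,
with the iterated coproducts of `h` (for `p = n` the term is `(-1)^n Ψ(g₁, …, gₙ, h - ε(h) 1)`).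
It is given by recursion on `n`: the terms with `p ≥ 1` sum up to `- (i_h (Ψ(g₁, ·)))(g₂, …, gₙ)`. -/
def contract : ∀ n : ℕ, H →ₗ[K] Cochain K H (n + 1) →ₗ[K] Cochain K H n
  | 0 => contractHead 0
  | n + 1 => contractHead (n + 1) - tailMap ∘ₗ contract n

theorem contract_zero_apply (h : H) (Ψ : Cochain K H 1) (g : Fin 0 → H) :
    contract 0 h Ψ g = Ψ (fun _ => h - algebraMap K H (Coalgebra.counit h)) := by
  have r := ℛ K h
  have h1 : ∑ j ∈ r.index, (Coalgebra.counit (r.right j) : K) • r.left j = h := by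
    simpa only [map_sum, TensorProduct.rid_tmul, one_smul] using
      congrArg (TensorProduct.rid K H) (Coalgebra.sum_tmul_counit_eq (R := K) r)
  have h2 : ∑ j ∈ r.index, (Coalgebra.counit (r.right j) : K) • reduced K (r.left j) =
      reduced K h := by
    simp only [← map_smul, ← map_sum, h1]
  have h3 : (fun _ : Fin 1 => reduced K h) = Fin.cons (reduced K h) g := by
    ext i; fin_cases i; rfl
  rw [← reduced_apply, h3, ← curry_apply, ← h2, contract, contractHead_apply r]
  simp only [map_sum, map_smul, coad_zero_apply]

theorem contract_succ_apply {n : ℕ} {h : H} {ι : Type*} (r : Coalgebra.Repr K h ι)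
    (Ψ : Cochain K H (n + 2)) (g : Fin (n + 1) → H) :
    contract (n + 1) h Ψ g =
      ∑ j ∈ r.index, coad (n + 1) (r.right j)
        (curry _ Ψ (r.left j - algebraMap K H (Coalgebra.counit (r.left j)))) g -
      contract n h (curry _ Ψ (g 0)) (Fin.tail g) := by
  rw [contract]
  simp [contractHead_apply r, ← reduced_apply]

end Cochain

namespace MultilinearForms

/-- The counit of `H`, seen as an element of `C¹(H)`. -/
def counitForm : MultilinearForms K H :=
  of K H 1 (MultilinearMap.ofSubsingleton K H K (0 : Fin 1) (Coalgebra.counit (R := K) (A := H)))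

/-- The Hochschild differential of `C(H)`, with coefficients in the trivial bimodule:
`d ω = d₀ ω + ε ω + (-1)^{n+1} ω ε` for `ω ∈ C^n(H)`. -/
def diff : MultilinearForms K H →ₗ[K] MultilinearForms K H :=
  lift fun n =>
    of K H (n + 1) ∘ₗ Cochain.barDiff n + LinearMap.mulLeft K counitForm ∘ₗ of K H n +
      (-1 : K) ^ (n + 1) • (LinearMap.mulRight K counitForm ∘ₗ of K H n)

/-- The contractions `i_h` of `C(H)`; they vanish on `C⁰(H)`. -/
def contraction : H →ₗ[K] Module.End K (MultilinearForms K H) where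
  toFun h := lift fun n =>
    match n with
    | 0 => 0
    | n + 1 => of K H n ∘ₗ Cochain.contract n h
  map_add' h h' := hom_ext fun n f => by cases n <;> simp
  map_smul' c h := hom_ext fun n f => by cases n <;> simp

end MultilinearForms

end HopfCochains

/-! ### Graded algebras -/

theorem graded_induction {K : Type*} [Field K] {M : Type*} [AddCommGroup M] [Module K M]
    (ℳ : ℕ → Submodule K M) [DirectSum.Decomposition ℳ] {P : M → Prop}
    (h : ∀ n, ∀ a ∈ ℳ n, P a) (hadd : ∀ a b, P a → P b → P (a + b)) (a : M) : P a :=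
  DirectSum.Decomposition.inductionOn ℳ (h 0 0 (zero_mem _)) (fun {n} m => h n m m.2)
    (fun a b => hadd a b) a

section GradeInv

variable {K : Type*} [Field K] {A : Type*} [Ring A] [Algebra K A]
variable (𝒜 : ℕ → Submodule K A) [GradedAlgebra 𝒜]

/-- Auxiliary linear map for `gradeInv`. -/
def gradeInvLin : A →ₗ[K] A :=
  (DirectSum.toModule K ℕ A fun n => (-1 : K) ^ n • (𝒜 n).subtype) ∘ₗ
    (DirectSum.decomposeLinearEquiv 𝒜).toLinearMap

theorem gradeInvLin_of_mem {n : ℕ} {a : A} (ha : a ∈ 𝒜 n) :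
    gradeInvLin 𝒜 a = (-1 : K) ^ n • a := by
  lift a to 𝒜 n using ha
  simp [gradeInvLin]

/-- The grading automorphism `a ↦ (-1)^n a` for `a` homogeneous of degree `n`. -/
def gradeInv : A →ₐ[K] A :=
  AlgHom.ofLinearMap (gradeInvLin 𝒜)
    (by rw [gradeInvLin_of_mem 𝒜 (SetLike.GradedOne.one_mem (A := 𝒜))]; simp)
    (fun a b => by
      induction a using graded_induction 𝒜 with
      | hadd a a' h h' => simp [add_mul, h, h']
      | h m a ha =>
        induction b using graded_induction 𝒜 with
        | hadd b b' h h' => simp [mul_add, h, h']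
        | h n b hb =>
          rw [gradeInvLin_of_mem 𝒜 ha, gradeInvLin_of_mem 𝒜 hb,
            gradeInvLin_of_mem 𝒜 (SetLike.GradedMul.mul_mem ha hb), pow_add, smul_mul_smul_comm])

theorem gradeInv_of_mem {n : ℕ} {a : A} (ha : a ∈ 𝒜 n) :
    gradeInv 𝒜 a = (-1 : K) ^ n • a :=
  gradeInvLin_of_mem 𝒜 ha

end GradeInv

/-! ### The tensor algebra of a bimodule -/

section BimoduleTensorAlgebra

variable (K : Type*) [Field K] (A : Type*) [Ring A] [Algebra K A]
variable (M : Type*) [AddCommGroup M] [Module K M] [Module A M] [Module Aᵐᵒᵖ M]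

/-- The relations defining the tensor algebra of the bimodule `M` over the (noncommutative)
algebra `A` as a quotient of the tensor algebra over `K` of the vector space `A × M`. -/
inductive BimoduleTensorAlgebra.Rel :
    TensorAlgebra K (A × M) → TensorAlgebra K (A × M) → Prop
  | one : Rel (TensorAlgebra.ι K (1, 0)) 1
  | mul (a b : A) : Rel (TensorAlgebra.ι K (a, 0) * TensorAlgebra.ι K (b, 0))
      (TensorAlgebra.ι K (a * b, 0))
  | left (a : A) (m : M) : Rel (TensorAlgebra.ι K (a, 0) * TensorAlgebra.ι K (0, m))
      (TensorAlgebra.ι K (0, a • m))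
  | right (m : M) (a : A) : Rel (TensorAlgebra.ι K (0, m) * TensorAlgebra.ι K (a, 0))
      (TensorAlgebra.ι K (0, MulOpposite.op a • m))

/-- The tensor algebra `T_A(M) = A ⊕ M ⊕ (M ⊗_A M) ⊕ ⋯` over the (noncommutative) algebra `A` of
the `A`-bimodule `M` (the right action of `A` is encoded as an action of `Aᵐᵒᵖ`). -/
def BimoduleTensorAlgebra : Type _ := RingQuot (BimoduleTensorAlgebra.Rel K A M)

namespace BimoduleTensorAlgebra

instance : Ring (BimoduleTensorAlgebra K A M) :=
  inferInstanceAs (Ring (RingQuot (BimoduleTensorAlgebra.Rel K A M)))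

instance : Algebra K (BimoduleTensorAlgebra K A M) :=
  inferInstanceAs (Algebra K (RingQuot (BimoduleTensorAlgebra.Rel K A M)))

/-- The quotient map. -/
def mk : TensorAlgebra K (A × M) →ₐ[K] BimoduleTensorAlgebra K A M :=
  RingQuot.mkAlgHom K (Rel K A M)

variable {K A M}

theorem mk_rel {x y : TensorAlgebra K (A × M)} (h : Rel K A M x y) : mk K A M x = mk K A M y :=
  RingQuot.mkAlgHom_rel K h

variable (K A M)

/-- The inclusion of `M` in `T_A(M)`. -/
def ofModule : M →ₗ[K] BimoduleTensorAlgebra K A M :=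
  (mk K A M).toLinearMap ∘ₗ TensorAlgebra.ι K ∘ₗ LinearMap.inr K A M

/-- The inclusion of `A` in `T_A(M)`. -/
def ofAlgebra : A →ₐ[K] BimoduleTensorAlgebra K A M :=
  AlgHom.ofLinearMap ((mk K A M).toLinearMap ∘ₗ TensorAlgebra.ι K ∘ₗ LinearMap.inl K A M)
    (by simpa using mk_rel (M := M) (Rel.one (K := K) (A := A)))
    (fun a b => by simpa using (mk_rel (M := M) (Rel.mul (K := K) a b)).symm)

variable {K A M}

theorem ofModule_smul (a : A) (m : M) :
    ofModule K A M (a • m) = ofAlgebra K A M a * ofModule K A M m :=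
  (mk_rel (Rel.left (K := K) a m)).symm.trans (map_mul (mk K A M) _ _)

theorem ofModule_op_smul (a : A) (m : M) :
    ofModule K A M (MulOpposite.op a • m) = ofModule K A M m * ofAlgebra K A M a :=
  (mk_rel (Rel.right (K := K) m a)).symm.trans (map_mul (mk K A M) _ _)

/-- The universal property of `T_A(M)`. -/
def lift {B : Type*} [Ring B] [Algebra K B] (f : A →ₐ[K] B) (g : M →ₗ[K] B)
    (hl : ∀ a m, g (a • m) = f a * g m) (hr : ∀ a m, g (MulOpposite.op a • m) = g m * f a) :
    BimoduleTensorAlgebra K A M →ₐ[K] B :=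
  RingQuot.liftAlgHom K ⟨TensorAlgebra.lift K (f.toLinearMap.coprod g), by
    rintro _ _ (_ | ⟨a, b⟩ | ⟨a, m⟩ | ⟨m, a⟩)
    · simp
    · simp
    · simp [hl]
    · simp [hr]⟩

section lift
variable {B : Type*} [Ring B] [Algebra K B] (f : A →ₐ[K] B) (g : M →ₗ[K] B)
    (hl : ∀ a m, g (a • m) = f a * g m) (hr : ∀ a m, g (MulOpposite.op a • m) = g m * f a)

@[simp] theorem lift_ofAlgebra (a : A) : lift f g hl hr (ofAlgebra K A M a) = f a :=
  (RingQuot.liftAlgHom_mkAlgHom_apply _ _ _ _).trans (by simp)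

@[simp] theorem lift_ofModule (m : M) : lift f g hl hr (ofModule K A M m) = g m :=
  (RingQuot.liftAlgHom_mkAlgHom_apply _ _ _ _).trans (by simp)

end lift

theorem hom_ext {B : Type*} [Semiring B] [Algebra K B] {f g : BimoduleTensorAlgebra K A M →ₐ[K] B}
    (hA : ∀ a, f (ofAlgebra K A M a) = g (ofAlgebra K A M a))
    (hM : ∀ m, f (ofModule K A M m) = g (ofModule K A M m)) : f = g := by
  refine RingQuot.ringQuot_ext' K f g (TensorAlgebra.hom_ext (LinearMap.ext fun x => ?_))
  have hx : x = (x.1, 0) + (0, x.2) := by simp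
  rw [hx, map_add, map_add]
  exact congrArg₂ (· + ·) (hA x.1) (hM x.2)

/-! The grading of `T_A(M)` induced by gradings of `A` and `M`. -/

/-- Products of homogeneous elements of `A` and `M`, with their total degree. -/
inductive IsHomogeneousProduct (𝒜 : ℕ → Submodule K A) (ℳ : ℕ → Submodule K M) :
    ℕ → BimoduleTensorAlgebra K A M → Prop
  | ofAlgebra {n : ℕ} {a : A} (ha : a ∈ 𝒜 n) : IsHomogeneousProduct 𝒜 ℳ n (ofAlgebra K A M a)
  | ofModule {n : ℕ} {m : M} (hm : m ∈ ℳ n) : IsHomogeneousProduct 𝒜 ℳ n (ofModule K A M m)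
  | mul {m n : ℕ} {x y : BimoduleTensorAlgebra K A M} (hx : IsHomogeneousProduct 𝒜 ℳ m x)
      (hy : IsHomogeneousProduct 𝒜 ℳ n y) : IsHomogeneousProduct 𝒜 ℳ (m + n) (x * y)

/-- The graduation of `T_A(M)` which induces given graduations on `A` and `M`. -/
def grading (𝒜 : ℕ → Submodule K A) (ℳ : ℕ → Submodule K M) (n : ℕ) :
    Submodule K (BimoduleTensorAlgebra K A M) :=
  Submodule.span K {x | IsHomogeneousProduct 𝒜 ℳ n x}

theorem ofAlgebra_mem_grading (𝒜 : ℕ → Submodule K A) (ℳ : ℕ → Submodule K M) {n : ℕ} {a : A}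
    (ha : a ∈ 𝒜 n) : ofAlgebra K A M a ∈ grading 𝒜 ℳ n :=
  Submodule.subset_span (.ofAlgebra ha)

theorem ofModule_mem_grading (𝒜 : ℕ → Submodule K A) (ℳ : ℕ → Submodule K M) {n : ℕ} {m : M}
    (hm : m ∈ ℳ n) : ofModule K A M m ∈ grading 𝒜 ℳ n :=
  Submodule.subset_span (.ofModule hm)

instance (𝒜 : ℕ → Submodule K A) [GradedAlgebra 𝒜] (ℳ : ℕ → Submodule K M) :
    SetLike.GradedMonoid (grading 𝒜 ℳ) where
  one_mem := by
    rw [← map_one (ofAlgebra K A M)]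
    exact ofAlgebra_mem_grading 𝒜 ℳ (SetLike.GradedOne.one_mem (A := 𝒜))
  mul_mem := by
    intro m n x y hx hy
    induction hx using Submodule.span_induction with
    | zero => simp
    | add x x' _ _ h h' => rw [add_mul]; exact add_mem h h'
    | smul c x _ h => rw [smul_mul_assoc]; exact Submodule.smul_mem _ c h
    | mem x hx =>
      induction hy using Submodule.span_induction with
      | zero => simp
      | add y y' _ _ h h' => rw [mul_add]; exact add_mem h h'
      | smul c y _ h => rw [mul_smul_comm]; exact Submodule.smul_mem _ c h
      | mem y hy => exact Submodule.subset_span (.mul hx hy)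

section decompose

variable {N : Type*} [AddCommGroup N] [Module K N] (𝒩 : ℕ → Submodule K N)
  [DirectSum.Decomposition 𝒩] {B : Type*} [AddCommGroup B] [Module K B] (ℬ : ℕ → Submodule K B)
  (φ : N →ₗ[K] B) (hφ : ∀ n, ∀ x ∈ 𝒩 n, φ x ∈ ℬ n)

/-- The map `N → ⨁ n, ℬ n` induced by a homogeneous linear map `φ : N → B`. -/
def toDirectSum : N →ₗ[K] ⨁ n, ℬ n :=
  (DirectSum.toModule K ℕ _ fun n => DirectSum.lof K ℕ (fun n => ℬ n) n ∘ₗ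
    φ.restrict (hφ n)) ∘ₗ (DirectSum.decomposeLinearEquiv 𝒩).toLinearMap

theorem toDirectSum_of_mem {n : ℕ} {x : N} (hx : x ∈ 𝒩 n) :
    toDirectSum 𝒩 ℬ φ hφ x = DirectSum.of (fun n => ℬ n) n ⟨φ x, hφ n x hx⟩ := by
  lift x to 𝒩 n using hx
  simp [toDirectSum]
  rfl

end decompose

/-- The bimodule structure is compatible with the graduations. -/
class IsGradedBimodule (𝒜 : ℕ → Submodule K A) (ℳ : ℕ → Submodule K M) : Prop where
  smul_mem : ∀ {m n : ℕ} {a : A} {x : M}, a ∈ 𝒜 m → x ∈ ℳ n → a • x ∈ ℳ (m + n)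
  op_smul_mem : ∀ {m n : ℕ} {a : A} {x : M}, x ∈ ℳ m → a ∈ 𝒜 n →
    MulOpposite.op a • x ∈ ℳ (m + n)

section graded

/-- Auxiliary map for the decomposition of `T_A(M)`. -/
def decomposeAlgebraLin (𝒜 : ℕ → Submodule K A) [GradedAlgebra 𝒜] (ℳ : ℕ → Submodule K M) :
    A →ₗ[K] ⨁ n, grading 𝒜 ℳ n :=
  toDirectSum 𝒜 (grading 𝒜 ℳ) (ofAlgebra K A M).toLinearMap
    fun _ _ ha => ofAlgebra_mem_grading 𝒜 ℳ ha

theorem decomposeAlgebraLin_of_mem (𝒜 : ℕ → Submodule K A) [GradedAlgebra 𝒜]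
    (ℳ : ℕ → Submodule K M) {n : ℕ} {a : A} (ha : a ∈ 𝒜 n) :
    decomposeAlgebraLin 𝒜 ℳ a = DirectSum.of (fun n => grading 𝒜 ℳ n) n
      ⟨ofAlgebra K A M a, ofAlgebra_mem_grading 𝒜 ℳ ha⟩ :=
  toDirectSum_of_mem _ _ _ _ ha

/-- Auxiliary map for the decomposition of `T_A(M)`. -/
def decomposeAlgebra (𝒜 : ℕ → Submodule K A) [GradedAlgebra 𝒜] (ℳ : ℕ → Submodule K M) :
    A →ₐ[K] ⨁ n, grading 𝒜 ℳ n :=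
  AlgHom.ofLinearMap (decomposeAlgebraLin 𝒜 ℳ)
    (by
      rw [decomposeAlgebraLin_of_mem _ _ (SetLike.GradedOne.one_mem (A := 𝒜))]
      refine congrArg (DirectSum.of (fun n => grading 𝒜 ℳ n) 0) (Subtype.ext ?_)
      exact map_one (ofAlgebra K A M))
    (fun a b => by
      induction a using graded_induction 𝒜 with
      | hadd a a' h h' => simp only [add_mul, map_add, h, h']
      | h m a ha =>
        induction b using graded_induction 𝒜 with
        | hadd b b' h h' => simp only [mul_add, map_add, h, h']
        | h n b hb =>
          rw [decomposeAlgebraLin_of_mem _ _ ha, decomposeAlgebraLin_of_mem _ _ hb,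
            decomposeAlgebraLin_of_mem _ _ (SetLike.GradedMul.mul_mem ha hb),
            DirectSum.of_mul_of]
          refine congrArg (DirectSum.of (fun n => grading 𝒜 ℳ n) (m + n)) (Subtype.ext ?_)
          exact map_mul (ofAlgebra K A M) a b)

theorem decomposeAlgebra_of_mem (𝒜 : ℕ → Submodule K A) [GradedAlgebra 𝒜]
    (ℳ : ℕ → Submodule K M) {n : ℕ} {a : A} (ha : a ∈ 𝒜 n) :
    decomposeAlgebra 𝒜 ℳ a = DirectSum.of (fun n => grading 𝒜 ℳ n) n
      ⟨ofAlgebra K A M a, ofAlgebra_mem_grading 𝒜 ℳ ha⟩ :=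
  decomposeAlgebraLin_of_mem 𝒜 ℳ ha

/-- Auxiliary map for the decomposition of `T_A(M)`. -/
def decomposeModule (𝒜 : ℕ → Submodule K A) (ℳ : ℕ → Submodule K M)
    [DirectSum.Decomposition ℳ] : M →ₗ[K] ⨁ n, grading 𝒜 ℳ n :=
  toDirectSum ℳ (grading 𝒜 ℳ) (ofModule K A M) fun _ _ hm => ofModule_mem_grading 𝒜 ℳ hm

theorem decomposeModule_of_mem (𝒜 : ℕ → Submodule K A) (ℳ : ℕ → Submodule K M)
    [DirectSum.Decomposition ℳ] {n : ℕ} {m : M} (hm : m ∈ ℳ n) :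
    decomposeModule 𝒜 ℳ m = DirectSum.of (fun n => grading 𝒜 ℳ n) n
      ⟨ofModule K A M m, ofModule_mem_grading 𝒜 ℳ hm⟩ :=
  toDirectSum_of_mem _ _ _ _ hm

variable (𝒜 : ℕ → Submodule K A) [GradedAlgebra 𝒜] (ℳ : ℕ → Submodule K M)
  [DirectSum.Decomposition ℳ] [IsGradedBimodule 𝒜 ℳ]

/-- Auxiliary map for the decomposition of `T_A(M)`. -/
def decomposeHom : BimoduleTensorAlgebra K A M →ₐ[K] ⨁ n, grading 𝒜 ℳ n :=
  lift (decomposeAlgebra 𝒜 ℳ) (decomposeModule 𝒜 ℳ)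
    (fun a x => by
      induction a using graded_induction 𝒜 with
      | hadd a a' h h' => simp only [add_smul, add_mul, map_add, h, h']
      | h m a ha =>
        induction x using graded_induction ℳ with
        | hadd b b' h h' => simp only [smul_add, mul_add, map_add, h, h']
        | h n x hx =>
          rw [decomposeAlgebra_of_mem _ _ ha, decomposeModule_of_mem _ _ hx,
            decomposeModule_of_mem _ _ (IsGradedBimodule.smul_mem ha hx), DirectSum.of_mul_of]
          exact congrArg (DirectSum.of (fun n => grading 𝒜 ℳ n) (m + n))
            (Subtype.ext (ofModule_smul a x)))
    (fun a x => by
      induction a using graded_induction 𝒜 with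
      | hadd a a' h h' => simp only [MulOpposite.op_add, add_smul, mul_add, map_add, h, h']
      | h n a ha =>
        induction x using graded_induction ℳ with
        | hadd b b' h h' => simp only [smul_add, add_mul, map_add, h, h']
        | h m x hx =>
          rw [decomposeAlgebra_of_mem _ _ ha, decomposeModule_of_mem _ _ hx,
            decomposeModule_of_mem _ _ (IsGradedBimodule.op_smul_mem hx ha), DirectSum.of_mul_of]
          exact congrArg (DirectSum.of (fun n => grading 𝒜 ℳ n) (m + n))
            (Subtype.ext (ofModule_op_smul a x)))

instance : GradedAlgebra (grading 𝒜 ℳ) :=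
  GradedAlgebra.ofAlgHom (grading 𝒜 ℳ) (decomposeHom 𝒜 ℳ)
    (hom_ext
      (fun a => by
        induction a using graded_induction 𝒜 with
        | hadd a a' h h' => simp only [map_add, h, h']
        | h n a ha => simp [decomposeHom, decomposeAlgebra_of_mem _ _ ha])
      (fun x => by
        induction x using graded_induction ℳ with
        | hadd a a' h h' => simp only [map_add, h, h']
        | h n x hx => simp [decomposeHom, decomposeModule_of_mem _ _ hx]))
    (fun n x => by
      obtain ⟨x, hx⟩ := x
      change decomposeHom 𝒜 ℳ x = _
      induction hx using Submodule.span_induction with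
      | zero => rw [map_zero]; exact (map_zero (DirectSum.of (fun n => grading 𝒜 ℳ n) n)).symm
      | add x y _ _ h h' =>
        rw [map_add, h, h', ← map_add]
        rfl
      | smul c x _ h =>
        rw [map_smul, h]
        exact (map_smul (DirectSum.lof K ℕ (fun n => grading 𝒜 ℳ n) n) c _).symm
      | mem x hx =>
        induction hx with
        | ofAlgebra ha => simp [decomposeHom, decomposeAlgebra_of_mem _ _ ha]
        | ofModule hm => simp [decomposeHom, decomposeModule_of_mem _ _ hm]
        | mul hx hy h h' =>
          rw [map_mul, h, h', DirectSum.of_mul_of]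
          rfl)

end graded
end BimoduleTensorAlgebra
end BimoduleTensorAlgebra

/-! ### The universal antiderivation and the differential envelope of a graded algebra -/

section TensorGrading

variable {K : Type*} [Field K] {A : Type*} [Ring A] [Algebra K A] (𝒜 : ℕ → Submodule K A)

/-- The component `⨁_{r + s = n} A^r ⊗ A^s` of `A ⊗ A`. -/
def tensorGrading (n : ℕ) : Submodule K (A ⊗[K] A) :=
  Submodule.span K {t | ∃ r s, r + s = n ∧ ∃ a ∈ 𝒜 r, ∃ b ∈ 𝒜 s, a ⊗ₜ b = t}

theorem tmul_mem_tensorGrading {r s : ℕ} {a b : A} (ha : a ∈ 𝒜 r) (hb : b ∈ 𝒜 s) :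
    a ⊗ₜ b ∈ tensorGrading 𝒜 (r + s) :=
  Submodule.subset_span ⟨r, s, rfl, a, ha, b, hb, rfl⟩

end TensorGrading

section Envelope

variable {K : Type*} [Field K] {A : Type*} [Ring A] [Algebra K A]
variable (𝒜 : ℕ → Submodule K A) [GradedAlgebra 𝒜]

/-- The twisted product `μ(a ⊗ b) = (-1)^s a b`, `b` homogeneous of degree `s`. -/
def twistedMul : A ⊗[K] A →ₗ[K] A :=
  LinearMap.mul' K A ∘ₗ (gradeInv 𝒜).toLinearMap.lTensor A

@[simp] theorem twistedMul_tmul (a b : A) : twistedMul 𝒜 (a ⊗ₜ b) = a * gradeInv 𝒜 b := rfl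

theorem twistedMul_left (x : A) (t : A ⊗[K] A) :
    twistedMul 𝒜 ((x ⊗ₜ 1) * t) = x * twistedMul 𝒜 t := by
  induction t with
  | zero => simp
  | add t t' h h' => simp only [mul_add, map_add, h, h']
  | tmul a b => simp [mul_assoc]

theorem twistedMul_right (t : A ⊗[K] A) (y : A) :
    twistedMul 𝒜 (t * (1 ⊗ₜ y)) = twistedMul 𝒜 t * gradeInv 𝒜 y := by
  induction t with
  | zero => simp
  | add t t' h h' => simp only [add_mul, map_add, h, h']
  | tmul a b => simp [mul_assoc]

/-- The kernel `J ⊆ A ⊗ A` of the twisted product. With its bimodule structure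
`x (a ⊗ b) y = x a ⊗ b y` and its graduation below it is `Ω¹_gr(A)`. -/
def OmegaOne : Type _ := LinearMap.ker (twistedMul 𝒜)

namespace OmegaOne

instance : AddCommGroup (OmegaOne 𝒜) := inferInstanceAs (AddCommGroup (LinearMap.ker (twistedMul 𝒜)))

instance : Module K (OmegaOne 𝒜) := inferInstanceAs (Module K (LinearMap.ker (twistedMul 𝒜)))

/-- The inclusion of `J` in `A ⊗ A`. -/
def incl : OmegaOne 𝒜 →ₗ[K] A ⊗[K] A := (LinearMap.ker (twistedMul 𝒜)).subtype

theorem incl_injective : Function.Injective (incl 𝒜) := Subtype.val_injective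

theorem twistedMul_incl (t : OmegaOne 𝒜) : twistedMul 𝒜 (incl 𝒜 t) = 0 := t.2

variable {𝒜} in
/-- An element of the kernel of the twisted product, as an element of `J`. -/
def ofKer (t : A ⊗[K] A) (ht : twistedMul 𝒜 t = 0) : OmegaOne 𝒜 := ⟨t, ht⟩

@[simp] theorem incl_ofKer (t : A ⊗[K] A) (ht : twistedMul 𝒜 t = 0) :
    incl 𝒜 (ofKer t ht) = t := rfl

/-- The left action `x (a ⊗ b) = x a ⊗ b`. -/
instance : SMul A (OmegaOne 𝒜) where
  smul x t := ofKer ((x ⊗ₜ 1) * incl 𝒜 t) (by rw [twistedMul_left, twistedMul_incl, mul_zero])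

/-- The right action `(a ⊗ b) y = a ⊗ b y`. -/
instance : SMul Aᵐᵒᵖ (OmegaOne 𝒜) where
  smul y t := ofKer (incl 𝒜 t * (1 ⊗ₜ y.unop))
    (by rw [twistedMul_right, twistedMul_incl, zero_mul])

@[simp] theorem incl_smul (x : A) (t : OmegaOne 𝒜) :
    incl 𝒜 (x • t) = (x ⊗ₜ 1) * incl 𝒜 t := rfl

@[simp] theorem incl_op_smul (y : Aᵐᵒᵖ) (t : OmegaOne 𝒜) :
    incl 𝒜 (y • t) = incl 𝒜 t * (1 ⊗ₜ y.unop) := rfl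

instance : Module A (OmegaOne 𝒜) where
  one_smul t := incl_injective 𝒜 (by simp [← Algebra.TensorProduct.one_def])
  mul_smul x y t := incl_injective 𝒜 (by simp [← mul_assoc])
  smul_zero x := incl_injective 𝒜 (by simp)
  smul_add x t t' := incl_injective 𝒜 (by simp [mul_add])
  add_smul x y t := incl_injective 𝒜 (by simp [TensorProduct.add_tmul, add_mul])
  zero_smul t := incl_injective 𝒜 (by simp)

instance : Module Aᵐᵒᵖ (OmegaOne 𝒜) where
  one_smul t := incl_injective 𝒜 (by simp [← Algebra.TensorProduct.one_def])
  mul_smul x y t := incl_injective 𝒜 (by simp [mul_assoc])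
  smul_zero x := incl_injective 𝒜 (by simp)
  smul_add x t t' := incl_injective 𝒜 (by simp [add_mul])
  add_smul x y t := incl_injective 𝒜 (by simp [TensorProduct.tmul_add, mul_add])
  zero_smul t := incl_injective 𝒜 (by simp)

/-- The universal antiderivation `d : A → J`, `d x = 1 ⊗ x - (-1)^n x ⊗ 1` for `x` homogeneous of
degree `n`. -/
def d : A →ₗ[K] OmegaOne 𝒜 :=
  LinearMap.codRestrict (LinearMap.ker (twistedMul 𝒜))
    (TensorProduct.mk K A A 1 - (TensorProduct.mk K A A).flip 1 ∘ₗ (gradeInv 𝒜).toLinearMap)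
    (fun x => by simp)

@[simp] theorem incl_d (x : A) : incl 𝒜 (d 𝒜 x) = 1 ⊗ₜ x - gradeInv 𝒜 x ⊗ₜ 1 := rfl

@[simp] theorem d_one : d 𝒜 (1 : A) = 0 := incl_injective 𝒜 (by simp)

theorem d_mul (a b : A) :
    d 𝒜 (a * b) = MulOpposite.op b • d 𝒜 a + gradeInv 𝒜 a • d 𝒜 b :=
  incl_injective 𝒜 (by simp [sub_mul, mul_sub])

/-! The graduation of `J`. -/

/-- The graduation of `J`: the component of degree `n + 1` is the part of `J` contained in
`⨁_{r + s = n} A^r ⊗ A^s`. -/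
def grading : ℕ → Submodule K (OmegaOne 𝒜)
  | 0 => ⊥
  | n + 1 => (tensorGrading 𝒜 n).comap (incl 𝒜)

theorem mem_grading_succ {n : ℕ} {t : OmegaOne 𝒜} :
    t ∈ grading 𝒜 (n + 1) ↔ incl 𝒜 t ∈ tensorGrading 𝒜 n := Iff.rfl

/-- Auxiliary map for the decomposition of `A ⊗ A`. -/
def tensorDecompose : A ⊗[K] A →ₗ[K] ⨁ n, tensorGrading 𝒜 n :=
  TensorProduct.lift
    ((DirectSum.toModule K ℕ _ fun r => LinearMap.flip
      (DirectSum.toModule K ℕ _ fun s => LinearMap.mk₂ K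
        (fun (b : 𝒜 s) (a : 𝒜 r) => DirectSum.lof K ℕ (fun n => tensorGrading 𝒜 n) (r + s)
          ⟨(a : A) ⊗ₜ (b : A), tmul_mem_tensorGrading 𝒜 a.2 b.2⟩)
        (fun b b' a => by
          rw [← map_add]; congr 1; ext1; simp [TensorProduct.tmul_add])
        (fun c b a => by
          rw [← map_smul]; congr 1; ext1; simp)
        (fun b a a' => by
          rw [← map_add]; congr 1; ext1; simp [TensorProduct.add_tmul])
        (fun c b a => by
          rw [← map_smul]; congr 1) ∘ₗ LinearMap.id))
      |>.compl₁₂ (DirectSum.decomposeLinearEquiv 𝒜).toLinearMap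
        (DirectSum.decomposeLinearEquiv 𝒜).toLinearMap)

theorem tensorDecompose_tmul {r s : ℕ} {a b : A} (ha : a ∈ 𝒜 r) (hb : b ∈ 𝒜 s) :
    tensorDecompose 𝒜 (a ⊗ₜ b) = DirectSum.of (fun n => tensorGrading 𝒜 n) (r + s)
      ⟨a ⊗ₜ b, tmul_mem_tensorGrading 𝒜 ha hb⟩ := by
  lift a to 𝒜 r using ha
  lift b to 𝒜 s using hb
  simp [tensorDecompose]
  rfl

instance : DirectSum.Decomposition (tensorGrading 𝒜) :=
  DirectSum.Decomposition.ofLinearMap _ (tensorDecompose 𝒜)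
    (by
      refine TensorProduct.ext' fun a b => ?_
      induction a using graded_induction 𝒜 with
      | hadd a a' h h' => simp only [TensorProduct.add_tmul, map_add, h, h']
      | h m a ha =>
        induction b using graded_induction 𝒜 with
        | hadd b b' h h' => simp only [TensorProduct.tmul_add, map_add, h, h']
        | h n b hb =>
          rw [LinearMap.comp_apply, tensorDecompose_tmul 𝒜 ha hb]
          exact DirectSum.coeLinearMap_lof _ _ _)
    (by
      refine DirectSum.linearMap_ext K fun n => LinearMap.ext fun t => ?_
      obtain ⟨t, ht⟩ := t
      rw [LinearMap.comp_apply, LinearMap.comp_apply, DirectSum.coeLinearMap_lof]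
      change tensorDecompose 𝒜 t = DirectSum.lof K ℕ (fun n => tensorGrading 𝒜 n) n ⟨t, ht⟩
      induction ht using Submodule.span_induction with
      | zero => rw [map_zero]; exact (map_zero _).symm
      | add x y _ _ h h' => rw [map_add, h, h', ← map_add]; rfl
      | smul c x _ h => rw [map_smul, h, ← map_smul]; rfl
      | mem t ht =>
        obtain ⟨r, s, rfl, a, ha, b, hb, rfl⟩ := ht
        exact tensorDecompose_tmul 𝒜 ha hb)

/-- The projection `a ⊗ b ↦ a ⊗ b - μ(a ⊗ b) ⊗ 1` of `A ⊗ A` onto `J`. -/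
def proj : A ⊗[K] A →ₗ[K] OmegaOne 𝒜 :=
  LinearMap.codRestrict (LinearMap.ker (twistedMul 𝒜))
    (LinearMap.id - (TensorProduct.mk K A A).flip 1 ∘ₗ twistedMul 𝒜)
    (fun x => by simp)

@[simp] theorem incl_proj (t : A ⊗[K] A) :
    incl 𝒜 (proj 𝒜 t) = t - twistedMul 𝒜 t ⊗ₜ 1 := rfl

theorem proj_incl (t : OmegaOne 𝒜) : proj 𝒜 (incl 𝒜 t) = t :=
  incl_injective 𝒜 (by simp [twistedMul_incl])

theorem twistedMul_mem {n : ℕ} {t : A ⊗[K] A} (ht : t ∈ tensorGrading 𝒜 n) :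
    twistedMul 𝒜 t ∈ 𝒜 n := by
  induction ht using Submodule.span_induction with
  | zero => simp
  | add x y _ _ h h' => rw [map_add]; exact add_mem h h'
  | smul c x _ h => rw [map_smul]; exact Submodule.smul_mem _ c h
  | mem t ht =>
    obtain ⟨r, s, rfl, a, ha, b, hb, rfl⟩ := ht
    rw [twistedMul_tmul, gradeInv_of_mem 𝒜 hb, mul_smul_comm]
    exact Submodule.smul_mem _ _ (SetLike.GradedMul.mul_mem ha hb)

theorem proj_mem {n : ℕ} {t : A ⊗[K] A} (ht : t ∈ tensorGrading 𝒜 n) :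
    proj 𝒜 t ∈ grading 𝒜 (n + 1) := by
  rw [mem_grading_succ, incl_proj]
  exact sub_mem ht (tmul_mem_tensorGrading 𝒜 (s := 0) (twistedMul_mem 𝒜 ht)
    (SetLike.GradedOne.one_mem (A := 𝒜)))

/-- Auxiliary map for the decomposition of `J`. -/
def collect : (⨁ n, tensorGrading 𝒜 n) →ₗ[K] ⨁ n, grading 𝒜 n :=
  DirectSum.toModule K ℕ _ fun n => DirectSum.lof K ℕ (fun n => grading 𝒜 n) (n + 1) ∘ₗ
    (proj 𝒜).restrict fun _ ht => proj_mem 𝒜 ht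

theorem coe_collect (x : ⨁ n, tensorGrading 𝒜 n) :
    DirectSum.coeLinearMap (grading 𝒜) (collect 𝒜 x) =
      proj 𝒜 (DirectSum.coeLinearMap (tensorGrading 𝒜) x) := by
  have h : DirectSum.coeLinearMap (grading 𝒜) ∘ₗ collect 𝒜 =
      proj 𝒜 ∘ₗ DirectSum.coeLinearMap (tensorGrading 𝒜) := by
    refine DirectSum.linearMap_ext K fun n => LinearMap.ext fun t => ?_
    simp only [LinearMap.comp_apply, collect, DirectSum.toModule_lof, DirectSum.coeLinearMap_lof]
    rfl
  exact LinearMap.congr_fun h x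

instance : DirectSum.Decomposition (grading 𝒜) :=
  DirectSum.Decomposition.ofLinearMap _ (collect 𝒜 ∘ₗ
      (DirectSum.decomposeLinearEquiv (tensorGrading 𝒜)).toLinearMap ∘ₗ incl 𝒜)
    (by
      refine LinearMap.ext fun t => ?_
      rw [LinearMap.comp_apply, LinearMap.comp_apply, coe_collect, LinearMap.comp_apply]
      exact (congrArg (proj 𝒜)
        ((DirectSum.decomposeLinearEquiv (tensorGrading 𝒜)).symm_apply_apply _)).trans
        (proj_incl 𝒜 t))
    (by
      refine DirectSum.linearMap_ext K fun n => LinearMap.ext fun t => ?_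
      obtain ⟨t, ht⟩ := t
      rw [LinearMap.comp_apply, LinearMap.comp_apply, DirectSum.coeLinearMap_lof]
      cases n with
      | zero =>
        obtain rfl : t = 0 := ht
        rw [map_zero]; exact (map_zero _).symm
      | succ n =>
        have h : DirectSum.decomposeLinearEquiv (tensorGrading 𝒜) (incl 𝒜 t) =
            DirectSum.lof K ℕ (fun n => tensorGrading 𝒜 n) n ⟨incl 𝒜 t, ht⟩ :=
          DirectSum.decompose_of_mem (tensorGrading 𝒜) (x := incl 𝒜 t) ht
        simp only [LinearMap.comp_apply, LinearEquiv.coe_coe]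
        rw [h, collect, DirectSum.toModule_lof]
        exact congrArg (DirectSum.lof K ℕ (fun n => grading 𝒜 n) (n + 1))
          (Subtype.ext (proj_incl 𝒜 t)))

theorem left_mem {m n : ℕ} {a : A} (ha : a ∈ 𝒜 m) {t : A ⊗[K] A} (ht : t ∈ tensorGrading 𝒜 n) :
    (a ⊗ₜ 1) * t ∈ tensorGrading 𝒜 (m + n) := by
  induction ht using Submodule.span_induction with
  | zero => simp
  | add x y _ _ h h' => rw [mul_add]; exact add_mem h h'
  | smul c x _ h => rw [mul_smul_comm]; exact Submodule.smul_mem _ c h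
  | mem t ht =>
    obtain ⟨r, s, rfl, b, hb, c, hc, rfl⟩ := ht
    rw [Algebra.TensorProduct.tmul_mul_tmul, one_mul, ← add_assoc]
    exact tmul_mem_tensorGrading 𝒜 (SetLike.GradedMul.mul_mem ha hb) hc

theorem right_mem {m n : ℕ} {a : A} (ha : a ∈ 𝒜 n) {t : A ⊗[K] A} (ht : t ∈ tensorGrading 𝒜 m) :
    t * (1 ⊗ₜ a) ∈ tensorGrading 𝒜 (m + n) := by
  induction ht using Submodule.span_induction with
  | zero => simp
  | add x y _ _ h h' => rw [add_mul]; exact add_mem h h'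
  | smul c x _ h => rw [smul_mul_assoc]; exact Submodule.smul_mem _ c h
  | mem t ht =>
    obtain ⟨r, s, rfl, b, hb, c, hc, rfl⟩ := ht
    rw [Algebra.TensorProduct.tmul_mul_tmul, mul_one, add_assoc]
    exact tmul_mem_tensorGrading 𝒜 hb (SetLike.GradedMul.mul_mem hc ha)

instance : BimoduleTensorAlgebra.IsGradedBimodule 𝒜 (grading 𝒜) where
  smul_mem {m n a x} ha hx := by
    cases n with
    | zero =>
      obtain rfl : x = 0 := hx
      rw [smul_zero]; exact zero_mem _
    | succ n => exact left_mem 𝒜 ha hx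
  op_smul_mem {m n a x} hx ha := by
    cases m with
    | zero =>
      obtain rfl : x = 0 := hx
      rw [smul_zero]; exact zero_mem _
    | succ m =>
      rw [Nat.add_right_comm]
      exact right_mem 𝒜 ha hx

theorem d_mem {n : ℕ} {a : A} (ha : a ∈ 𝒜 n) : d 𝒜 a ∈ grading 𝒜 (n + 1) := by
  have h1 : (1 : A) ∈ 𝒜 0 := SetLike.GradedOne.one_mem
  rw [mem_grading_succ, incl_d, gradeInv_of_mem 𝒜 ha]
  refine sub_mem ?_ ?_
  · have h := tmul_mem_tensorGrading 𝒜 h1 ha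
    rwa [zero_add] at h
  · exact tmul_mem_tensorGrading 𝒜 (r := n) (s := 0) (Submodule.smul_mem _ _ ha) h1

end OmegaOne

/-- The algebra `Ω_gr(A) = T_A(Ω¹_gr(A))`. -/
abbrev OmegaGr : Type _ := BimoduleTensorAlgebra K A (OmegaOne 𝒜)

namespace OmegaGr

/-- The graduation of `Ω_gr(A)` induced by the ones of `A` and `Ω¹_gr(A)`. -/
abbrev grading : ℕ → Submodule K (OmegaGr 𝒜) :=
  BimoduleTensorAlgebra.grading 𝒜 (OmegaOne.grading 𝒜)

/-- The canonical injection of `A` in `Ω_gr(A)`. -/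
abbrev ofAlgebra : A →ₐ[K] OmegaGr 𝒜 := BimoduleTensorAlgebra.ofAlgebra K A (OmegaOne 𝒜)

/-- The canonical injection of `Ω¹_gr(A)` in `Ω_gr(A)`. -/
abbrev ofOne : OmegaOne 𝒜 →ₗ[K] OmegaGr 𝒜 := BimoduleTensorAlgebra.ofModule K A (OmegaOne 𝒜)

/-- `a ↦ d a`, from `A` to `Ω_gr(A)`. -/
def dA : A →ₗ[K] OmegaGr 𝒜 := ofOne 𝒜 ∘ₗ OmegaOne.d 𝒜

theorem dA_mul (a b : A) :
    dA 𝒜 (a * b) = dA 𝒜 a * ofAlgebra 𝒜 b + ofAlgebra 𝒜 (gradeInv 𝒜 a) * dA 𝒜 b := by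
  simp only [dA, LinearMap.comp_apply, OmegaOne.d_mul, map_add,
    BimoduleTensorAlgebra.ofModule_smul, BimoduleTensorAlgebra.ofModule_op_smul]

theorem gradeInv_ofAlgebra (a : A) :
    gradeInv (grading 𝒜) (ofAlgebra 𝒜 a) = ofAlgebra 𝒜 (gradeInv 𝒜 a) := by
  induction a using graded_induction 𝒜 with
  | hadd a b h h' => simp only [map_add, h, h']
  | h n a ha =>
    rw [gradeInv_of_mem 𝒜 ha, map_smul]
    exact gradeInv_of_mem (grading 𝒜) (BimoduleTensorAlgebra.ofAlgebra_mem_grading _ _ ha)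

theorem gradeInv_ofOne {n : ℕ} {t : OmegaOne 𝒜} (ht : t ∈ OmegaOne.grading 𝒜 n) :
    gradeInv (grading 𝒜) (ofOne 𝒜 t) = (-1 : K) ^ n • ofOne 𝒜 t :=
  gradeInv_of_mem (grading 𝒜) (BimoduleTensorAlgebra.ofModule_mem_grading _ _ ht)

theorem gradeInv_dA (a : A) :
    gradeInv (grading 𝒜) (dA 𝒜 a) = - dA 𝒜 (gradeInv 𝒜 a) := by
  induction a using graded_induction 𝒜 with
  | hadd a b h h' => simp only [map_add, h, h', neg_add]
  | h n a ha =>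
    rw [gradeInv_of_mem 𝒜 ha, map_smul, dA, LinearMap.comp_apply,
      gradeInv_ofOne 𝒜 (OmegaOne.d_mem 𝒜 ha), pow_succ]
    simp

/-- `t ↦ ∑ x (d y)` for `t = ∑ x ⊗ y` in `A ⊗ A`. -/
def mulD : A ⊗[K] A →ₗ[K] OmegaGr 𝒜 :=
  TensorProduct.lift
    ((LinearMap.mul K (OmegaGr 𝒜)).compl₁₂ (ofAlgebra 𝒜).toLinearMap (dA 𝒜))

@[simp] theorem mulD_tmul (x y : A) : mulD 𝒜 (x ⊗ₜ y) = ofAlgebra 𝒜 x * dA 𝒜 y := rfl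

/-- `t ↦ ∑ (d x) (d y)` for `t = ∑ x ⊗ y` in `A ⊗ A`. -/
def dMulD : A ⊗[K] A →ₗ[K] OmegaGr 𝒜 :=
  TensorProduct.lift ((LinearMap.mul K (OmegaGr 𝒜)).compl₁₂ (dA 𝒜) (dA 𝒜))

@[simp] theorem dMulD_tmul (x y : A) : dMulD 𝒜 (x ⊗ₜ y) = dA 𝒜 x * dA 𝒜 y := rfl

/-- The restriction of `d` to `Ω¹_gr(A)`: an element `t = ∑ x ⊗ y` of `J` is `∑ x (d y)`, and
`d t = ∑ (d x) (d y)`. -/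
def dOne : OmegaOne 𝒜 →ₗ[K] OmegaGr 𝒜 := dMulD 𝒜 ∘ₗ OmegaOne.incl 𝒜

theorem mulD_eq (t : A ⊗[K] A) : mulD 𝒜 t = ofOne 𝒜 (OmegaOne.proj 𝒜 t) := by
  induction t with
  | zero => simp
  | add t t' h h' => simp only [map_add, h, h']
  | tmul x y =>
    rw [mulD_tmul, dA, LinearMap.comp_apply, ← BimoduleTensorAlgebra.ofModule_smul]
    refine congrArg (ofOne 𝒜) (OmegaOne.incl_injective 𝒜 ?_)
    simp [mul_sub]

theorem ofOne_eq (t : OmegaOne 𝒜) : ofOne 𝒜 t = mulD 𝒜 (OmegaOne.incl 𝒜 t) := by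
  rw [mulD_eq, OmegaOne.proj_incl]

theorem dMulD_left (a : A) (t : A ⊗[K] A) :
    dMulD 𝒜 ((a ⊗ₜ 1) * t) =
      dA 𝒜 a * mulD 𝒜 t + ofAlgebra 𝒜 (gradeInv 𝒜 a) * dMulD 𝒜 t := by
  induction t with
  | zero => simp
  | add t t' h h' => simp only [mul_add, map_add, h, h']; abel
  | tmul x y => simp [dA_mul, add_mul, mul_assoc]

theorem dMulD_right (a : A) (t : A ⊗[K] A) :
    dMulD 𝒜 (t * (1 ⊗ₜ a)) = dMulD 𝒜 t * ofAlgebra 𝒜 a +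
      (dA 𝒜 (twistedMul 𝒜 t) + gradeInv (grading 𝒜) (mulD 𝒜 t)) * dA 𝒜 a := by
  induction t with
  | zero => simp
  | add t t' h h' => simp only [add_mul, map_add, h, h']; abel
  | tmul x y =>
    have h : gradeInv 𝒜 (gradeInv 𝒜 y) = y := by
      induction y using graded_induction 𝒜 with
      | hadd a b h h' => simp only [map_add, h, h']
      | h n a ha =>
        rw [gradeInv_of_mem 𝒜 ha, map_smul, gradeInv_of_mem 𝒜 ha, smul_smul, ← pow_add,
          Even.neg_one_pow ⟨n, rfl⟩, one_smul]
    simp only [Algebra.TensorProduct.tmul_mul_tmul, mul_one, dMulD_tmul, mulD_tmul,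
      twistedMul_tmul, dA_mul, map_mul, gradeInv_dA, gradeInv_ofAlgebra]
    noncomm_ring

theorem dOne_smul (a : A) (t : OmegaOne 𝒜) :
    dOne 𝒜 (a • t) =
      dA 𝒜 a * ofOne 𝒜 t + ofAlgebra 𝒜 (gradeInv 𝒜 a) * dOne 𝒜 t := by
  rw [ofOne_eq]
  exact dMulD_left 𝒜 a _

theorem dOne_op_smul (a : A) (t : OmegaOne 𝒜) :
    dOne 𝒜 (MulOpposite.op a • t) =
      dOne 𝒜 t * ofAlgebra 𝒜 a + gradeInv (grading 𝒜) (ofOne 𝒜 t) * dA 𝒜 a := by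
  have h := dMulD_right 𝒜 a (OmegaOne.incl 𝒜 t)
  rw [OmegaOne.twistedMul_incl, map_zero, zero_add, ← ofOne_eq] at h
  exact h

section upper

variable {B : Type*} [Ring B]

/-- Upper triangular `2 × 2` matrices. -/
def upper (a b c : B) : Matrix (Fin 2) (Fin 2) B := !![a, b; 0, c]

theorem upper_mul (a b c a' b' c' : B) :
    upper a b c * upper a' b' c' = upper (a * a') (a * b' + b * c') (c * c') := by
  simp [upper]

theorem upper_add (a b c a' b' c' : B) :
    upper a b c + upper a' b' c' = upper (a + a') (b + b') (c + c') := by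
  simp [upper]

theorem upper_smul [Algebra K B] (x : K) (a b c : B) : x • upper a b c = upper (x • a) (x • b) (x • c) := by
  simp [upper]

theorem upper_one : upper (1 : B) 0 1 = 1 := Matrix.one_fin_two.symm

end upper

/-- The algebra homomorphism `w ↦ (σ(w), d w; 0, w)` into `2 × 2` matrices, where `σ` is the
grading automorphism, which encodes the antiderivation `d`. -/
def dMatrix : OmegaGr 𝒜 →ₐ[K] Matrix (Fin 2) (Fin 2) (OmegaGr 𝒜) :=
  BimoduleTensorAlgebra.lift
    (AlgHom.ofLinearMap
      { toFun := fun a => upper (ofAlgebra 𝒜 (gradeInv 𝒜 a)) (dA 𝒜 a) (ofAlgebra 𝒜 a)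
        map_add' := fun a b => by simp only [map_add, upper_add]
        map_smul' := fun c a => by simp only [map_smul, upper_smul, RingHom.id_apply] }
      (by
        change upper (ofAlgebra 𝒜 (gradeInv 𝒜 1)) (dA 𝒜 1) (ofAlgebra 𝒜 1) = 1
        simp only [dA, LinearMap.comp_apply, OmegaOne.d_one, map_one, map_zero, upper_one])
      (fun a b => by
        change upper _ _ _ = upper _ _ _ * upper _ _ _
        rw [upper_mul, dA_mul, map_mul (gradeInv 𝒜), map_mul (ofAlgebra 𝒜), map_mul (ofAlgebra 𝒜),
          add_comm]))
    { toFun := fun t => upper (gradeInv (grading 𝒜) (ofOne 𝒜 t)) (dOne 𝒜 t) (ofOne 𝒜 t)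
      map_add' := fun a b => by simp only [map_add, upper_add]
      map_smul' := fun c a => by simp only [map_smul, upper_smul, RingHom.id_apply] }
    (fun a t => by
      change upper _ _ _ = upper _ _ _ * upper _ _ _
      rw [upper_mul, dOne_smul, BimoduleTensorAlgebra.ofModule_smul, map_mul, gradeInv_ofAlgebra,
        add_comm])
    (fun a t => by
      change upper _ _ _ = upper _ _ _ * upper _ _ _
      rw [upper_mul, dOne_op_smul, BimoduleTensorAlgebra.ofModule_op_smul, map_mul,
        gradeInv_ofAlgebra, add_comm])

theorem dMatrix_ofAlgebra (a : A) : dMatrix 𝒜 (ofAlgebra 𝒜 a) =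
    upper (ofAlgebra 𝒜 (gradeInv 𝒜 a)) (dA 𝒜 a) (ofAlgebra 𝒜 a) :=
  BimoduleTensorAlgebra.lift_ofAlgebra _ _ _ _ a

theorem dMatrix_ofOne (t : OmegaOne 𝒜) : dMatrix 𝒜 (ofOne 𝒜 t) =
    upper (gradeInv (grading 𝒜) (ofOne 𝒜 t)) (dOne 𝒜 t) (ofOne 𝒜 t) :=
  BimoduleTensorAlgebra.lift_ofModule _ _ _ _ t

/-- The differential of `Ω_gr(A)`. -/
def d : OmegaGr 𝒜 →ₗ[K] OmegaGr 𝒜 where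
  toFun w := dMatrix 𝒜 w 0 1
  map_add' _ _ := by simp
  map_smul' _ _ := by simp

theorem d_ofAlgebra (a : A) : d 𝒜 (ofAlgebra 𝒜 a) = ofOne 𝒜 (OmegaOne.d 𝒜 a) :=
  congrFun (congrFun (dMatrix_ofAlgebra 𝒜 a) 0) 1

theorem d_ofOne (t : OmegaOne 𝒜) : d 𝒜 (ofOne 𝒜 t) = dOne 𝒜 t :=
  congrFun (congrFun (dMatrix_ofOne 𝒜 t) 0) 1

/-- `Ω_gr(A)` is spanned by the products of homogeneous elements of `A` and `Ω¹_gr(A)`. -/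
theorem induction {P : OmegaGr 𝒜 → Prop}
    (hA : ∀ n, ∀ a ∈ 𝒜 n, P (ofAlgebra 𝒜 a))
    (hJ : ∀ n, ∀ t ∈ OmegaOne.grading 𝒜 n, P (ofOne 𝒜 t))
    (hmul : ∀ x y, P x → P y → P (x * y)) (hadd : ∀ x y, P x → P y → P (x + y))
    (hsmul : ∀ (c : K) x, P x → P (c • x)) (w : OmegaGr 𝒜) : P w := by
  induction w using graded_induction (grading 𝒜) with
  | hadd x y h h' => exact hadd x y h h'
  | h n w hw =>
    induction hw using Submodule.span_induction with
    | zero => simpa using hsmul 0 _ (hA 0 1 SetLike.GradedOne.one_mem)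
    | add x y _ _ h h' => exact hadd x y h h'
    | smul c x _ h => exact hsmul c x h
    | mem x hx =>
      induction hx with
      | ofAlgebra ha => exact hA _ _ ha
      | ofModule ht => exact hJ _ _ ht
      | mul _ _ h h' => exact hmul _ _ h h'

theorem dMatrix_apply (w : OmegaGr 𝒜) :
    dMatrix 𝒜 w = upper (gradeInv (grading 𝒜) w) (d 𝒜 w) w := by
  induction w using induction 𝒜 with
  | hA n a ha => rw [dMatrix_ofAlgebra, gradeInv_ofAlgebra, d_ofAlgebra]; rfl
  | hJ n t ht => rw [dMatrix_ofOne, d_ofOne]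
  | hadd x y h h' => simp only [map_add, h, h', upper_add]
  | hsmul c x h => simp only [map_smul, h, upper_smul]
  | hmul x y h h' =>
    have hd : d 𝒜 (x * y) = gradeInv (grading 𝒜) x * d 𝒜 y + d 𝒜 x * y := by
      change dMatrix 𝒜 (x * y) 0 1 = _
      rw [map_mul, h, h', upper_mul]
      rfl
    rw [map_mul, map_mul, h, h', upper_mul, hd]

theorem d_mul (x y : OmegaGr 𝒜) :
    d 𝒜 (x * y) = d 𝒜 x * y + gradeInv (grading 𝒜) x * d 𝒜 y := by
  change dMatrix 𝒜 (x * y) 0 1 = _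
  rw [map_mul, dMatrix_apply, dMatrix_apply, upper_mul, add_comm]
  rfl

theorem dOne_mem {n : ℕ} {t : OmegaOne 𝒜} (ht : t ∈ OmegaOne.grading 𝒜 n) :
    dOne 𝒜 t ∈ grading 𝒜 (n + 1) := by
  have hA : ∀ {n : ℕ} {a : A}, a ∈ 𝒜 n → dA 𝒜 a ∈ grading 𝒜 (n + 1) := fun ha =>
    BimoduleTensorAlgebra.ofModule_mem_grading _ _ (OmegaOne.d_mem 𝒜 ha)
  cases n with
  | zero =>
    obtain rfl : t = 0 := ht
    rw [map_zero]; exact zero_mem _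
  | succ n =>
    change OmegaOne.incl 𝒜 t ∈ tensorGrading 𝒜 n at ht
    change dMulD 𝒜 (OmegaOne.incl 𝒜 t) ∈ _
    generalize OmegaOne.incl 𝒜 t = t' at ht ⊢
    induction ht using Submodule.span_induction with
    | zero => rw [map_zero]; exact zero_mem _
    | add x y _ _ h h' => rw [map_add]; exact add_mem h h'
    | smul c x _ h => rw [map_smul]; exact Submodule.smul_mem _ c h
    | mem t ht =>
      obtain ⟨r, s, rfl, a, ha, b, hb, rfl⟩ := ht
      have h := SetLike.GradedMul.mul_mem (hA ha) (hA hb)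
      rwa [show r + 1 + (s + 1) = r + s + 1 + 1 by omega] at h

theorem d_mem {n : ℕ} {w : OmegaGr 𝒜} (hw : w ∈ grading 𝒜 n) : d 𝒜 w ∈ grading 𝒜 (n + 1) := by
  induction hw using Submodule.span_induction with
  | zero => rw [map_zero]; exact zero_mem _
  | add x y _ _ h h' => rw [map_add]; exact add_mem h h'
  | smul c x _ h => rw [map_smul]; exact Submodule.smul_mem _ c h
  | mem x hx =>
    induction hx with
    | ofAlgebra ha =>
      exact d_ofAlgebra 𝒜 _ ▸
        BimoduleTensorAlgebra.ofModule_mem_grading _ _ (OmegaOne.d_mem 𝒜 ha)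
    | ofModule ht => exact d_ofOne 𝒜 _ ▸ dOne_mem 𝒜 ht
    | @mul m n x y hx hy h h' =>
      have hx' : x ∈ grading 𝒜 m := Submodule.subset_span hx
      have hy' : y ∈ grading 𝒜 n := Submodule.subset_span hy
      rw [d_mul, gradeInv_of_mem (grading 𝒜) hx', smul_mul_assoc]
      refine add_mem ?_ (Submodule.smul_mem _ _ ?_)
      · rw [Nat.add_right_comm]
        exact SetLike.GradedMul.mul_mem h hy'
      · rw [add_assoc]
        exact SetLike.GradedMul.mul_mem hx' h'

theorem gradeInv_d (w : OmegaGr 𝒜) :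
    gradeInv (grading 𝒜) (d 𝒜 w) = - d 𝒜 (gradeInv (grading 𝒜) w) := by
  induction w using graded_induction (grading 𝒜) with
  | hadd x y h h' => simp only [map_add, h, h', neg_add]
  | h n w hw =>
    rw [gradeInv_of_mem (grading 𝒜) hw, gradeInv_of_mem (grading 𝒜) (d_mem 𝒜 hw), map_smul,
      pow_succ]
    simp

theorem d_dA (a : A) : d 𝒜 (dA 𝒜 a) = 0 := by
  rw [dA, LinearMap.comp_apply, d_ofOne, dOne, LinearMap.comp_apply, OmegaOne.incl_d, map_sub,
    dMulD_tmul, dMulD_tmul]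
  simp [dA]

theorem d_d (w : OmegaGr 𝒜) : d 𝒜 (d 𝒜 w) = 0 := by
  induction w using induction 𝒜 with
  | hA n a ha => rw [d_ofAlgebra]; exact d_dA 𝒜 a
  | hJ n t ht =>
    rw [d_ofOne, dOne, LinearMap.comp_apply]
    induction OmegaOne.incl 𝒜 t with
    | zero => simp
    | add t t' h h' => simp only [map_add, h, h', add_zero]
    | tmul x y => simp [d_mul, d_dA]
  | hadd x y h h' => simp only [map_add, h, h', add_zero]
  | hsmul c x h => simp only [map_smul, h, smul_zero]
  | hmul x y h h' =>
    simp [d_mul, h, h', gradeInv_d]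

end OmegaGr

end Envelope

/-! ### Operations of a Hopf algebra and connections -/

section Operations

open CategoryTheory



/-- A (`ℕ`-)graded differential algebra over `K`: a unital associative graded algebra with an
antiderivation `d` of degree `1` and of square zero. -/
structure GradedDiffAlgebra (K : Type u) [Field K] where
  /-- The underlying algebra. -/
  carrier : Type w
  [ring : Ring carrier]
  [algebra : Algebra K carrier]
  /-- The homogeneous components. -/
  grading : ℕ → Submodule K carrier
  [gradedAlgebra : GradedAlgebra grading]
  /-- The differential. -/
  d : carrier →ₗ[K] carrier
  d_mem : ∀ (n : ℕ) (a : carrier), a ∈ grading n → d a ∈ grading (n + 1)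
  d_mul : ∀ (n : ℕ) (a b : carrier), a ∈ grading n →
    d (a * b) = d a * b + (-1 : K) ^ n • (a * d b)
  d_d : ∀ a : carrier, d (d a) = 0

attribute [instance] GradedDiffAlgebra.ring GradedDiffAlgebra.algebra
  GradedDiffAlgebra.gradedAlgebra

variable (K : Type u) [Field K] (H : Type v) [Ring H] [HopfAlgebra K H]

variable {K H} in
/-- `L_h = d i_h + i_h d + ε(h) I`, for a linear map `d` and a family `i` of linear maps. -/
def lieDerivative {V : Type*} [AddCommGroup V] [Module K V] (d : Module.End K V)
    (i : H →ₗ[K] Module.End K V) (h : H) : Module.End K V :=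
  d ∘ₗ i h + i h ∘ₗ d + (Coalgebra.counit h : K) • LinearMap.id

variable {K} in
/-- An operation of the Hopf algebra `H` in the graded differential algebra `Ω`.
Here `ℛ K h` is a representation `Δ h = ∑ⱼ h⁽¹⁾ⱼ ⊗ h⁽²⁾ⱼ` with
`h⁽¹⁾ⱼ = (ℛ K h).left j`, `h⁽²⁾ⱼ = (ℛ K h).right j`. -/
structure HopfOperation (Ω : GradedDiffAlgebra.{u, w} K) where
  /-- The contractions `h ↦ i_h`. -/
  i : H →ₗ[K] Module.End K Ω.carrier
  i_degree_zero : ∀ (h : H) (a : Ω.carrier), a ∈ Ω.grading 0 → i h a = 0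
  i_mem : ∀ (h : H) (n : ℕ) (a : Ω.carrier), a ∈ Ω.grading (n + 1) → i h a ∈ Ω.grading n
  i_one : i 1 = 0
  i_mul : ∀ (h : H) (n : ℕ) (a b : Ω.carrier), a ∈ Ω.grading n →
    i h (a * b) =
      ∑ j ∈ (ℛ K h).index, i ((ℛ K h).left j) a * lieDerivative Ω.d i ((ℛ K h).right j) b +
        (-1 : K) ^ n • (a * i h b)
  i_comp_L : ∀ g h : H, i g ∘ₗ lieDerivative Ω.d i h =
    ∑ j ∈ (ℛ K h).index,
      lieDerivative Ω.d i ((ℛ K h).left j) ∘ₗ i (rightAd K ((ℛ K h).right j) g)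
  L_comp_L : ∀ h g : H,
    lieDerivative Ω.d i h ∘ₗ lieDerivative Ω.d i g = lieDerivative Ω.d i (h * g)

variable {K H} in
/-- The maps `L_h = d i_h + i_h d + ε(h) I` of an operation of `H` in `Ω`. -/
def HopfOperation.L {Ω : GradedDiffAlgebra.{u, w} K} (op : HopfOperation H Ω) (h : H) :
    Module.End K Ω.carrier :=
  lieDerivative Ω.d op.i h

variable {K H} in
/-- The maps `L_h = d i_h + i_h d + ε(h) I` of `C(H)`. -/
def MultilinearForms.L (h : H) : Module.End K (MultilinearForms K H) :=
  lieDerivative MultilinearForms.diff MultilinearForms.contraction h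

variable {K H} in
/-- `α : C(H) → Ω` is an algebraic connection on the `H`-operation in `Ω`: it is a homomorphism of
graded algebras which commutes with the `i_h` and the `L_h`. -/
structure IsConnection {Ω : GradedDiffAlgebra.{u, w} K} (op : HopfOperation H Ω)
    (α : MultilinearForms K H →ₐ[K] Ω.carrier) : Prop where
  map_mem : ∀ (n : ℕ) (Ψ : MultilinearForms K H),
    Ψ ∈ MultilinearForms.grading K H n → α Ψ ∈ Ω.grading n
  i_comm : ∀ (h : H) (Ψ : MultilinearForms K H),
    op.i h (α Ψ) = α (MultilinearForms.contraction h Ψ)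
  L_comm : ∀ (h : H) (Ψ : MultilinearForms K H), op.L h (α Ψ) = α (MultilinearForms.L h Ψ)

/-- `H`-operations with connections `(i, Ω, α)`. -/
structure HopfOperationConn where
  /-- The graded differential algebra. -/
  Ω : GradedDiffAlgebra.{u, w} K
  /-- The operation of `H` in it. -/
  op : HopfOperation H Ω
  /-- The connection. -/
  α : MultilinearForms K H →ₐ[K] Ω.carrier
  isConnection : IsConnection op α

namespace HopfOperationConn

variable {K H}

/-- Morphisms of `H`-operations with connections: homomorphisms of graded differential algebras
which commute with the `i_h` and map the connection on the connection. -/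
@[ext]
structure Hom (X : HopfOperationConn.{u, v, w} K H) (Y : HopfOperationConn.{u, v, w'} K H) where
  /-- The homomorphism of algebras. -/
  toAlgHom : X.Ω.carrier →ₐ[K] Y.Ω.carrier
  map_mem : ∀ (n : ℕ) (a : X.Ω.carrier), a ∈ X.Ω.grading n → toAlgHom a ∈ Y.Ω.grading n
  map_d : ∀ a : X.Ω.carrier, toAlgHom (X.Ω.d a) = Y.Ω.d (toAlgHom a)
  map_i : ∀ (h : H) (a : X.Ω.carrier), toAlgHom (X.op.i h a) = Y.op.i h (toAlgHom a)
  map_connection : toAlgHom.comp X.α = Y.α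

/-- The category of `H`-operations with connections. -/
instance : Category (HopfOperationConn.{u, v, w} K H) where
  Hom X Y := Hom X Y
  id X :=
    { toAlgHom := AlgHom.id K X.Ω.carrier
      map_mem := fun _ _ ha => ha
      map_d := fun _ => rfl
      map_i := fun _ _ => rfl
      map_connection := rfl }
  comp {X Y Z} f g :=
    { toAlgHom := g.toAlgHom.comp f.toAlgHom
      map_mem := fun n a ha => g.map_mem n _ (f.map_mem n a ha)
      map_d := fun a => by simp [f.map_d, g.map_d]
      map_i := fun h a => by simp [f.map_i, g.map_i]
      map_connection := by rw [AlgHom.comp_assoc, f.map_connection, g.map_connection] }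
  id_comp _ := rfl
  comp_id _ := rfl
  assoc _ _ _ := rfl

end HopfOperationConn

/-! ### The Weil algebra -/

variable {K} in
/-- The differential envelope `Ω_gr(A)` of a graded algebra `A`, as a graded differential
algebra. -/
def differentialEnvelope {A : Type w} [Ring A] [Algebra K A] (𝒜 : ℕ → Submodule K A)
    [GradedAlgebra 𝒜] : GradedDiffAlgebra K where
  carrier := OmegaGr 𝒜
  grading := OmegaGr.grading 𝒜
  d := OmegaGr.d 𝒜
  d_mem _ _ ha := OmegaGr.d_mem 𝒜 ha
  d_mul n a b ha := by
    rw [OmegaGr.d_mul, gradeInv_of_mem (OmegaGr.grading 𝒜) ha, smul_mul_assoc]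
  d_d a := OmegaGr.d_d 𝒜 a

/-- The graded differential algebra `W(H) = Ω_gr(C(H))`. -/
def weilAlgebra : GradedDiffAlgebra K := differentialEnvelope (MultilinearForms.grading K H)

/-- The canonical injection `α_W` of `C(H)` in `W(H)`. -/
def weilConnection : MultilinearForms K H →ₐ[K] (weilAlgebra K H).carrier :=
  OmegaGr.ofAlgebra (MultilinearForms.grading K H)

/-- `W(H)` with a given operation of `H` for which `α_W` is a connection. -/
def weilOperationConn (op : HopfOperation H (weilAlgebra K H))
    (hop : IsConnection op (weilConnection K H)) : HopfOperationConn K H where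
  Ω := weilAlgebra K H
  op := op
  α := weilConnection K H
  isConnection := hop

end Operations

end

/-! The proof has a computation in C(H), an extension principle for Ω_gr(A) with A any graded
algebra, and a generation argument.

In C(H), the operator d i_h + i_h d + ε(h) is the diagonal coadjoint action of H
(`MultilinearForms.cartan`). The differential of C(H) enters the notion of connection only through
L_h, hence only through this action. A form is determined by its part of degree 0 and by the forms
ι_x Φ obtained by inserting x as first argument, and insertion obeys short exchange rules. With Q_h
the summand p = 0 of i_h they read ι_x coad_h = ∑ coad_{h⁽²⁾} ι_{ad(h⁽¹⁾)x}, ι_x i_h = ι_x Q_h - i_h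
ι_x, and ι_x d = ε(x) - d ι_x - D_x where ι_y D_x = ι_{x(y - ε(y)1)}. Induction on the number of
arguments thus reduces the identities of C(H) to identities of H. The decisive ones are ∑ h⁽¹⁾
ad(h⁽²⁾)g = g h (`sw_mul_rightAd`) and its refinement `sw_comul_rightAd`, the source of i_g L_h = ∑
L_{h⁽¹⁾} i_{ad(h⁽²⁾)g}.

A homomorphism out of Ω_gr(A) is the same as a homomorphism f out of A with an antiderivation along
f (`OmegaGr.lift`). The product rules of i and L say precisely that w ↦ (ε σ(w), i w; 0, L w), with
σ the grading automorphism, is a homomorphism into matrices over the convolution algebra Hom(H,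
Ω_gr(A)). On A the entries are given. On dA they are forced: i_h(da) = L_h a - ε(h)a - d(i_h a) and
L_h(da) = d(L_h a). The remaining axioms propagate from A to dA and to products
(`lieDerivative_envelopeI`, `envelopeI_envelopeL`).

Given a connection α in Ω, the maps α and d ∘ α define the homomorphism W(H) → Ω, the only possible
one since C(H) and dC(H) generate W(H). It commutes with i and L on C(H) because both sides are
connections, on dC(H) by the formula for L, and on products by the product rules
(`weilLift_commutesAt`). No particular operation on W(H) is used here; taking for Ω the algebra W(H)
with a second operation, where the homomorphism is the identity, shows that the operation is unique.
-/

noncomputable section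

/-! ### Sums over the coproduct -/

/-- The proposition that a map of vector spaces is linear, for use with `fun_prop`. -/
@[fun_prop]
structure IsLin (K : Type*) [Field K] {M N : Type*} [AddCommGroup M] [AddCommGroup N]
    [Module K M] [Module K N] (f : M → N) : Prop where
  add : ∀ x y, f (x + y) = f x + f y
  smul : ∀ (c : K) x, f (c • x) = c • f x

namespace IsLin
variable {K : Type*} [Field K] {M N P : Type*} [AddCommGroup M] [AddCommGroup N] [Module K M]
  [Module K N] [AddCommGroup P] [Module K P] {A : Type*} [Ring A] [Algebra K A]

@[fun_prop] theorem id : IsLin K (fun x : M => x) := ⟨fun _ _ => rfl, fun _ _ => rfl⟩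

@[fun_prop] theorem comp {f : N → P} {g : M → N} (hf : IsLin K f) (hg : IsLin K g) :
    IsLin K (fun x => f (g x)) := ⟨by simp [hf.add, hg.add], by simp [hf.smul, hg.smul]⟩

@[fun_prop] theorem linearMap_apply (f : N →ₗ[K] P) {g : M → N} (hg : IsLin K g) :
    IsLin K (fun x => f (g x)) := ⟨by simp [hg.add], by simp [hg.smul]⟩

@[fun_prop] theorem apply_const {f : M → (N →ₗ[K] P)} (hf : IsLin K f) (c : N) :
    IsLin K (fun x => f x c) := ⟨by simp [hf.add], by simp [hf.smul]⟩

@[fun_prop] theorem add_fun {f g : M → N} (hf : IsLin K f) (hg : IsLin K g) :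
    IsLin K (fun x => f x + g x) :=
  ⟨by simp [hf.add, hg.add, add_add_add_comm], by simp [hf.smul, hg.smul]⟩

@[fun_prop] theorem sub_fun {f g : M → N} (hf : IsLin K f) (hg : IsLin K g) :
    IsLin K (fun x => f x - g x) :=
  ⟨by simp [hf.add, hg.add, add_sub_add_comm], by simp [hf.smul, hg.smul, smul_sub]⟩

@[fun_prop] theorem const_smul {f : M → N} (hf : IsLin K f) (c : K) :
    IsLin K (fun x => c • f x) := ⟨by simp [hf.add], by simp [hf.smul, smul_comm c]⟩

@[fun_prop] theorem smul_const {f : M → K} (hf : IsLin K f) (c : N) :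
    IsLin K (fun x => f x • c) := ⟨by simp [hf.add, add_smul], by simp [hf.smul, mul_smul]⟩

@[fun_prop] theorem mul_const {f : M → A} (hf : IsLin K f) (c : A) :
    IsLin K (fun x => f x * c) := ⟨by simp [hf.add, add_mul], by simp [hf.smul]⟩

@[fun_prop] theorem const_mul {f : M → A} (hf : IsLin K f) (c : A) :
    IsLin K (fun x => c * f x) := ⟨by simp [hf.add, mul_add], by simp [hf.smul]⟩

/-- The bundled linear map. -/
def toLinearMap {f : M → N} (hf : IsLin K f) : M →ₗ[K] N where
  toFun := f
  map_add' := hf.add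
  map_smul' := hf.smul

end IsLin

section Sweedler

variable {K : Type*} [Field K] {H : Type*} [Ring H] [HopfAlgebra K H]
variable {M N : Type*} [AddCommGroup M] [AddCommGroup N]

open HopfAlgebra (antipode)
open Coalgebra (counit comul)

variable (K) in
/-- `∑ⱼ F(h⁽¹⁾ⱼ, h⁽²⁾ⱼ)`, where `Δ h = ∑ⱼ h⁽¹⁾ⱼ ⊗ h⁽²⁾ⱼ`. -/
def sw (h : H) (F : H → H → M) : M :=
  ∑ j ∈ (ℛ K h).index, F ((ℛ K h).left j) ((ℛ K h).right j)

theorem sw_add_fun (h : H) (F G : H → H → M) :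
    sw K h (fun x y => F x y + G x y) = sw K h F + sw K h G := Finset.sum_add_distrib

theorem sw_sub_fun (h : H) (F G : H → H → M) :
    sw K h (fun x y => F x y - G x y) = sw K h F - sw K h G := Finset.sum_sub_distrib _ _

theorem sw_zero_fun (h : H) : sw K h (fun _ _ => (0 : M)) = 0 := Finset.sum_const_zero

theorem sw_neg_fun (h : H) (F : H → H → M) :
    sw K h (fun x y => - F x y) = - sw K h F := Finset.sum_neg_distrib _

theorem sw_mul_const {A : Type*} [Ring A] (h : H) (F : H → H → A) (a : A) :
    sw K h (fun x y => F x y * a) = sw K h F * a := (Finset.sum_mul _ _ _).symm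

theorem sw_const_mul {A : Type*} [Ring A] (h : H) (F : H → H → A) (a : A) :
    sw K h (fun x y => a * F x y) = a * sw K h F := (Finset.mul_sum _ _ _).symm

theorem sw_comm (h g : H) (F : H → H → H → H → M) :
    sw K h (fun x y => sw K g fun z w => F x y z w) =
      sw K g fun z w => sw K h fun x y => F x y z w := Finset.sum_comm

variable [Module K M] [Module K N]

/-- For bilinear `F` the sum depends on Δh alone and not on the chosen representation. The bialgebra
axioms enter through this fact, which is why the later rules ask for linearity in each slot while
the purely additive ones above do not. -/
theorem sw_eq_lift (h : H) {F : H → H → M} (hl : ∀ y, IsLin K fun x => F x y)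
    (hr : ∀ x, IsLin K (F x)) :
    sw K h F = TensorProduct.lift (LinearMap.mk₂ K F (fun x x' y => (hl y).add x x')
      (fun c x y => (hl y).smul c x) (fun x y y' => (hr x).add y y')
      (fun c x y => (hr x).smul c y)) (comul h) := by
  rw [← (ℛ K h).eq, map_sum]
  rfl

theorem map_sw (f : M →ₗ[K] N) (h : H) (F : H → H → M) :
    f (sw K h F) = sw K h fun x y => f (F x y) := map_sum f _ _

theorem IsLin.map_sw {f : M → N} (hf : IsLin K f) (h : H) (F : H → H → M) :
    f (sw K h F) = sw K h fun x y => f (F x y) := _root_.map_sw hf.toLinearMap h F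

theorem algHom_sw {A B : Type*} [Ring A] [Algebra K A] [Ring B] [Algebra K B] (f : A →ₐ[K] B)
    (h : H) (F : H → H → A) : f (sw K h F) = sw K h fun x y => f (F x y) := map_sum f _ _

theorem sw_apply (h : H) (F : H → H → (M →ₗ[K] N)) (m : M) :
    sw K h F m = sw K h fun x y => F x y m := LinearMap.sum_apply _ _ _

theorem sw_smul_fun (h : H) (c : K) (F : H → H → M) :
    sw K h (fun x y => c • F x y) = c • sw K h F := Finset.smul_sum.symm

-- With the next rule, this lets `fun_prop` see through nested coproduct sums and discharge the
-- linearity conditions of the rules below.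
@[fun_prop] theorem IsLin.sw_left {F : H → H → M} {f : N → H} (hf : IsLin K f)
    (hl : ∀ y, IsLin K fun x => F x y) (hr : ∀ x, IsLin K (F x)) :
    IsLin K fun z => sw K (f z) F := by
  simp only [sw_eq_lift _ hl hr]
  fun_prop

@[fun_prop] theorem IsLin.sw_right {F : N → H → H → M} (h : H)
    (hF : ∀ x y, IsLin K fun z => F z x y) : IsLin K fun z => sw K h (F z) :=
  ⟨fun z z' => by rw [← sw_add_fun]; simp only [← (hF _ _).add],
    fun c z => by rw [← sw_smul_fun]; simp only [← (hF _ _).smul]⟩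

theorem sw_one {F : H → H → M} (hl : ∀ y, IsLin K fun x => F x y) (hr : ∀ x, IsLin K (F x)) :
    sw K 1 F = F 1 1 := by
  rw [sw_eq_lift _ hl hr, Bialgebra.comul_one, Algebra.TensorProduct.one_def]
  rfl

theorem sw_mul (h g : H) {F : H → H → M} (hl : ∀ y, IsLin K fun x => F x y)
    (hr : ∀ x, IsLin K (F x)) :
    sw K (h * g) F = sw K h fun x y => sw K g fun z w => F (x * z) (y * w) := by
  rw [sw_eq_lift _ hl hr, Bialgebra.comul_mul, ← (ℛ K h).eq, ← (ℛ K g).eq, Finset.sum_mul_sum]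
  simp only [map_sum, Algebra.TensorProduct.tmul_mul_tmul]
  rfl

theorem sw_counit_left (h : H) {f : H → M} (hf : IsLin K f) :
    (sw K h fun x y => (counit x : K) • f y) = f h := by
  have := congrArg hf.toLinearMap (Coalgebra.sum_counit_smul (R := K) (ℛ K h))
  simp only [map_sum, map_smul] at this
  exact this

theorem sw_counit_right (h : H) {f : H → M} (hf : IsLin K f) :
    (sw K h fun x y => (counit y : K) • f x) = f h := by
  have := congrArg (hf.toLinearMap ∘ₗ (TensorProduct.rid K H).toLinearMap)
    (Coalgebra.sum_tmul_counit_eq (R := K) (ℛ K h))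
  simp only [map_sum, LinearMap.comp_apply, LinearEquiv.coe_coe, TensorProduct.rid_tmul, map_smul,
    one_smul] at this
  exact this

/-- Coassociativity: both sides evaluate the trilinear map `F` on the iterated coproduct of `h`. -/
theorem sw_assoc (h : H) {F : H → H → H → M} (h₁ : ∀ y z, IsLin K fun x => F x y z)
    (h₂ : ∀ x z, IsLin K fun y => F x y z) (h₃ : ∀ x y, IsLin K fun z => F x y z) :
    (sw K h fun x z => sw K x fun a b => F a b z) =
      sw K h fun x y => sw K y fun b c => F x b c := by
  let B : H →ₗ[K] H ⊗[K] H →ₗ[K] M :=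
    IsLin.toLinearMap (f := fun x => TensorProduct.lift (LinearMap.mk₂ K (F x)
      (fun y y' z => (h₂ x z).add y y') (fun c y z => (h₂ x z).smul c y)
      (fun y z z' => (h₃ x y).add z z') (fun c y z => (h₃ x y).smul c z)))
      ⟨fun x y => by ext; simp [(h₁ _ _).add], fun c y => by ext; simp [(h₁ _ _).smul]⟩
  have := congrArg (TensorProduct.lift B) (Coalgebra.sum_tmul_tmul_eq (R := K) (ℛ K h)
    (fun j => ℛ K ((ℛ K h).left j)) (fun j => ℛ K ((ℛ K h).right j)))
  simp only [map_sum] at this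
  exact this

theorem sw_antipode_mul (h : H) {f : H → M} (hf : IsLin K f) :
    (sw K h fun x y => f (antipode K x * y)) = (counit h : K) • f 1 := by
  have := congrArg hf.toLinearMap (HopfAlgebra.sum_antipode_mul_eq_smul (R := K) (ℛ K h))
  simp only [map_sum, map_smul] at this
  exact this

theorem sw_mul_antipode (h : H) {f : H → M} (hf : IsLin K f) :
    (sw K h fun x y => f (x * antipode K y)) = (counit h : K) • f 1 := by
  have := congrArg hf.toLinearMap (HopfAlgebra.sum_mul_antipode_eq_smul (R := K) (ℛ K h))
  simp only [map_sum, map_smul] at this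
  exact this

theorem rightAd_eq (h g : H) : rightAd K h g = sw K h fun x y => antipode K x * g * y :=
  rightAd_apply _ g

/-! ### The adjoint action -/

/-- ∑ h⁽¹⁾ S(h⁽²⁾) g h⁽³⁾ = g h, because ∑ h⁽¹⁾ S(h⁽²⁾) collapses to the counit. This moves `h`
across `g` at the price of the adjoint action. -/
theorem sw_mul_rightAd (h g : H) {f : H → M} (hf : IsLin K f) :
    (sw K h fun x y => f (x * rightAd K y g)) = f (g * h) := by
  simp only [rightAd_eq, ← sw_const_mul, hf.map_sw]
  rw [← sw_assoc (F := fun x a b => f (x * (antipode K a * g * b))) h (by fun_prop) (by fun_prop)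
    (by fun_prop)]
  have (w b : H) : (sw K w fun x a => f (x * (antipode K a * g * b))) =
      (counit w : K) • f (g * b) := by
    simpa [mul_assoc] using sw_mul_antipode (f := fun z => f (z * (g * b))) w (by fun_prop)
  simp only [this]
  exact sw_counit_left h (by fun_prop)

/-- Expanding only the first adjoint action gives ∑ S(h⁽¹⁾) a h⁽²⁾ ad(h⁽³⁾)b, and h⁽²⁾ ad(h⁽³⁾)b
sums to b h⁽²⁾ by `sw_mul_rightAd`. -/
theorem rightAd_mul (h a b : H) :
    rightAd K h (a * b) = sw K h fun x y => rightAd K x a * rightAd K y b := by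
  simp only [rightAd_eq (K := K) _ a, ← sw_mul_const]
  rw [sw_assoc (F := fun p q y => antipode K p * a * q * rightAd K y b) h (by fun_prop)
    (by fun_prop) (by fun_prop)]
  simp only [mul_assoc, sw_const_mul]
  simp only [sw_mul_rightAd (K := K) (f := fun z => z) _ b (by fun_prop)]
  simp only [rightAd_eq, mul_assoc]

theorem rightAd_rightAd (h g a : H) : rightAd K g (rightAd K h a) = rightAd K (h * g) a := by
  rw [rightAd_eq (h * g), sw_mul h g (by fun_prop) (by fun_prop), sw_comm]
  simp only [rightAd_eq, HopfAlgebra.antipode_mul_antidistrib, ← sw_mul_const, ← sw_const_mul,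
    mul_assoc]

theorem rightAd_one (h : H) : rightAd K h 1 = algebraMap K H (counit h) := by
  simpa [rightAd_eq, Algebra.algebraMap_eq_smul_one] using
    sw_antipode_mul (K := K) (f := fun z => z) h (by fun_prop)

theorem one_rightAd (a : H) : rightAd K (1 : H) a = a := by
  rw [rightAd_eq, sw_one (by fun_prop) (by fun_prop)]
  simp

/-- The counit applied to ∑ h⁽¹⁾ ad(h⁽²⁾)a = a h. -/
theorem counit_rightAd (h a : H) :
    (counit (rightAd K h a) : K) = counit h * counit a := by
  have := sw_mul_rightAd (K := K) (f := fun z => (counit z : K)) h a (by fun_prop)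
  simp only [Bialgebra.counit_mul] at this
  rw [mul_comm, ← this]
  exact (sw_counit_left (K := K) (f := fun y => (counit (rightAd K y a) : K)) h
    (by fun_prop)).symm

theorem rightAd_reduced (h a : H) : rightAd K h (reduced K a) = reduced K (rightAd K h a) := by
  simp only [reduced_apply, map_sub, counit_rightAd, Algebra.algebraMap_eq_smul_one, map_smul,
    rightAd_one, smul_smul, mul_comm]

theorem counit_reduced (h : H) : (counit (reduced K h) : K) = 0 := by
  simp [reduced_apply]

theorem reduced_one : reduced K (1 : H) = 0 := by
  simp [reduced_apply]

/-- `∑ (ad(h⁽²⁾) g)⁽¹⁾ ⊗ h⁽¹⁾ (ad(h⁽²⁾) g)⁽²⁾ = ∑ ad(h⁽¹⁾) g⁽¹⁾ ⊗ g⁽²⁾ h⁽²⁾`. -/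
theorem sw_comul_rightAd (h g : H) {F : H → H → M} (hl : ∀ y, IsLin K fun x => F x y)
    (hr : ∀ x, IsLin K (F x)) :
    (sw K h fun x y => sw K (rightAd K y g) fun k l => F k (x * l)) =
      sw K h fun x y => sw K g fun a b => F (rightAd K x a) (b * y) := by
  have hl' {f : H → H} (y) (hf : IsLin K f) : IsLin K fun x => F (f x) y := (hl y).comp hf
  have hr' {f : H → H} (x) (hf : IsLin K f) : IsLin K fun y => F x (f y) := (hr x).comp hf
  -- The right side is ∑ S(h⁽¹⁾) (g h⁽²⁾)⁽¹⁾ ⊗ (g h⁽²⁾)⁽²⁾ once Δ(g h⁽²⁾) is recognised. Replacing g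
  -- h⁽²⁾ by ∑ h⁽²⁾ ad(h⁽³⁾)g and taking coproducts produces a factor S(h⁽¹⁾) h⁽²⁾, which collapses
  -- to the counit.
  symm
  calc
    _ = sw K h fun x y => sw K x fun p q => sw K g fun a b =>
          F (antipode K p * (a * q)) (b * y) := by
        simp only [rightAd_eq, (hl _).map_sw, mul_assoc]
        simp only [sw_comm _ g]
    _ = sw K h fun p w => sw K w fun q y => sw K g fun a b =>
          F (antipode K p * (a * q)) (b * y) :=
        sw_assoc h (by fun_prop) (by fun_prop) (by fun_prop)
    _ = sw K h fun p w => sw K (g * w) fun c d => F (antipode K p * c) d := by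
        congr! 3 with p w
        rw [sw_mul g w (by fun_prop) (by fun_prop), sw_comm]
    _ = sw K h fun p w => sw K w fun x y => sw K (x * rightAd K y g) fun c d =>
          F (antipode K p * c) d := by
        congr! 3 with p w
        rw [sw_mul_rightAd (f := fun z => sw K z fun c d => F (antipode K p * c) d) w g
          (by fun_prop)]
    _ = sw K h fun p w => sw K w fun x y => sw K x fun x₁ x₂ => sw K (rightAd K y g) fun k l =>
          F (antipode K p * (x₁ * k)) (x₂ * l) := by
        congr! 6 with p w x y
        rw [sw_mul x _ (by fun_prop) (by fun_prop)]
    _ = sw K h fun p w => sw K w fun x₁ u => sw K u fun x₂ y => sw K (rightAd K y g) fun k l =>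
          F (antipode K p * (x₁ * k)) (x₂ * l) := by
        congr! 3 with p w
        exact sw_assoc (F := fun x₁ x₂ y => sw K (rightAd K y g) fun k l =>
          F (antipode K p * (x₁ * k)) (x₂ * l)) w (by fun_prop) (by fun_prop) (by fun_prop)
    _ = sw K h fun v u => sw K v fun p x₁ => sw K u fun x₂ y => sw K (rightAd K y g) fun k l =>
          F (antipode K p * (x₁ * k)) (x₂ * l) :=
        (sw_assoc (F := fun p x₁ u => sw K u fun x₂ y => sw K (rightAd K y g) fun k l =>
          F (antipode K p * (x₁ * k)) (x₂ * l)) h (by fun_prop) (by fun_prop) (by fun_prop)).symm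
    _ = sw K h fun v u => (counit v : K) • sw K u fun x₂ y => sw K (rightAd K y g) fun k l =>
          F k (x₂ * l) := by
        congr! 3 with v u
        have := sw_antipode_mul (K := K) (f := fun z => sw K u fun x₂ y =>
          sw K (rightAd K y g) fun k l => F (z * k) (x₂ * l)) v (by fun_prop)
        simpa only [mul_assoc, one_mul] using this
    _ = _ := sw_counit_left h (by fun_prop)

end Sweedler

/-! ### Operators on the algebra of multilinear forms -/

namespace MultilinearForms

variable {K : Type*} [Field K] {H : Type*} [Ring H]

section Algebra

variable [Algebra K H]

theorem induction_of {P : MultilinearForms K H → Prop} (hof : ∀ n f, P (of K H n f))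
    (hadd : ∀ Φ Ψ, P Φ → P Ψ → P (Φ + Ψ)) (Φ : MultilinearForms K H) : P Φ :=
  DirectSum.induction_on (motive := P) Φ (by have := hof 0 0; rw [map_zero] at this; exact this)
    hof hadd

theorem of_congr {m n : ℕ} (h : m = n) (f : Cochain K H m) (g : Cochain K H n)
    (h' : ∀ x : Fin n → H, f (fun i => x (Fin.cast h i)) = g x) : of K H m f = of K H n g := by
  subst h
  congr 1
  ext x
  exact h' x

/-- The degree is brought to the form `_ + 1`, the shape on which insertion of a first argument
computes. -/
theorem of_succ_mul_of {m n : ℕ} (f : Cochain K H (m + 1)) (g : Cochain K H n) :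
    of K H (m + 1) f * of K H n g = of K H (m + n + 1)
      ((Cochain.tensor f g).domDomCongr (finCongr (Nat.add_right_comm m 1 n))) := by
  rw [of_mul_of]
  exact of_congr (Nat.add_right_comm m 1 n) _ _ fun x => rfl

variable (K H) in
/-- The component of degree `n`. -/
def component (n : ℕ) : MultilinearForms K H →ₗ[K] Cochain K H n :=
  DirectSum.component K ℕ (Cochain K H) n ∘ₗ (equivDirectSum K H).toLinearMap

theorem component_of (n : ℕ) (f : Cochain K H n) : component K H n (of K H n f) = f :=
  DirectSum.component.lof_self K n f

theorem component_of_ne {m n : ℕ} (h : n ≠ m) (f : Cochain K H n) :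
    component K H m (of K H n f) = 0 :=
  (DirectSum.component.of K m n f).trans (dif_neg h)

theorem ext_component {Φ Ψ : MultilinearForms K H}
    (h : ∀ n, component K H n Φ = component K H n Ψ) : Φ = Ψ :=
  DirectSum.ext_component K h

variable (K H) in
/-- The value of the component of degree `0`. -/
def aug : MultilinearForms K H →ₗ[K] K where
  toFun Φ := component K H 0 Φ Fin.elim0
  map_add' _ _ := by simp
  map_smul' _ _ := by simp

theorem aug_of_zero (f : Cochain K H 0) : aug K H (of K H 0 f) = f Fin.elim0 := by
  simp [aug, component_of]

@[simp] theorem aug_of_succ (n : ℕ) (f : Cochain K H (n + 1)) :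
    aug K H (of K H (n + 1) f) = 0 := by
  simp [aug, component_of_ne]

@[simp] theorem aug_one : aug K H 1 = 1 := by
  rw [one_def, aug_of_zero, Cochain.const_apply]

theorem of_zero (f : Cochain K H 0) : of K H 0 f = f Fin.elim0 • (1 : MultilinearForms K H) := by
  rw [one_def, ← map_smul]
  congr 1
  ext x
  simp [Subsingleton.elim x Fin.elim0]

theorem aug_mul (Φ Ψ : MultilinearForms K H) : aug K H (Φ * Ψ) = aug K H Φ * aug K H Ψ := by
  induction Φ using induction_of with
  | hadd Φ Φ' h h' => simp only [add_mul, map_add, h, h']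
  | hof m f =>
    induction Ψ using induction_of with
    | hadd Φ Φ' h h' => simp only [mul_add, map_add, h, h']
    | hof n g =>
      cases m with
      | zero => rw [of_zero]; simp
      | succ m => rw [of_succ_mul_of]; simp

end Algebra

/-! ### Insertion of a first argument; recursive description of the adjoint action and of the
contractions -/

variable [HopfAlgebra K H]

open Coalgebra (counit)

/-- Inserting `x` as first argument: `Φ ↦ Φ(x, ·)`. -/
def insert : H →ₗ[K] Module.End K (MultilinearForms K H) where
  toFun x := lift fun n =>
    match n with
    | 0 => 0
    | n + 1 => of K H n ∘ₗ (Cochain.curry n).flip x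
  map_add' x y := hom_ext fun n f => by cases n <;> simp
  map_smul' c x := hom_ext fun n f => by cases n <;> simp

@[simp] theorem insert_of_zero (x : H) (f : Cochain K H 0) : insert x (of K H 0 f) = 0 := by
  simp [insert]

@[simp] theorem insert_of_succ (x : H) {n : ℕ} (f : Cochain K H (n + 1)) :
    insert x (of K H (n + 1) f) = of K H n (Cochain.curry n f x) := by
  simp [insert]

@[simp] theorem insert_one (x : H) : insert x (1 : MultilinearForms K H) = 0 := by
  simp [one_def]

/-- The value on a list of arguments of the component whose degree is the length of the list. -/
def ev : List H → MultilinearForms K H →ₗ[K] K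
  | [] => aug K H
  | x :: l => ev l ∘ₗ insert x

@[simp] theorem ev_nil (Φ : MultilinearForms K H) : ev [] Φ = aug K H Φ := rfl

@[simp] theorem ev_cons (x : H) (l : List H) (Φ : MultilinearForms K H) :
    ev (x :: l) Φ = ev l (insert x Φ) := rfl

theorem component_insert (n : ℕ) (x : H) (Φ : MultilinearForms K H) :
    component K H n (insert x Φ) = Cochain.curry n (component K H (n + 1) Φ) x := by
  induction Φ using induction_of with
  | hadd Φ Φ' h h' => simp only [map_add, h, h', LinearMap.add_apply]
  | hof m f =>
    cases m with
    | zero => rw [insert_of_zero, component_of_ne (by simp)]; simp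
    | succ m =>
      rw [insert_of_succ]
      rcases eq_or_ne m n with rfl | h
      · rw [component_of, component_of]
      · rw [component_of_ne h, component_of_ne (by simpa using h)]; simp

theorem ev_ofFn {n : ℕ} (g : Fin n → H) (Φ : MultilinearForms K H) :
    ev (List.ofFn g) Φ = component K H n Φ g := by
  induction n generalizing Φ with
  | zero => rw [List.ofFn_zero, Subsingleton.elim g Fin.elim0]; rfl
  | succ n ih =>
    rw [List.ofFn_succ, ev_cons, ih, component_insert, Cochain.curry_apply]
    congr 1
    exact Fin.cons_self_tail g

/-- The basis of the inductions below: evaluating on `x :: l` is inserting `x` and evaluating on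
`l`, so an identity of operators follows by induction on `l` from the way each operator commutes
with insertion. -/
theorem ext_ev {Φ Ψ : MultilinearForms K H} (h : ∀ l : List H, ev l Φ = ev l Ψ) : Φ = Ψ :=
  ext_component fun n => by ext g; rw [← ev_ofFn, ← ev_ofFn, h]

/-- The one-step version, sufficient for operators whose insertion is known in closed form, such as
`headDiff`. -/
theorem ext_insert {Φ Ψ : MultilinearForms K H} (h₀ : aug K H Φ = aug K H Ψ)
    (h : ∀ x : H, insert x Φ = insert x Ψ) : Φ = Ψ :=
  ext_ev fun l => by
    cases l with
    | nil => exact h₀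
    | cons x l => rw [ev_cons, h, ev_cons]

/-- The first argument of a product goes to the left factor, unless that factor is a scalar. -/
theorem insert_mul (x : H) (Φ Ψ : MultilinearForms K H) :
    insert x (Φ * Ψ) = insert x Φ * Ψ + aug K H Φ • insert x Ψ := by
  induction Φ using induction_of with
  | hadd Φ Φ' h h' => simp only [add_mul, map_add, h, h', add_smul]; abel
  | hof m f =>
    induction Ψ using induction_of with
    | hadd Φ Φ' h h' => simp only [mul_add, map_add, h, h', smul_add]; abel
    | hof n g =>
      cases m with
      | zero => rw [of_zero]; simp
      | succ m =>
        rw [of_succ_mul_of, insert_of_succ, insert_of_succ, of_mul_of, aug_of_succ, zero_smul,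
          add_zero]
        congr 1
        ext y
        simp only [Cochain.curry_apply, MultilinearMap.domDomCongr_apply, Cochain.tensor_apply]
        congr 2
        · funext i
          refine Fin.cases rfl (fun i => ?_) i
          rw [Fin.cons_succ, ← Fin.cons_succ (α := fun _ => H) x y]
          congr 1
        · funext i
          rw [← Fin.cons_succ (α := fun _ => H) x y]
          congr 1
          ext
          simp; omega

/-- The diagonal adjoint action on `C(H)`. -/
def coadjoint : H →ₗ[K] Module.End K (MultilinearForms K H) where
  toFun h := lift fun n => of K H n ∘ₗ Cochain.coad n h
  map_add' h h' := hom_ext fun n f => by simp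
  map_smul' c h := hom_ext fun n f => by simp

@[simp] theorem coadjoint_of (h : H) (n : ℕ) (f : Cochain K H n) :
    coadjoint h (of K H n f) = of K H n (Cochain.coad n h f) := by
  simp [coadjoint]

theorem aug_coadjoint (h : H) (Φ : MultilinearForms K H) :
    aug K H (coadjoint h Φ) = counit h * aug K H Φ := by
  induction Φ using induction_of with
  | hadd Φ Φ' h h' => simp only [map_add, h, h', mul_add]
  | hof m f =>
    rw [coadjoint_of]
    cases m with
    | zero => rw [Cochain.coad_zero_apply, map_smul, map_smul, smul_eq_mul]
    | succ m => simp

theorem insert_coadjoint (x h : H) (Φ : MultilinearForms K H) :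
    insert x (coadjoint h Φ) = sw K h fun a b => coadjoint b (insert (rightAd K a x) Φ) := by
  induction Φ using induction_of with
  | hadd Φ Φ' h h' => simp only [map_add, h, h', sw_add_fun]
  | hof m f =>
    cases m with
    | zero => simp [sw]
    | succ m =>
      simp only [coadjoint_of, insert_of_succ, ← map_sw]
      congr 1
      ext g
      rw [Cochain.curry_apply, Cochain.coad_succ_apply (ℛ K h)]
      simp [sw]

/-- The part `Φ ↦ ((g₁, g₂, …) ↦ ∑ Φ(h⁽¹⁾ - ε(h⁽¹⁾) 1, ad(h⁽²⁾) g₁, ad(h⁽³⁾) g₂, …))` of the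
contraction `i_h`. -/
def contractionHead (h : H) (Φ : MultilinearForms K H) : MultilinearForms K H :=
  sw K h fun a b => coadjoint b (insert (reduced K a) Φ)

theorem contractionHead_of_zero (h : H) (f : Cochain K H 0) :
    contractionHead h (of K H 0 f) = 0 := by
  simp [contractionHead, sw]

theorem contractionHead_of_succ (h : H) {n : ℕ} (f : Cochain K H (n + 1)) :
    contractionHead h (of K H (n + 1) f) = of K H n (Cochain.contractHead n h f) := by
  rw [Cochain.contractHead_apply (ℛ K h)]
  simp [contractionHead, sw]

theorem contractionHead_add (h : H) (Φ Ψ : MultilinearForms K H) :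
    contractionHead h (Φ + Ψ) = contractionHead h Φ + contractionHead h Ψ := by
  simp only [contractionHead, map_add, sw_add_fun]

@[simp] theorem contraction_of_zero (h : H) (f : Cochain K H 0) :
    contraction h (of K H 0 f) = 0 := by
  simp [contraction]

@[simp] theorem contraction_of_succ (h : H) {n : ℕ} (f : Cochain K H (n + 1)) :
    contraction h (of K H (n + 1) f) = of K H n (Cochain.contract n h f) := by
  simp [contraction]

/-- The summand p = 0 of i_h is `contractionHead`. The summands p ≥ 1 leave the first argument in
place, and lowering p by one changes their sign. -/
theorem insert_contraction (x h : H) (Φ : MultilinearForms K H) :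
    insert x (contraction h Φ) = insert x (contractionHead h Φ) - contraction h (insert x Φ) := by
  induction Φ using induction_of with
  | hadd Φ Φ' h h' => simp only [map_add, h, h', contractionHead_add]; abel
  | hof m f =>
    match m with
    | 0 => simp [contractionHead_of_zero]
    | 1 => simp [contractionHead_of_succ]
    | n + 2 =>
      rw [contractionHead_of_succ, contraction_of_succ, insert_of_succ, insert_of_succ,
        insert_of_succ, contraction_of_succ, ← map_sub]
      congr 1

/-- Only forms of degree 1 contribute, and on the resulting scalars the adjoint action of h⁽²⁾ is
ε(h⁽²⁾), which the counit axiom absorbs. -/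
theorem aug_contraction (h : H) (Φ : MultilinearForms K H) :
    aug K H (contraction h Φ) = aug K H (insert (reduced K h) Φ) := by
  have key : aug K H (contraction h Φ) = aug K H (contractionHead h Φ) := by
    induction Φ using induction_of with
    | hadd Φ Φ' h h' => simp only [map_add, h, h', contractionHead_add]
    | hof m f =>
      match m with
      | 0 => simp [contractionHead_of_zero]
      | 1 => rw [contractionHead_of_succ, contraction_of_succ]; rfl
      | n + 2 => rw [contractionHead_of_succ, contraction_of_succ]; simp
  rw [key, contractionHead, map_sw]
  simp only [aug_coadjoint]
  exact sw_counit_right (f := fun a => aug K H (insert (reduced K a) Φ)) h (by fun_prop)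

/-! The differential. -/

variable (K H) in
/-- The part `d₀` of the differential which involves the product of `H`. -/
def bar : MultilinearForms K H →ₗ[K] MultilinearForms K H :=
  lift fun n => of K H (n + 1) ∘ₗ Cochain.barDiff n

/-- `Φ ↦ ((g₁, g₂, …) ↦ Φ(x g₁, g₂, …))`, and zero on `C⁰(H)`. -/
def mulHead (x : H) : Module.End K (MultilinearForms K H) :=
  lift fun n =>
    match n with
    | 0 => 0
    | n + 1 => of K H (n + 1) ∘ₗ Cochain.headTail (LinearMap.mulLeft K x) LinearMap.id

@[simp] theorem mulHead_of_zero (x : H) (f : Cochain K H 0) : mulHead x (of K H 0 f) = 0 := by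
  simp [mulHead]

@[simp] theorem mulHead_of_succ (x : H) {n : ℕ} (f : Cochain K H (n + 1)) :
    mulHead x (of K H (n + 1) f) =
      of K H (n + 1) (Cochain.headTail (LinearMap.mulLeft K x) LinearMap.id f) := by
  simp [mulHead]

theorem aug_mulHead (x : H) (Φ : MultilinearForms K H) : aug K H (mulHead x Φ) = 0 := by
  induction Φ using induction_of with
  | hadd Φ Φ' h h' => simp only [map_add, h, h', add_zero]
  | hof m f => cases m <;> simp

theorem insert_mulHead (x y : H) (Φ : MultilinearForms K H) :
    insert y (mulHead x Φ) = insert (x * y) Φ := by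
  induction Φ using induction_of with
  | hadd Φ Φ' h h' => simp only [map_add, h, h']
  | hof m f =>
    cases m with
    | zero => simp
    | succ m =>
      rw [mulHead_of_succ, insert_of_succ, insert_of_succ]
      congr 1

/-- The term k = 1 multiplies `x` into the next argument. In the others `x` stays in front, and the
shift of k changes the sign. -/
theorem insert_bar (x : H) (Φ : MultilinearForms K H) :
    insert x (bar K H Φ) = - bar K H (insert x Φ) - mulHead x Φ := by
  induction Φ using induction_of with
  | hadd Φ Φ' h h' => simp only [map_add, h, h']; abel
  | hof m f =>
    cases m with
    | zero => simp [bar, Cochain.barDiff]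
    | succ m =>
      rw [bar, lift_of, insert_of_succ, lift_of, mulHead_of_succ, LinearMap.comp_apply,
        LinearMap.comp_apply, insert_of_succ, ← map_neg, ← map_sub]
      congr 1
      ext g
      have h₁ : Fin.contractNth 0 (· * ·) (Fin.cons x g : Fin (m + 2) → H) =
          Fin.cons (x * g 0) (Fin.tail g) := by
        funext i
        refine Fin.cases ?_ (fun i => ?_) i
        · simp [Fin.contractNth]
        · simp [Fin.contractNth, Fin.tail]
      have h₂ (k : Fin m) :
          Fin.contractNth k.castSucc.succ (· * ·) (Fin.cons x g : Fin (m + 2) → H) =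
            Fin.cons x (Fin.contractNth k.castSucc (· * ·) g) := by
        funext i
        refine Fin.cases ?_ (fun i => ?_) i
        · simp [Fin.contractNth]
        · simp [Fin.contractNth]
      simp [Cochain.barDiff, Fin.sum_univ_succ, h₁, h₂, pow_succ]
      rw [← sub_eq_add_neg]

theorem diff_of (n : ℕ) (f : Cochain K H n) :
    diff (of K H n f) = bar K H (of K H n f) + counitForm * of K H n f +
      (-1 : K) ^ (n + 1) • (of K H n f * counitForm) := by
  simp [diff, bar]

theorem aug_counitForm : aug K H counitForm = 0 := aug_of_succ _ _

theorem insert_counitForm (x : H) :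
    insert x (counitForm (K := K) (H := H)) = (counit x : K) • 1 := by
  rw [counitForm, insert_of_succ, of_zero]
  rfl

theorem aug_diff (Φ : MultilinearForms K H) : aug K H (diff Φ) = 0 := by
  induction Φ using induction_of with
  | hadd Φ Φ' h h' => simp only [map_add, h, h', add_zero]
  | hof m f => simp [diff_of, aug_mul, aug_counitForm, bar]

/-- The part of the differential that does not come from the tail of the arguments. -/
def headDiff (x : H) (Φ : MultilinearForms K H) : MultilinearForms K H :=
  mulHead x Φ - counitForm * insert x Φ + ((counit x : K) * aug K H Φ) • 1

theorem aug_headDiff (x : H) (Φ : MultilinearForms K H) :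
    aug K H (headDiff x Φ) = counit x * aug K H Φ := by
  simp [headDiff, aug_mulHead, aug_mul, aug_counitForm]

/-- Inserting y in the product with ε leaves -ε(y) ι_x, which combines with ι_{xy}; the constant
term is killed. No operator on the remaining arguments survives. -/
theorem insert_headDiff (x y : H) (Φ : MultilinearForms K H) :
    insert y (headDiff x Φ) = insert (x * reduced K y) Φ := by
  simp [headDiff, insert_mulHead, insert_mul, aug_counitForm, insert_counitForm, reduced_apply,
    Algebra.algebraMap_eq_smul_one, mul_sub]

/-- In positive degree the two products by ε on the right, in d and in d ι_x, cancel because the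
signs (-1)^{n+1} for degrees n and n - 1 are opposite. In degree 0 the argument `x` falls on that
factor ε instead, which accounts for the constant term of `headDiff`. -/
theorem insert_diff (x : H) (Φ : MultilinearForms K H) :
    insert x (diff Φ) = (counit x : K) • Φ - diff (insert x Φ) - headDiff x Φ := by
  induction Φ using induction_of with
  | hadd Φ Φ' h h' =>
    simp only [map_add, h, h', smul_add, headDiff, mul_add, add_smul]; abel
  | hof m f =>
    rw [diff_of]
    cases m with
    | zero =>
      simp [insert_bar, insert_mul, headDiff, aug_counitForm, insert_counitForm]
      rw [smul_smul, mul_comm, sub_eq_add_neg]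
    | succ m =>
      simp [insert_bar, insert_mul, headDiff, aug_counitForm, insert_counitForm, diff_of, pow_succ]
      abel

end MultilinearForms

/-! ### The operation of `H` in the algebra of multilinear forms -/

namespace MultilinearForms

variable {K : Type*} [Field K] {H : Type*} [Ring H] [HopfAlgebra K H]

open Coalgebra (counit)

/-- Each tensor factor receives its share of the iterated coproduct of h, by coassociativity; when
the left factor is a scalar its share is absorbed by the counit. -/
theorem coadjoint_mul (h : H) (Φ Ψ : MultilinearForms K H) :
    coadjoint h (Φ * Ψ) = sw K h fun a b => coadjoint a Φ * coadjoint b Ψ := by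
  refine ext_ev fun l => ?_
  induction l generalizing h Φ Ψ with
  | nil =>
    simp only [ev_nil, map_sw, aug_mul, aug_coadjoint, mul_assoc]
    exact (mul_left_comm _ _ _).trans (sw_counit_left (K := K)
      (f := fun b => aug K H Φ * (counit b * aug K H Ψ)) h (by fun_prop)).symm
  | cons x l ih =>
    have h₁ : insert x (coadjoint h (Φ * Ψ)) =
        (sw K h fun a b => coadjoint b (insert (rightAd K a x) Φ * Ψ)) +
          aug K H Φ • insert x (coadjoint h Ψ) := by
      simp only [insert_coadjoint, insert_mul, map_add, map_smul, sw_add_fun, sw_smul_fun]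
    have h₂ : insert x (sw K h fun a b => coadjoint a Φ * coadjoint b Ψ) =
        (sw K h fun a b => sw K b fun c d =>
          coadjoint c (insert (rightAd K a x) Φ) * coadjoint d Ψ) +
          aug K H Φ • insert x (coadjoint h Ψ) := by
      simp only [map_sw, insert_mul, sw_add_fun, aug_coadjoint]
      congr 1
      · simp only [insert_coadjoint x _ Φ, ← sw_mul_const]
        exact sw_assoc (F := fun a c d => coadjoint c (insert (rightAd K a x) Φ) * coadjoint d Ψ)
          h (by fun_prop) (by fun_prop) (by fun_prop)
      · simp only [mul_comm _ (aug K H Φ), mul_smul, sw_smul_fun]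
        rw [sw_counit_left (f := fun b => insert x (coadjoint b Ψ)) h (by fun_prop)]
    rw [ev_cons, ev_cons, h₁, h₂]
    simp only [map_add, map_sw, ih]

theorem coadjoint_coadjoint (h g : H) (Φ : MultilinearForms K H) :
    coadjoint h (coadjoint g Φ) = coadjoint (h * g) Φ := by
  refine ext_ev fun l => ?_
  induction l generalizing h g Φ with
  | nil => simp only [ev_nil, aug_coadjoint, Bialgebra.counit_mul, mul_assoc]
  | cons x l ih =>
    simp only [ev_cons, insert_coadjoint, map_sw, ih, rightAd_rightAd]
    exact (sw_mul (F := fun a b => ev l (coadjoint b (insert (rightAd K a x) Φ))) h g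
      (by fun_prop) (by fun_prop)).symm

theorem coadjoint_one (Φ : MultilinearForms K H) : coadjoint (1 : H) Φ = Φ := by
  refine ext_ev fun l => ?_
  induction l generalizing Φ with
  | nil => simp [aug_coadjoint]
  | cons x l ih =>
    rw [ev_cons, insert_coadjoint, sw_one (by fun_prop) (by fun_prop), ih, one_rightAd, ev_cons]

/-- After insertion of y both sides come down to ad(h)(x ȳ) = ∑ ad(h⁽¹⁾)x · ad(h⁽²⁾)ȳ with ȳ = y -
ε(y)1. -/
theorem headDiff_coadjoint (x h : H) (Φ : MultilinearForms K H) :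
    headDiff x (coadjoint h Φ) = sw K h fun a b => coadjoint b (headDiff (rightAd K a x) Φ) := by
  refine ext_insert ?_ fun y => ?_
  · simp only [aug_headDiff, map_sw, aug_coadjoint, counit_rightAd, mul_assoc]
    exact (mul_left_comm _ _ _).trans (sw_counit_right (K := K)
      (f := fun a => counit a * (counit x * aug K H Φ)) h (by fun_prop)).symm
  · simp only [insert_headDiff, map_sw, insert_coadjoint, ← rightAd_reduced]
    rw [← sw_assoc (F := fun a c d => coadjoint d
      (insert (rightAd K a x * rightAd K c (reduced K y)) Φ)) h (by fun_prop) (by fun_prop)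
      (by fun_prop)]
    congr! 3 with w d
    rw [rightAd_mul]
    exact IsLin.map_sw (f := fun z => coadjoint d (insert z Φ)) (by fun_prop) _ _

/-- Each of the three terms of `insert_diff` is equivariant: the scalar by ε(ad(h)x) = ε(h)ε(x), the
second by induction, the third by `headDiff_coadjoint`. -/
theorem diff_coadjoint (h : H) (Φ : MultilinearForms K H) :
    diff (coadjoint h Φ) = coadjoint h (diff Φ) := by
  refine ext_ev fun l => ?_
  induction l generalizing h Φ with
  | nil => simp [aug_coadjoint, aug_diff]
  | cons x l ih =>
    simp only [ev_cons, insert_coadjoint, insert_diff, headDiff_coadjoint, map_sub, map_sw, ih,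
      sw_sub_fun, map_smul, counit_rightAd, mul_smul]
    congr 2
    exact (sw_counit_left (K := K) (f := fun b => counit x • ev l (coadjoint b Φ)) h
      (by fun_prop)).symm

/-! ### Product rule and equivariance of the contractions -/

theorem gradeInv_of (n : ℕ) (f : Cochain K H n) :
    gradeInv (grading K H) (of K H n f) = (-1 : K) ^ n • of K H n f :=
  gradeInv_of_mem _ (of_mem_grading n f)

theorem aug_gradeInv (Φ : MultilinearForms K H) :
    aug K H (gradeInv (grading K H) Φ) = aug K H Φ := by
  induction Φ using induction_of with
  | hadd Φ Φ' h h' => simp only [map_add, h, h']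
  | hof m f => cases m <;> simp [gradeInv_of]

theorem insert_gradeInv (x : H) (Φ : MultilinearForms K H) :
    insert x (gradeInv (grading K H) Φ) = - gradeInv (grading K H) (insert x Φ) := by
  induction Φ using induction_of with
  | hadd Φ Φ' h h' => simp only [map_add, h, h', neg_add]
  | hof m f => cases m <;> simp [gradeInv_of, pow_succ]

theorem reduced_reduced (h : H) : reduced K (reduced K h) = reduced K h := by
  rw [reduced_apply (reduced K h), counit_reduced, map_zero, sub_zero]

theorem contractionHead_mul (h : H) (Φ Ψ : MultilinearForms K H) :
    contractionHead h (Φ * Ψ) =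
      (sw K h fun a b => contractionHead a Φ * coadjoint b Ψ) + aug K H Φ • contractionHead h Ψ := by
  simp only [contractionHead, insert_mul, map_add, map_smul, sw_add_fun, sw_smul_fun,
    coadjoint_mul, ← sw_mul_const]
  congr 1
  exact (sw_assoc (F := fun a c d => coadjoint c (insert (reduced K a) Φ) * coadjoint d Ψ)
          h (by fun_prop) (by fun_prop) (by fun_prop)).symm

theorem aug_contractionHead (h : H) (Φ : MultilinearForms K H) :
    aug K H (contractionHead h Φ) = aug K H (contraction h Φ) := by
  rw [aug_contraction, contractionHead, map_sw]
  simp only [aug_coadjoint]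
  exact sw_counit_right (f := fun a => aug K H (insert (reduced K a) Φ)) h (by fun_prop)

/-- Insertion of x produces the same head terms on both sides; what is left is minus the claim for
ι_x Φ and Ψ. -/
theorem contraction_mul (h : H) (Φ Ψ : MultilinearForms K H) :
    contraction h (Φ * Ψ) = (sw K h fun a b => contraction a Φ * coadjoint b Ψ) +
      gradeInv (grading K H) Φ * contraction h Ψ := by
  refine ext_ev fun l => ?_
  induction l generalizing h Φ Ψ with
  | nil =>
    simp only [ev_nil, map_add, map_sw, aug_mul, aug_coadjoint, aug_gradeInv, aug_contraction,
      insert_mul, map_smul, smul_eq_mul]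
    congr 1
    rw [← sw_counit_right (K := K) (f := fun a => aug K H (insert (reduced K a) Φ) * aug K H Ψ) h
      (by fun_prop)]
    congr! 3 with a b
    rw [smul_eq_mul]
    ring
  | cons x l ih =>
    have h₁ : insert x (contraction h (Φ * Ψ)) =
        (sw K h fun a b => insert x (contractionHead a Φ) * coadjoint b Ψ) +
        (sw K h fun a b => aug K H (contraction a Φ) • insert x (coadjoint b Ψ)) +
        aug K H Φ • insert x (contraction h Ψ) - contraction h (insert x Φ * Ψ) := by
      rw [insert_contraction, contractionHead_mul, insert_contraction]
      simp only [map_add, map_sw, insert_mul, sw_add_fun, map_smul, smul_sub, aug_contractionHead]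
      abel
    have h₂ : insert x ((sw K h fun a b => contraction a Φ * coadjoint b Ψ) +
          gradeInv (grading K H) Φ * contraction h Ψ) =
        (sw K h fun a b => insert x (contractionHead a Φ) * coadjoint b Ψ) +
        (sw K h fun a b => aug K H (contraction a Φ) • insert x (coadjoint b Ψ)) +
        aug K H Φ • insert x (contraction h Ψ) -
        ((sw K h fun a b => contraction a (insert x Φ) * coadjoint b Ψ) +
          gradeInv (grading K H) (insert x Φ) * contraction h Ψ) := by
      simp only [map_add, map_sw, insert_mul, sw_add_fun, insert_contraction x _ Φ, sub_mul,
        sw_sub_fun, insert_gradeInv, aug_gradeInv]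
      noncomm_ring
    rw [ev_cons, ev_cons, h₁, h₂, map_sub, map_sub, ih]

theorem contraction_one (Φ : MultilinearForms K H) : contraction (1 : H) Φ = 0 := by
  have hQ (Φ : MultilinearForms K H) : contractionHead (1 : H) Φ = 0 := by
    rw [contractionHead, sw_one (by fun_prop) (by fun_prop), reduced_one]
    simp
  refine ext_ev fun l => ?_
  induction l generalizing Φ with
  | nil => simp [aug_contraction, reduced_one]
  | cons x l ih => simp [insert_contraction, hQ, ih]

/-- Both sides are sums of terms coad_b ι_{a - ε(a)1}, and the tensors ∑ a ⊗ b involved are the two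
sides of `sw_comul_rightAd`. -/
theorem contractionHead_coadjoint (g h : H) (Φ : MultilinearForms K H) :
    contractionHead g (coadjoint h Φ) =
      sw K h fun a b => coadjoint a (contractionHead (rightAd K b g) Φ) := by
  have := sw_comul_rightAd (K := K) h g
    (F := fun a b => coadjoint b (insert (reduced K a) Φ)) (by fun_prop) (by fun_prop)
  simp only [contractionHead, insert_coadjoint, map_sw, coadjoint_coadjoint, this,
    rightAd_reduced]
  rw [sw_comm]

/-- The head terms agree by `contractionHead_coadjoint`. The others reduce to the claim for the
forms ι_{ad(h⁽¹⁾)x} Φ, regrouped by coassociativity. -/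
theorem contraction_coadjoint (g h : H) (Φ : MultilinearForms K H) :
    contraction g (coadjoint h Φ) =
      sw K h fun a b => coadjoint a (contraction (rightAd K b g) Φ) := by
  refine ext_ev fun l => ?_
  induction l generalizing g h Φ with
  | nil =>
    simp only [ev_nil, map_sw, aug_contraction, aug_coadjoint, insert_coadjoint]
    refine Eq.trans ?_ (sw_counit_left (K := K)
      (f := fun b => aug K H (insert (reduced K (rightAd K b g)) Φ)) h (by fun_prop)).symm
    rw [← rightAd_reduced]
    exact sw_counit_right (f := fun a => aug K H (insert (rightAd K a (reduced K g)) Φ)) h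
      (by fun_prop)
  | cons x l ih =>
    have h₁ : insert x (contraction g (coadjoint h Φ)) =
        (sw K h fun a b => insert x (coadjoint a (contractionHead (rightAd K b g) Φ))) -
        sw K h fun a b => contraction g (coadjoint b (insert (rightAd K a x) Φ)) := by
      rw [insert_contraction, contractionHead_coadjoint, insert_coadjoint]
      simp only [map_sw]
    have h₂ : insert x (sw K h fun a b => coadjoint a (contraction (rightAd K b g) Φ)) =
        (sw K h fun a b => insert x (coadjoint a (contractionHead (rightAd K b g) Φ))) -
        sw K h fun a b => sw K b fun c d =>
          coadjoint c (contraction (rightAd K d g) (insert (rightAd K a x) Φ)) := by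
      have h₃ (a k : H) : insert x (coadjoint a (contraction k Φ)) =
          insert x (coadjoint a (contractionHead k Φ)) -
            sw K a fun p q => coadjoint q (contraction k (insert (rightAd K p x) Φ)) := by
        simp only [insert_coadjoint, insert_contraction, map_sub, sw_sub_fun]
      rw [map_sw]
      simp only [h₃, sw_sub_fun]
      exact congrArg (fun z => _ - z) (sw_assoc (F := fun a c d =>
        coadjoint c (contraction (rightAd K d g) (insert (rightAd K a x) Φ))) h
        (by fun_prop) (by fun_prop) (by fun_prop))
    rw [ev_cons, ev_cons, h₁, h₂]
    simp only [map_sub, map_sw, ih]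

/-! The Cartan formula. -/

/-- The sum on the right equals Q_h D_x Φ, with Q_h the head of the contraction. The content is thus
that i_h - Q_h, whose summands leave the first argument in place, commutes with D_x. -/
theorem contraction_headDiff (x h : H) (Φ : MultilinearForms K H) :
    contraction h (headDiff x Φ) = headDiff x (contraction h Φ) +
      (sw K h fun a b => coadjoint b (insert (x * reduced K a) Φ)) -
      headDiff x (contractionHead h Φ) := by
  refine ext_insert ?_ fun y => ?_
  · simp only [aug_contraction, map_sub, map_add, aug_headDiff, insert_headDiff, map_sw,
      aug_coadjoint, aug_contractionHead, reduced_reduced, add_sub_cancel_left]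
    exact (sw_counit_right (f := fun a => aug K H (insert (x * reduced K a) Φ)) h
      (by fun_prop)).symm
  · simp only [insert_contraction, map_sub, map_add, insert_headDiff]
    simp only [contractionHead, insert_headDiff, reduced_reduced]
    abel

/-- The product of the two reduced elements is h⁽¹⁾ ad(h⁽²⁾)x - ε(h⁽²⁾)ε(x)(h⁽¹⁾ - ε(h⁽¹⁾)1) -
ε(h⁽¹⁾) ad(h⁽²⁾)x. The first term sums to x h⁽¹⁾ by `sw_mul_rightAd`, the others by the counit
axioms. -/
theorem sw_reduced_mul_reduced_rightAd {M : Type*} [AddCommGroup M] [Module K M] (x h : H)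
    {F : H → H → M} (hl : ∀ y, IsLin K fun x => F x y) (hr : ∀ x, IsLin K (F x)) :
    (sw K h fun a b => sw K b fun b c => F (reduced K a * reduced K (rightAd K b x)) c) =
      (sw K h fun a b => F (x * a) b) - (counit x : K) • (sw K h fun a b => F (reduced K a) b) -
        sw K h fun a b => F (rightAd K a x) b := by
  have hl' {f : H → H} (y) (hf : IsLin K f) : IsLin K fun x => F (f x) y := (hl y).comp hf
  rw [← sw_assoc (F := fun a b c => F (reduced K a * reduced K (rightAd K b x)) c) h
    (by fun_prop) (by fun_prop) (by fun_prop), ← sw_smul_fun, ← sw_sub_fun, ← sw_sub_fun]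
  congr! 3 with w c
  have h₁ (a b : H) : reduced K a * reduced K (rightAd K b x) = a * rightAd K b x -
      (counit b : K) • (counit x : K) • reduced K a - (counit a : K) • rightAd K b x := by
    simp only [reduced_apply, counit_rightAd, Algebra.algebraMap_eq_smul_one, sub_mul, mul_sub,
      smul_sub, smul_mul_assoc, mul_smul_comm, mul_one, one_mul, smul_smul]
    rw [mul_assoc]
    abel
  have h₂ (f : H → M) (hf : IsLin K f) : (sw K w fun a b =>
      f (reduced K a * reduced K (rightAd K b x))) =
        f (x * w) - (counit x : K) • f (reduced K w) - f (rightAd K w x) := by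
    have hs (a b : H) : f (a - b) = f a - f b := map_sub hf.toLinearMap a b
    simp only [h₁, hs, sw_sub_fun, hf.smul, sw_mul_rightAd w x hf]
    rw [sw_counit_left (f := fun b => f (rightAd K b x)) w (by fun_prop),
      sw_counit_right (f := fun a => (counit x : K) • f (reduced K a)) w (by fun_prop)]
  exact h₂ (fun z => F z c) (hl c)

/-- Since d commutes with the adjoint action and reduced elements have counit 0, Q_h d + d Q_h is -∑
coad_{h⁽²⁾} D_y with y = h⁽¹⁾ - ε(h⁽¹⁾)1; inserting x leaves the product evaluated in the preceding
lemma. -/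
theorem insert_contractionHead_diff (x h : H) (Φ : MultilinearForms K H) :
    insert x (contractionHead h (diff Φ)) + insert x (diff (contractionHead h Φ)) =
      insert x (coadjoint h Φ) + (counit x : K) • contractionHead h Φ -
        sw K h fun a b => coadjoint b (insert (x * a) Φ) := by
  have h₁ : contractionHead h (diff Φ) + diff (contractionHead h Φ) =
      - sw K h fun a b => coadjoint b (headDiff (reduced K a) Φ) := by
    simp only [contractionHead, map_sw, diff_coadjoint, insert_diff, counit_reduced, map_sub,
      sw_sub_fun, zero_smul, map_zero, sw_zero_fun]
    abel
  rw [← map_add, h₁]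
  simp only [map_neg, map_sw, insert_coadjoint, insert_headDiff]
  rw [sw_reduced_mul_reduced_rightAd (F := fun a b => coadjoint b (insert a Φ)) x h (by fun_prop)
    (by fun_prop), contractionHead]
  abel

/-- Inserting x in the left side gives ι_x coad_h Φ, plus the left side for ι_x Φ, minus coad_h ι_x
Φ; by induction the last two cancel. The adjoint action thus arises from the head terms alone. -/
theorem cartan (h : H) (Φ : MultilinearForms K H) :
    diff (contraction h Φ) + contraction h (diff Φ) + (counit h : K) • Φ = coadjoint h Φ := by
  refine ext_ev fun l => ?_
  induction l generalizing h Φ with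
  | nil =>
    simp [aug_diff, aug_contraction, insert_diff, aug_headDiff, counit_reduced, aug_coadjoint]
  | cons x l ih =>
    have h₁ : (sw K h fun a b => coadjoint b (insert (x * reduced K a) Φ)) =
        (sw K h fun a b => coadjoint b (insert (x * a) Φ)) - coadjoint h (insert x Φ) := by
      simp only [reduced_apply, mul_sub, map_sub, LinearMap.sub_apply, sw_sub_fun,
        Algebra.algebraMap_eq_smul_one, mul_smul_comm, mul_one, map_smul, LinearMap.smul_apply]
      rw [sw_counit_left (f := fun b => coadjoint b (insert x Φ)) h (by fun_prop)]
    have h₂ : insert x (diff (contraction h Φ) + contraction h (diff Φ) + (counit h : K) • Φ) =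
        insert x (coadjoint h Φ) + (diff (contraction h (insert x Φ)) +
          contraction h (diff (insert x Φ)) + (counit h : K) • insert x Φ) -
          coadjoint h (insert x Φ) := by
      have h₃ := insert_contractionHead_diff x h Φ
      rw [← eq_sub_iff_add_eq] at h₃
      simp only [map_add, map_smul, insert_diff, insert_contraction, map_sub, h₃,
        contraction_headDiff, h₁]
      abel
    rw [ev_cons, ev_cons, h₂, map_sub, map_add, ih]
    abel

theorem L_eq_coadjoint (h : H) :
    lieDerivative diff contraction h = coadjoint (K := K) h :=
  LinearMap.ext (cartan h)

end MultilinearForms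

/-! ### Graded algebras with contractions -/

section GradeInvLemmas

variable {K : Type*} [Field K] {A : Type*} [Ring A] [Algebra K A]
variable (𝒜 : ℕ → Submodule K A) [GradedAlgebra 𝒜]

theorem gradeInv_gradeInv (a : A) : gradeInv 𝒜 (gradeInv 𝒜 a) = a := by
  induction a using graded_induction 𝒜 with
  | hadd a b h h' => simp only [map_add, h, h']
  | h n a ha =>
    rw [gradeInv_of_mem 𝒜 ha, map_smul, gradeInv_of_mem 𝒜 ha, smul_smul, ← pow_add,
      Even.neg_one_pow ⟨n, rfl⟩, one_smul]

variable {𝒜} in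
theorem map_gradeInv_of_degree_zero {f : A →ₗ[K] A} (hf : ∀ n, ∀ a ∈ 𝒜 n, f a ∈ 𝒜 n) (a : A) :
    f (gradeInv 𝒜 a) = gradeInv 𝒜 (f a) := by
  induction a using graded_induction 𝒜 with
  | hadd a b h h' => simp only [map_add, h, h']
  | h n a ha => rw [gradeInv_of_mem 𝒜 ha, gradeInv_of_mem 𝒜 (hf n a ha), map_smul]

variable {𝒜} in
theorem map_gradeInv_of_degree_neg_one {f : A →ₗ[K] A} (h₀ : ∀ a ∈ 𝒜 0, f a = 0)
    (hf : ∀ n, ∀ a ∈ 𝒜 (n + 1), f a ∈ 𝒜 n) (a : A) :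
    f (gradeInv 𝒜 a) = - gradeInv 𝒜 (f a) := by
  induction a using graded_induction 𝒜 with
  | hadd a b h h' => simp only [map_add, h, h', neg_add]
  | h n a ha =>
    rw [gradeInv_of_mem 𝒜 ha, map_smul]
    cases n with
    | zero => simp [h₀ a ha]
    | succ n => rw [gradeInv_of_mem 𝒜 (hf n a ha), pow_succ]; simp

end GradeInvLemmas

/-- Contractions `i_h` and an action `L_h` of `H` on a graded algebra which satisfy the identities
of an operation of `H` that do not involve a differential. -/
structure GradedContractions {K : Type*} [Field K] (H : Type*) [Ring H] [HopfAlgebra K H]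
    {A : Type*} [Ring A] [Algebra K A] (𝒜 : ℕ → Submodule K A) [GradedAlgebra 𝒜] where
  /-- The contractions. -/
  i : H →ₗ[K] Module.End K A
  /-- The action. -/
  L : H →ₗ[K] Module.End K A
  i_degree_zero : ∀ h, ∀ a ∈ 𝒜 0, i h a = 0
  i_mem : ∀ h n, ∀ a ∈ 𝒜 (n + 1), i h a ∈ 𝒜 n
  L_mem : ∀ h n, ∀ a ∈ 𝒜 n, L h a ∈ 𝒜 n
  i_one : ∀ a, i 1 a = 0
  L_one : ∀ a, L 1 a = a
  L_map_one : ∀ h, L h 1 = (Coalgebra.counit h : K) • (1 : A)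
  i_mul : ∀ h a b, i h (a * b) = (sw K h fun x y => i x a * L y b) + gradeInv 𝒜 a * i h b
  L_mul : ∀ h a b, L h (a * b) = sw K h fun x y => L x a * L y b
  i_L : ∀ g h a, i g (L h a) = sw K h fun x y => L x (i (rightAd K y g) a)
  L_L : ∀ h g a, L h (L g a) = L (h * g) a

namespace GradedContractions

variable {K : Type*} [Field K] {H : Type*} [Ring H] [HopfAlgebra K H]
  {A : Type*} [Ring A] [Algebra K A] {𝒜 : ℕ → Submodule K A} [GradedAlgebra 𝒜]
  (c : GradedContractions H 𝒜)

theorem i_map_one (h : H) : c.i h 1 = 0 := c.i_degree_zero h 1 SetLike.GradedOne.one_mem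

theorem i_gradeInv (h : H) (a : A) : c.i h (gradeInv 𝒜 a) = - gradeInv 𝒜 (c.i h a) :=
  map_gradeInv_of_degree_neg_one (c.i_degree_zero h) (c.i_mem h) a

theorem L_gradeInv (h : H) (a : A) : c.L h (gradeInv 𝒜 a) = gradeInv 𝒜 (c.L h a) :=
  map_gradeInv_of_degree_zero (c.L_mem h) a

end GradedContractions

/-- The contractions and the diagonal adjoint action on `C(H)`. -/
def MultilinearForms.gradedContractions (K : Type*) [Field K] (H : Type*) [Ring H]
    [HopfAlgebra K H] : GradedContractions H (MultilinearForms.grading K H) where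
  i := contraction
  L := coadjoint
  i_degree_zero := by rintro h _ ⟨f, rfl⟩; exact contraction_of_zero h f
  i_mem := by rintro h n _ ⟨f, rfl⟩; rw [contraction_of_succ]; exact of_mem_grading _ _
  L_mem := by rintro h n _ ⟨f, rfl⟩; rw [coadjoint_of]; exact of_mem_grading _ _
  i_one := contraction_one
  L_one := coadjoint_one
  L_map_one h := by
    rw [one_def, coadjoint_of, Cochain.coad_zero_apply, map_smul]
  i_mul := contraction_mul
  L_mul := coadjoint_mul
  i_L := contraction_coadjoint
  L_L := coadjoint_coadjoint

/-! ### The universal property of the differential envelope -/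

namespace OmegaGr

variable {K : Type*} [Field K] {A : Type*} [Ring A] [Algebra K A]
variable (𝒜 : ℕ → Submodule K A) [GradedAlgebra 𝒜]

theorem mulD_induction {P : OmegaGr 𝒜 → Prop} (hadd : ∀ x y, P x → P y → P (x + y))
    (h : ∀ a b, P (ofAlgebra 𝒜 a * dA 𝒜 b)) (t : A ⊗[K] A) : P (mulD 𝒜 t) := by
  induction t with
  | zero => simpa using h 0 0
  | add x y hx hy => rw [map_add]; exact hadd _ _ hx hy
  | tmul a b => exact h a b

/-- `Ω_gr(A)` is generated by `A` and `d A`. -/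
theorem induction_dA {P : OmegaGr 𝒜 → Prop} (hA : ∀ a, P (ofAlgebra 𝒜 a)) (hd : ∀ a, P (dA 𝒜 a))
    (hmul : ∀ x y, P x → P y → P (x * y)) (hadd : ∀ x y, P x → P y → P (x + y))
    (w : OmegaGr 𝒜) : P w := by
  induction w using induction 𝒜 with
  | hA n a _ => exact hA a
  | hJ n t _ => rw [ofOne_eq]; exact mulD_induction 𝒜 hadd (fun a b => hmul _ _ (hA a) (hd b)) _
  | hmul x y h h' => exact hmul x y h h'
  | hadd x y h h' => exact hadd x y h h'
  -- A scalar is the image of `c • 1` in `A`, so closure under products suffices.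
  | hsmul c x h => rw [← smul_one_mul, ← map_one (ofAlgebra 𝒜), ← map_smul]; exact hmul _ _ (hA _) h

/-- A graded version of `induction_dA`. -/
theorem graded_induction_dA {P : ℕ → OmegaGr 𝒜 → Prop} (hA : ∀ n, ∀ a ∈ 𝒜 n, P n (ofAlgebra 𝒜 a))
    (hd : ∀ n, ∀ a ∈ 𝒜 n, P (n + 1) (dA 𝒜 a))
    (hmul : ∀ m n, ∀ x ∈ grading 𝒜 m, ∀ y ∈ grading 𝒜 n, P m x → P n y → P (m + n) (x * y))
    (hadd : ∀ n x y, P n x → P n y → P n (x + y)) (hsmul : ∀ n (c : K) x, P n x → P n (c • x))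
    (n : ℕ) (w : OmegaGr 𝒜) (hw : w ∈ grading 𝒜 n) : P n w := by
  have hzero (n : ℕ) : P n 0 := by simpa using hA n 0 (zero_mem _)
  induction hw using Submodule.span_induction with
  | zero => exact hzero n
  | add x y _ _ h h' => exact hadd n x y h h'
  | smul c x _ h => exact hsmul n c x h
  | mem x hx =>
    induction hx with
    | ofAlgebra ha => exact hA _ _ ha
    | mul hx hy h h' =>
      exact hmul _ _ _ (Submodule.subset_span hx) _ (Submodule.subset_span hy) h h'
    | @ofModule n t ht =>
      change P n (ofOne 𝒜 t)
      rw [ofOne_eq]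
      cases n with
      | zero =>
        obtain rfl : t = 0 := ht
        simpa using hzero 0
      | succ n =>
        change OmegaOne.incl 𝒜 t ∈ tensorGrading 𝒜 n at ht
        generalize OmegaOne.incl 𝒜 t = t' at ht ⊢
        induction ht using Submodule.span_induction with
        | zero => simpa using hzero _
        | add x y _ _ h h' => rw [map_add]; exact hadd _ _ _ h h'
        | smul c x _ h => rw [map_smul]; exact hsmul _ c _ h
        | mem t ht =>
          obtain ⟨r, s, rfl, a, ha, b, hb, rfl⟩ := ht
          exact hmul r (s + 1) _ (BimoduleTensorAlgebra.ofAlgebra_mem_grading _ _ ha) _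
            (BimoduleTensorAlgebra.ofModule_mem_grading _ _ (OmegaOne.d_mem 𝒜 hb))
            (hA r a ha) (hd s b hb)

section lift

variable {B : Type*} [Ring B] [Algebra K B] (f : A →ₐ[K] B) (D : A →ₗ[K] B)

/-- `t ↦ ∑ f(x) D(y)` for `t = ∑ x ⊗ y` in `A ⊗ A`. -/
def liftTensor : A ⊗[K] A →ₗ[K] B :=
  TensorProduct.lift ((LinearMap.mul K B).compl₁₂ f.toLinearMap D)

@[simp] theorem liftTensor_tmul (x y : A) : liftTensor f D (x ⊗ₜ y) = f x * D y := rfl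

theorem liftTensor_left (a : A) (t : A ⊗[K] A) :
    liftTensor f D ((a ⊗ₜ 1) * t) = f a * liftTensor f D t := by
  induction t with
  | zero => simp
  | add t t' h h' => simp only [mul_add, map_add, h, h']
  | tmul x y => simp [mul_assoc]

/-- The defect of right linearity is f(μ(t)) D(a), with μ the twisted product. It vanishes on the
kernel of μ, that is, on Ω¹_gr(A), where the map is therefore one of bimodules. -/
theorem liftTensor_right
    (hD : ∀ a b, D (a * b) = D a * f b + f (gradeInv 𝒜 a) * D b) (a : A) (t : A ⊗[K] A) :
    liftTensor f D (t * (1 ⊗ₜ a)) =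
      liftTensor f D t * f a + f (twistedMul 𝒜 t) * D a := by
  induction t with
  | zero => simp
  | add t t' h h' => simp only [add_mul, map_add, h, h']; abel
  | tmul x y => simp [hD, mul_add, mul_assoc]

variable (hD : ∀ a b, D (a * b) = D a * f b + f (gradeInv 𝒜 a) * D b)

/-- The universal property of `Ω_gr(A)`: homomorphisms from it correspond to homomorphisms `f` from
`A` together with antiderivations `D` along `f`. -/
def lift : OmegaGr 𝒜 →ₐ[K] B :=
  BimoduleTensorAlgebra.lift f (liftTensor f D ∘ₗ OmegaOne.incl 𝒜)
    (fun a _ => liftTensor_left f D a _)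
    (fun a t => by
      have h := liftTensor_right 𝒜 f D hD a (OmegaOne.incl 𝒜 t)
      rwa [OmegaOne.twistedMul_incl, map_zero, zero_mul, add_zero] at h)

@[simp] theorem lift_ofAlgebra (a : A) : lift 𝒜 f D hD (ofAlgebra 𝒜 a) = f a :=
  BimoduleTensorAlgebra.lift_ofAlgebra _ _ _ _ a

@[simp] theorem lift_dA (a : A) : lift 𝒜 f D hD (dA 𝒜 a) = D a := by
  -- Needed because da contains σ(a) ⊗ 1, which is sent to f(σ(a)) D(1).
  have h1 : D 1 = 0 := by simpa using hD 1 1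
  refine (BimoduleTensorAlgebra.lift_ofModule _ _ _ _ _).trans ?_
  simp [h1]

end lift

variable {𝒜} in
theorem algHom_ext {B : Type*} [Ring B] [Algebra K B] {f g : OmegaGr 𝒜 →ₐ[K] B}
    (hA : ∀ a, f (ofAlgebra 𝒜 a) = g (ofAlgebra 𝒜 a)) (hd : ∀ a, f (dA 𝒜 a) = g (dA 𝒜 a)) :
    f = g :=
  AlgHom.ext fun w => by
    induction w using induction_dA 𝒜 with
    | hA a => exact hA a
    | hd a => exact hd a
    | hmul x y h h' => rw [map_mul, map_mul, h, h']
    | hadd x y h h' => rw [map_add, map_add, h, h']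

end OmegaGr

/-! ### The extension of contractions to the differential envelope -/

section Antiderivation

variable {K : Type*} [Field K] {H : Type*} [Ring H] [HopfAlgebra K H]
  {A : Type*} [Ring A] [Algebra K A] {𝒜 : ℕ → Submodule K A} [GradedAlgebra 𝒜]

/-- The behaviour of `d i_h + i_h d + ε(h)` on products. -/
theorem lieDerivative_mul {d : Module.End K A} {i L : H →ₗ[K] Module.End K A}
    (d_mul : ∀ a b, d (a * b) = d a * b + gradeInv 𝒜 a * d b)
    (gradeInv_d : ∀ a, gradeInv 𝒜 (d a) = - d (gradeInv 𝒜 a))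
    (i_gradeInv : ∀ h a, i h (gradeInv 𝒜 a) = - gradeInv 𝒜 (i h a))
    (i_mul : ∀ h a b, i h (a * b) = (sw K h fun x y => i x a * L y b) + gradeInv 𝒜 a * i h b)
    (L_d : ∀ h a, L h (d a) = d (L h a)) (h : H) (a b : A) :
    lieDerivative d i h (a * b) = (sw K h fun x y => lieDerivative d i x a * L y b) +
      a * (lieDerivative d i h b - L h b) := by
  simp only [lieDerivative, LinearMap.add_apply, LinearMap.comp_apply, LinearMap.smul_apply,
    LinearMap.id_apply, d_mul, i_mul, map_add, map_sw, sw_add_fun, add_mul, smul_mul_assoc,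
    i_gradeInv, L_d, gradeInv_d, neg_mul, sw_neg_fun, gradeInv_gradeInv]
  -- The terms ε(x)a in the Lie derivatives of a add up to a · L_h b, which the last summand of the
  -- conclusion removes again.
  rw [sw_counit_left (f := fun y => a * L y b) h (by fun_prop)]
  noncomm_ring

end Antiderivation

/-! ### Contractions and action on the envelope, from matrices over the convolution algebra -/

namespace GradedContractions

variable {K : Type*} [Field K] {H : Type*} [Ring H] [HopfAlgebra K H]
  {A : Type*} [Ring A] [Algebra K A] {𝒜 : ℕ → Submodule K A} [GradedAlgebra 𝒜]
  (c : GradedContractions H 𝒜)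

open Coalgebra (counit)
open WithConv (toConv ofConv)
open OmegaGr (ofAlgebra dA upper)

/-- Convolution is what turns the sums over the coproduct in the product rules of i and L into
ordinary products. -/
theorem convolution_apply {B : Type*} [Ring B] [Algebra K B] (φ ψ : WithConv (H →ₗ[K] B)) (h : H) :
    (φ * ψ).ofConv h = sw K h fun x y => φ.ofConv x * ψ.ofConv y :=
  (ℛ K h).convMul_apply φ ψ

theorem convolution_ext {B : Type*} [Ring B] [Algebra K B] {φ ψ : WithConv (H →ₗ[K] B)}
    (h : ∀ x, φ.ofConv x = ψ.ofConv x) : φ = ψ :=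
  WithConv.ext (LinearMap.ext h)

variable (H) in
/-- The map `h ↦ ε(h) b`, as an element of the convolution algebra. -/
def convConst {B : Type*} [Ring B] [Algebra K B] : B →ₗ[K] WithConv (H →ₗ[K] B) where
  toFun b := toConv ((counit (R := K) (A := H)).smulRight b)
  map_add' _ _ := convolution_ext fun h => by simp
  map_smul' r _ := convolution_ext fun h => by simp [smul_comm r]

@[simp] theorem convConst_apply {B : Type*} [Ring B] [Algebra K B] (b : B) (h : H) :
    (convConst (K := K) H b).ofConv h = (counit h : K) • b := rfl

/-- The map `h ↦ φ(X_h a)`, as an element of the convolution algebra. -/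
def convApply {B : Type*} [Ring B] [Algebra K B] (φ : A →ₗ[K] B) (X : H →ₗ[K] Module.End K A) :
    A →ₗ[K] WithConv (H →ₗ[K] B) where
  toFun a := toConv (φ ∘ₗ X.flip a)
  map_add' _ _ := convolution_ext fun h => by simp
  map_smul' r _ := convolution_ext fun h => by simp

@[simp] theorem convApply_apply {B : Type*} [Ring B] [Algebra K B] (φ : A →ₗ[K] B)
    (X : H →ₗ[K] Module.End K A) (a : A) (h : H) : (convApply φ X a).ofConv h = φ (X h a) := rfl

/-- The factor ε(h⁽¹⁾) uses up one leg of the coproduct. This is how the term σ(a) i_h(b), which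
carries no coproduct, becomes an entry of a matrix product. -/
theorem convConst_mul_apply {B : Type*} [Ring B] [Algebra K B] (b : B)
    (φ : WithConv (H →ₗ[K] B)) (h : H) : (convConst H b * φ).ofConv h = b * φ.ofConv h := by
  rw [convolution_apply]
  simp only [convConst_apply, smul_mul_assoc]
  exact sw_counit_left (f := fun y => b * φ.ofConv y) h (by fun_prop)

variable (H) in
theorem convConst_mul {B : Type*} [Ring B] [Algebra K B] (b b' : B) :
    convConst (K := K) H (b * b') = convConst H b * convConst H b' :=
  convolution_ext fun h => by simp [convConst_mul_apply, - LinearMap.convMul_apply]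

variable (H) in
theorem convConst_one {B : Type*} [Ring B] [Algebra K B] : convConst (K := K) H (1 : B) = 1 :=
  convolution_ext fun h => (Algebra.algebraMap_eq_smul_one (counit h : K)).symm

/-- The images of the elements of `A` under the homomorphism
`w ↦ (ε σ(w), i w; 0, L w)` of `Ω_gr(A)` into upper triangular matrices over the convolution
algebra of linear maps from `H` to `Ω_gr(A)`. -/
def matrixOfAlgebra : A →ₐ[K] Matrix (Fin 2) (Fin 2) (WithConv (H →ₗ[K] OmegaGr 𝒜)) :=
  AlgHom.ofLinearMap
    { toFun := fun a => upper (convConst H (ofAlgebra 𝒜 (gradeInv 𝒜 a)))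
        (convApply (ofAlgebra 𝒜).toLinearMap c.i a) (convApply (ofAlgebra 𝒜).toLinearMap c.L a)
      map_add' := fun a b => by simp only [map_add, OmegaGr.upper_add]
      map_smul' := fun r a => by simp only [map_smul, RingHom.id_apply, OmegaGr.upper_smul] }
    (by
      change upper _ _ _ = _
      rw [← OmegaGr.upper_one, map_one, map_one, convConst_one]
      congr 1 <;> refine convolution_ext fun h => ?_
      · simp [c.i_map_one]
      · rw [← convConst_one]; simp [c.L_map_one])
    (fun a b => by
      change upper _ _ _ = upper _ _ _ * upper _ _ _
      rw [OmegaGr.upper_mul, map_mul, map_mul, convConst_mul]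
      congr 1 <;> refine convolution_ext fun h => ?_
      · rw [WithConv.ofConv_add, LinearMap.add_apply, convConst_mul_apply, convolution_apply]
        simp [c.i_mul, algHom_sw, add_comm]
      · rw [convolution_apply]
        simp [c.L_mul, algHom_sw])

/-- The images of the elements `d a` under the homomorphism
`w ↦ (ε σ(w), i w; 0, L w)` of `Ω_gr(A)` into upper triangular matrices. -/
def matrixOfD : A →ₗ[K] Matrix (Fin 2) (Fin 2) (WithConv (H →ₗ[K] OmegaGr 𝒜)) where
  toFun a := upper (convConst H (gradeInv (OmegaGr.grading 𝒜) (dA 𝒜 a)))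
    -- The value of i_h(da) forced by d i_h + i_h d + ε(h) = L_h.
    (convApply (ofAlgebra 𝒜).toLinearMap c.L a - convConst H (ofAlgebra 𝒜 a) -
      convApply (dA 𝒜) c.i a)
    (convApply (dA 𝒜) c.L a)
  map_add' a b := by
    simp only [map_add, OmegaGr.upper_add]
    congr 1
    abel
  map_smul' r a := by simp only [map_smul, RingHom.id_apply, OmegaGr.upper_smul, smul_sub]

theorem matrixOfAlgebra_apply (a : A) : c.matrixOfAlgebra a =
    upper (convConst H (ofAlgebra 𝒜 (gradeInv 𝒜 a)))
        (convApply (ofAlgebra 𝒜).toLinearMap c.i a) (convApply (ofAlgebra 𝒜).toLinearMap c.L a) :=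
  rfl

/-- The condition needed to extend to Ω_gr(A). Only the upper right entry is delicate: the first
product contributes -a · L_h b, from the -ε(h)a part of i_h(da), and the second contributes a · L_h
b. The signs match since i_h anticommutes with σ, as does d, while L_h commutes with it. -/
theorem matrixOfD_mul (a b : A) : c.matrixOfD (a * b) =
    c.matrixOfD a * c.matrixOfAlgebra b + c.matrixOfAlgebra (gradeInv 𝒜 a) * c.matrixOfD b := by
  simp only [matrixOfAlgebra_apply]
  change upper _ _ _ = upper _ _ _ * _ + _ * upper _ _ _
  rw [OmegaGr.upper_mul, OmegaGr.upper_mul, OmegaGr.upper_add, gradeInv_gradeInv]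
  congr 1
  · rw [← convConst_mul, ← convConst_mul, ← map_add]
    congr 1
    rw [OmegaGr.dA_mul, map_add, map_mul, map_mul, OmegaGr.gradeInv_ofAlgebra,
      OmegaGr.gradeInv_ofAlgebra, gradeInv_gradeInv]
  · refine convolution_ext fun h => ?_
    simp only [WithConv.ofConv_add, LinearMap.add_apply, convConst_mul_apply, sub_mul,
      WithConv.ofConv_sub, LinearMap.sub_apply]
    simp only [convolution_apply, convApply_apply, convConst_apply, AlgHom.toLinearMap_apply,
      c.i_mul, c.L_mul, map_sw, map_add, OmegaGr.dA_mul, map_mul, c.i_gradeInv, OmegaGr.gradeInv_dA, sw_add_fun, map_neg, neg_mul, sw_neg_fun,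
      gradeInv_gradeInv]
    simp only [mul_sub, mul_smul_comm]
    abel
  · refine convolution_ext fun h => ?_
    rw [WithConv.ofConv_add, LinearMap.add_apply, convolution_apply, convolution_apply]
    simp [c.L_mul, map_sw, OmegaGr.dA_mul, sw_add_fun, c.L_gradeInv]

/-- The homomorphism `w ↦ (ε σ(w), i w; 0, L w)` of `Ω_gr(A)` into upper triangular matrices. -/
def matrixHom : OmegaGr 𝒜 →ₐ[K] Matrix (Fin 2) (Fin 2) (WithConv (H →ₗ[K] OmegaGr 𝒜)) :=
  OmegaGr.lift 𝒜 c.matrixOfAlgebra c.matrixOfD c.matrixOfD_mul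

/-- The contractions on `Ω_gr(A)`. -/
def envelopeI : H →ₗ[K] Module.End K (OmegaGr 𝒜) :=
  LinearMap.mk₂ K (fun h w => (c.matrixHom w 0 1).ofConv h) (fun _ _ _ => map_add _ _ _)
    (fun _ _ _ => map_smul _ _ _) (fun h w w' => by simp) (fun r h w => by simp)

/-- The action of `H` on `Ω_gr(A)`. -/
def envelopeL : H →ₗ[K] Module.End K (OmegaGr 𝒜) :=
  LinearMap.mk₂ K (fun h w => (c.matrixHom w 1 1).ofConv h) (fun _ _ _ => map_add _ _ _)
    (fun _ _ _ => map_smul _ _ _) (fun h w w' => by simp) (fun r h w => by simp)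

theorem matrixHom_ofAlgebra (a : A) : c.matrixHom (ofAlgebra 𝒜 a) = c.matrixOfAlgebra a :=
  OmegaGr.lift_ofAlgebra _ _ _ _ a

theorem matrixHom_dA (a : A) : c.matrixHom (dA 𝒜 a) = c.matrixOfD a :=
  OmegaGr.lift_dA _ _ _ _ a

@[simp] theorem envelopeI_ofAlgebra (h : H) (a : A) :
    c.envelopeI h (ofAlgebra 𝒜 a) = ofAlgebra 𝒜 (c.i h a) := by
  change (c.matrixHom (ofAlgebra 𝒜 a) 0 1).ofConv h = _
  rw [matrixHom_ofAlgebra]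
  rfl

@[simp] theorem envelopeL_ofAlgebra (h : H) (a : A) :
    c.envelopeL h (ofAlgebra 𝒜 a) = ofAlgebra 𝒜 (c.L h a) := by
  change (c.matrixHom (ofAlgebra 𝒜 a) 1 1).ofConv h = _
  rw [matrixHom_ofAlgebra]
  rfl

@[simp] theorem envelopeI_dA (h : H) (a : A) : c.envelopeI h (dA 𝒜 a) =
    ofAlgebra 𝒜 (c.L h a) - (counit h : K) • ofAlgebra 𝒜 a - dA 𝒜 (c.i h a) := by
  change (c.matrixHom (dA 𝒜 a) 0 1).ofConv h = _
  rw [matrixHom_dA]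
  rfl

@[simp] theorem envelopeL_dA (h : H) (a : A) :
    c.envelopeL h (dA 𝒜 a) = dA 𝒜 (c.L h a) := by
  change (c.matrixHom (dA 𝒜 a) 1 1).ofConv h = _
  rw [matrixHom_dA]
  rfl

/-- With the first column known, the second column of a product of matrices spells out the product
rules of i and L. -/
theorem matrixHom_apply_zero (w : OmegaGr 𝒜) :
    c.matrixHom w 0 0 = convConst H (gradeInv (OmegaGr.grading 𝒜) w) ∧ c.matrixHom w 1 0 = 0 := by
  induction w using OmegaGr.induction_dA 𝒜 with
  | hA a => rw [matrixHom_ofAlgebra, OmegaGr.gradeInv_ofAlgebra]; exact ⟨rfl, rfl⟩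
  | hd a => rw [matrixHom_dA]; exact ⟨rfl, rfl⟩
  | hmul x y h h' =>
    simp only [map_mul, Matrix.mul_apply, Fin.sum_univ_two, h.1, h.2, h'.1, h'.2, mul_zero,
      zero_mul, add_zero, convConst_mul, and_self]
  | hadd x y h h' =>
    simp only [map_add, Matrix.add_apply, h.1, h.2, h'.1, h'.2, add_zero, and_self]

theorem envelopeI_mul (h : H) (x y : OmegaGr 𝒜) : c.envelopeI h (x * y) =
    (sw K h fun a b => c.envelopeI a x * c.envelopeL b y) +
      gradeInv (OmegaGr.grading 𝒜) x * c.envelopeI h y := by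
  change (c.matrixHom (x * y) 0 1).ofConv h = _
  rw [map_mul, Matrix.mul_apply, Fin.sum_univ_two, (c.matrixHom_apply_zero x).1,
    WithConv.ofConv_add, LinearMap.add_apply, convConst_mul_apply, convolution_apply, add_comm]
  rfl

theorem envelopeL_mul (h : H) (x y : OmegaGr 𝒜) : c.envelopeL h (x * y) =
    sw K h fun a b => c.envelopeL a x * c.envelopeL b y := by
  change (c.matrixHom (x * y) 1 1).ofConv h = _
  rw [map_mul, Matrix.mul_apply, Fin.sum_univ_two, (c.matrixHom_apply_zero x).2, zero_mul, zero_add,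
    convolution_apply]
  rfl

end GradedContractions

/-! ### Degrees, Lie derivative and commutation relations on the envelope -/

namespace GradedContractions

variable {K : Type*} [Field K] {H : Type*} [Ring H] [HopfAlgebra K H]
  {A : Type*} [Ring A] [Algebra K A] {𝒜 : ℕ → Submodule K A} [GradedAlgebra 𝒜]
  (c : GradedContractions H 𝒜)

open Coalgebra (counit)
open OmegaGr (ofAlgebra dA)

theorem sw_mem {M : Type*} [AddCommGroup M] [Module K M] {S : Submodule K M} {h : H}
    {F : H → H → M} (hF : ∀ x y, F x y ∈ S) : sw K h F ∈ S :=
  Submodule.sum_mem _ fun _ _ => hF _ _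

theorem ofAlgebra_mem {n : ℕ} {a : A} (ha : a ∈ 𝒜 n) :
    ofAlgebra 𝒜 a ∈ OmegaGr.grading 𝒜 n :=
  BimoduleTensorAlgebra.ofAlgebra_mem_grading _ _ ha

theorem dA_mem {n : ℕ} {a : A} (ha : a ∈ 𝒜 n) : dA 𝒜 a ∈ OmegaGr.grading 𝒜 (n + 1) :=
  BimoduleTensorAlgebra.ofModule_mem_grading _ _ (OmegaOne.d_mem 𝒜 ha)

theorem envelopeL_mem (h : H) (n : ℕ) (w : OmegaGr 𝒜) (hw : w ∈ OmegaGr.grading 𝒜 n) :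
    c.envelopeL h w ∈ OmegaGr.grading 𝒜 n := by
  refine OmegaGr.graded_induction_dA 𝒜
    (P := fun n w => ∀ h, c.envelopeL h w ∈ OmegaGr.grading 𝒜 n) ?_ ?_ ?_ ?_ ?_ n w hw h
  · intro n a ha h
    rw [envelopeL_ofAlgebra]
    exact ofAlgebra_mem (c.L_mem h n a ha)
  · intro n a ha h
    rw [envelopeL_dA]
    exact dA_mem (c.L_mem h n a ha)
  · intro m n x _ y _ hx hy h
    rw [envelopeL_mul]
    exact sw_mem fun a b => SetLike.GradedMul.mul_mem (hx a) (hy b)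
  · intro n x y hx hy h
    rw [map_add]
    exact add_mem (hx h) (hy h)
  · intro n r x hx h
    rw [map_smul]
    exact Submodule.smul_mem _ r (hx h)

variable (𝒜) in
/-- The homogeneous component of degree `n - 1`, which is zero for `n = 0`. -/
def lowered : ℕ → Submodule K A
  | 0 => ⊥
  | n + 1 => 𝒜 n

theorem lowered_mul_mem {m n : ℕ} {x y : A} (hx : x ∈ lowered 𝒜 m) (hy : y ∈ 𝒜 n) :
    x * y ∈ lowered 𝒜 (m + n) := by
  cases m with
  | zero => obtain rfl : x = 0 := hx; rw [zero_mul]; exact zero_mem _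
  | succ m => rw [Nat.add_right_comm]; exact SetLike.GradedMul.mul_mem (A := 𝒜) hx hy

theorem mul_lowered_mem {m n : ℕ} {x y : A} (hx : x ∈ 𝒜 m) (hy : y ∈ lowered 𝒜 n) :
    x * y ∈ lowered 𝒜 (m + n) := by
  cases n with
  | zero => obtain rfl : y = 0 := hy; rw [mul_zero]; exact zero_mem _
  | succ n => exact SetLike.GradedMul.mul_mem (A := 𝒜) hx hy

theorem i_mem_lowered (h : H) {n : ℕ} {a : A} (ha : a ∈ 𝒜 n) : c.i h a ∈ lowered 𝒜 n := by
  cases n with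
  | zero => exact c.i_degree_zero h a ha
  | succ n => exact c.i_mem h n a ha

/-- With the convention that the component below degree 0 is zero, this gives both the vanishing in
degree 0 and the lowering of positive degrees. -/
theorem envelopeI_mem_lowered (h : H) {n : ℕ} {w : OmegaGr 𝒜} (hw : w ∈ OmegaGr.grading 𝒜 n) :
    c.envelopeI h w ∈ lowered (OmegaGr.grading 𝒜) n := by
  refine OmegaGr.graded_induction_dA 𝒜
    (P := fun n w => ∀ h, c.envelopeI h w ∈ lowered (OmegaGr.grading 𝒜) n) ?_ ?_ ?_ ?_ ?_ n w hw h
  · intro n a ha h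
    rw [envelopeI_ofAlgebra]
    have := c.i_mem_lowered h ha
    cases n with
    | zero => have h0 : c.i h a = 0 := this; rw [h0, map_zero]; exact zero_mem _
    | succ n => exact ofAlgebra_mem (n := n) this
  · intro n a ha h
    rw [envelopeI_dA]
    refine sub_mem (sub_mem (ofAlgebra_mem (c.L_mem h n a ha))
      (Submodule.smul_mem _ _ (ofAlgebra_mem ha))) ?_
    have := c.i_mem_lowered h ha
    cases n with
    | zero => have h0 : c.i h a = 0 := this; rw [h0, map_zero]; exact zero_mem _
    | succ n => exact dA_mem (n := n) this
  · intro m n x hx y hy hx' hy' h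
    rw [envelopeI_mul, gradeInv_of_mem _ hx]
    exact add_mem (sw_mem fun a b => lowered_mul_mem (hx' a) (c.envelopeL_mem b n y hy))
      (mul_lowered_mem (Submodule.smul_mem _ _ hx) (hy' h))
  · intro n x y hx hy h
    rw [map_add]
    exact add_mem (hx h) (hy h)
  · intro n r x hx h
    rw [map_smul]
    exact Submodule.smul_mem _ r (hx h)

theorem envelopeI_gradeInv (h : H) (w : OmegaGr 𝒜) :
    c.envelopeI h (gradeInv (OmegaGr.grading 𝒜) w) =
      - gradeInv (OmegaGr.grading 𝒜) (c.envelopeI h w) :=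
  map_gradeInv_of_degree_neg_one (fun _ hw => c.envelopeI_mem_lowered h hw)
    (fun _ _ hw => c.envelopeI_mem_lowered h hw) w

theorem envelopeL_gradeInv (h : H) (w : OmegaGr 𝒜) :
    c.envelopeL h (gradeInv (OmegaGr.grading 𝒜) w) =
      gradeInv (OmegaGr.grading 𝒜) (c.envelopeL h w) :=
  map_gradeInv_of_degree_zero (c.envelopeL_mem h) w

theorem d_ofAlgebra (a : A) : OmegaGr.d 𝒜 (ofAlgebra 𝒜 a) = dA 𝒜 a := OmegaGr.d_ofAlgebra 𝒜 a

theorem envelopeL_d (h : H) (w : OmegaGr 𝒜) :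
    c.envelopeL h (OmegaGr.d 𝒜 w) = OmegaGr.d 𝒜 (c.envelopeL h w) := by
  induction w using OmegaGr.induction_dA 𝒜 generalizing h with
  | hA a => simp only [d_ofAlgebra, envelopeL_dA, envelopeL_ofAlgebra]
  | hd a => simp only [OmegaGr.d_dA, envelopeL_dA, map_zero]
  | hmul x y hx hy =>
    simp only [OmegaGr.d_mul, envelopeL_mul, map_add, map_sw, hx, hy, sw_add_fun,
      envelopeL_gradeInv]
  | hadd x y hx hy => simp only [map_add, hx, hy]

/-- On A this is how i_h(da) was chosen, on dA it follows from d² = 0. On products the error term of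
`lieDerivative_mul` disappears because the claim holds for the second factor. -/
theorem lieDerivative_envelopeI (h : H) :
    lieDerivative (OmegaGr.d 𝒜) c.envelopeI h = c.envelopeL h := by
  ext w
  induction w using OmegaGr.induction_dA 𝒜 generalizing h with
  | hA a => simp [lieDerivative, d_ofAlgebra]
  | hd a => simp [lieDerivative, d_ofAlgebra, OmegaGr.d_dA]
  | hmul x y hx hy =>
    rw [lieDerivative_mul (OmegaGr.d_mul 𝒜) (OmegaGr.gradeInv_d 𝒜) c.envelopeI_gradeInv
      c.envelopeI_mul c.envelopeL_d, envelopeL_mul]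
    simp only [hx, hy, sub_self, mul_zero, add_zero]
  | hadd x y hx hy => simp only [map_add, hx, hy]

theorem envelopeI_d (h : H) (w : OmegaGr 𝒜) : c.envelopeI h (OmegaGr.d 𝒜 w) =
    c.envelopeL h w - (counit h : K) • w - OmegaGr.d 𝒜 (c.envelopeI h w) := by
  rw [← lieDerivative_envelopeI]
  simp [lieDerivative]

theorem envelope_one (w : OmegaGr 𝒜) : c.envelopeI 1 w = 0 ∧ c.envelopeL 1 w = w := by
  induction w using OmegaGr.induction_dA 𝒜 with
  | hA a => simp [c.i_one, c.L_one]
  | hd a => simp [c.i_one, c.L_one]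
  | hmul x y hx hy =>
    rw [envelopeI_mul, envelopeL_mul, sw_one (by fun_prop) (by fun_prop),
      sw_one (by fun_prop) (by fun_prop)]
    simp [hx.1, hx.2, hy.1, hy.2]
  | hadd x y hx hy => simp only [map_add, hx.1, hx.2, hy.1, hy.2, add_zero, and_self]

theorem envelopeL_envelopeL (h g : H) (w : OmegaGr 𝒜) :
    c.envelopeL h (c.envelopeL g w) = c.envelopeL (h * g) w := by
  induction w using OmegaGr.induction_dA 𝒜 generalizing h g with
  | hA a => simp [c.L_L]
  | hd a => simp [c.L_L]
  | hmul x y hx hy =>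
    rw [envelopeL_mul _ (h * g), sw_mul h g (by fun_prop) (by fun_prop), sw_comm, envelopeL_mul]
    simp only [map_sw, envelopeL_mul, hx, hy]
  | hadd x y hx hy => simp only [map_add, hx, hy]

/-- Writing i d as L - ε - d i, the relation for w handles the last term, and what remains is ∑
L_{h⁽¹⁾} L_{ad(h⁽²⁾)g} = L_{gh}, from ∑ h⁽¹⁾ ad(h⁽²⁾)g = g h. -/
theorem envelopeI_envelopeL_d {w : OmegaGr 𝒜} (hw : ∀ g h : H, c.envelopeI g (c.envelopeL h w) =
      sw K h fun a b => c.envelopeL a (c.envelopeI (rightAd K b g) w)) (g h : H) :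
    c.envelopeI g (c.envelopeL h (OmegaGr.d 𝒜 w)) =
      sw K h fun a b => c.envelopeL a (c.envelopeI (rightAd K b g) (OmegaGr.d 𝒜 w)) := by
  simp only [envelopeL_d, envelopeI_d, hw, map_sub, sw_sub_fun, envelopeL_envelopeL, map_sw,
    counit_rightAd, map_smul, mul_smul]
  rw [sw_mul_rightAd (f := fun z => c.envelopeL z w) h g (by fun_prop),
    sw_counit_right (f := fun a => (counit g : K) • c.envelopeL a w) h (by fun_prop)]

/-- On a product, the terms where the contraction hits the second factor agree by coassociativity,
and those where it hits the first factor by `sw_comul_rightAd`. -/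
theorem envelopeI_envelopeL (g h : H) (w : OmegaGr 𝒜) :
    c.envelopeI g (c.envelopeL h w) =
      sw K h fun a b => c.envelopeL a (c.envelopeI (rightAd K b g) w) := by
  have hA (g h : H) (a : A) : c.envelopeI g (c.envelopeL h (ofAlgebra 𝒜 a)) =
      sw K h fun x y => c.envelopeL x (c.envelopeI (rightAd K y g) (ofAlgebra 𝒜 a)) := by
    simp only [envelopeL_ofAlgebra, envelopeI_ofAlgebra, c.i_L, algHom_sw]
  induction w using OmegaGr.induction_dA 𝒜 generalizing g h with
  | hA a => exact hA g h a
  | hd a => rw [← d_ofAlgebra]; exact c.envelopeI_envelopeL_d (fun g h => hA g h a) g h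
  | hadd x y hx hy => simp only [map_add, hx, hy, sw_add_fun]
  | hmul x y hx hy =>
    have h₁ : c.envelopeI g (c.envelopeL h (x * y)) =
        (sw K h fun a b => sw K a fun a₁ a₂ => sw K g fun p q =>
          c.envelopeL a₁ (c.envelopeI (rightAd K a₂ p) x) * c.envelopeL (q * b) y) +
        sw K h fun a b => sw K b fun b₁ b₂ =>
          c.envelopeL a (gradeInv (OmegaGr.grading 𝒜) x) *
            c.envelopeL b₁ (c.envelopeI (rightAd K b₂ g) y) := by
      simp only [envelopeL_mul, envelopeI_mul, map_sw, sw_add_fun, hx, hy, envelopeL_envelopeL,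
        envelopeL_gradeInv, sw_const_mul, ← sw_mul_const]
      congr! 4 with a b
      rw [sw_comm]
    have h₂ : (sw K h fun a b => c.envelopeL a (c.envelopeI (rightAd K b g) (x * y))) =
        (sw K h fun a b => sw K a fun a₁ a₂ => sw K (rightAd K b g) fun k l =>
          c.envelopeL a₁ (c.envelopeI k x) * c.envelopeL (a₂ * l) y) +
        sw K h fun a b => sw K a fun a₁ a₂ =>
          c.envelopeL a₁ (gradeInv (OmegaGr.grading 𝒜) x) *
            c.envelopeL a₂ (c.envelopeI (rightAd K b g) y) := by
      simp only [envelopeL_mul, envelopeI_mul, map_sw, sw_add_fun, map_add, envelopeL_envelopeL]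
      congr! 4 with a b
      rw [sw_comm]
    rw [h₁, h₂]
    congr 1
    · rw [sw_assoc (F := fun a₁ a₂ b => sw K g fun p q =>
          c.envelopeL a₁ (c.envelopeI (rightAd K a₂ p) x) * c.envelopeL (q * b) y) h
          (by fun_prop) (by fun_prop) (by fun_prop),
        sw_assoc (F := fun a₁ a₂ b => sw K (rightAd K b g) fun k l =>
          c.envelopeL a₁ (c.envelopeI k x) * c.envelopeL (a₂ * l) y) h
          (by fun_prop) (by fun_prop) (by fun_prop)]
      congr! 3 with a₁ w
      exact (sw_comul_rightAd (F := fun k l =>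
        c.envelopeL a₁ (c.envelopeI k x) * c.envelopeL l y) w g (by fun_prop) (by fun_prop)).symm
    · exact (sw_assoc (F := fun a₁ a₂ b => c.envelopeL a₁ (gradeInv (OmegaGr.grading 𝒜) x) *
            c.envelopeL a₂ (c.envelopeI (rightAd K b g) y)) h
          (by fun_prop) (by fun_prop) (by fun_prop)).symm

/-- The operation of `H` in `Ω_gr(A)` induced by contractions on `A`. -/
def operation : HopfOperation H (differentialEnvelope 𝒜) where
  i := c.envelopeI
  i_degree_zero h _ hw := c.envelopeI_mem_lowered h hw
  i_mem h _ _ hw := c.envelopeI_mem_lowered h hw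
  i_one := LinearMap.ext fun w => (c.envelope_one w).1
  i_mul h n x y hx := by
    -- Stated on `OmegaGr 𝒜` and with `sw`, to which the carrier and the sum of the goal are only
    -- definitionally equal.
    have key (x y : OmegaGr 𝒜) (hx : x ∈ OmegaGr.grading 𝒜 n) : c.envelopeI h (x * y) =
        sw K h (fun a b =>
          c.envelopeI a x * lieDerivative (OmegaGr.d 𝒜) c.envelopeI b y) +
            (-1 : K) ^ n • (x * c.envelopeI h y) := by
      simp only [lieDerivative_envelopeI]
      rw [envelopeI_mul, gradeInv_of_mem _ hx, smul_mul_assoc]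
    exact key x y hx
  i_comp_L g h := by
    change c.envelopeI g ∘ₗ lieDerivative (OmegaGr.d 𝒜) c.envelopeI h = sw K h (fun a b =>
      lieDerivative (OmegaGr.d 𝒜) c.envelopeI a ∘ₗ c.envelopeI (rightAd K b g))
    simp only [lieDerivative_envelopeI]
    ext w
    rw [sw_apply]
    exact c.envelopeI_envelopeL g h w
  L_comp_L h g := by
    change lieDerivative (OmegaGr.d 𝒜) c.envelopeI h ∘ₗ lieDerivative (OmegaGr.d 𝒜) c.envelopeI g =
      lieDerivative (OmegaGr.d 𝒜) c.envelopeI (h * g)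
    simp only [lieDerivative_envelopeI]
    ext w
    exact c.envelopeL_envelopeL h g w

end GradedContractions

/-! ### Operations and morphisms -/

theorem GradedDiffAlgebra.gradeInv_d {K : Type u} [Field K] (Ω : GradedDiffAlgebra.{u, w} K)
    (a : Ω.carrier) : gradeInv Ω.grading (Ω.d a) = - Ω.d (gradeInv Ω.grading a) := by
  induction a using graded_induction Ω.grading with
  | hadd a b h h' => simp only [map_add, h, h', neg_add]
  | h n a ha =>
    rw [gradeInv_of_mem _ ha, gradeInv_of_mem _ (Ω.d_mem n a ha), map_smul, pow_succ]
    simp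

theorem GradedDiffAlgebra.d_mul_gradeInv {K : Type u} [Field K] (Ω : GradedDiffAlgebra.{u, w} K)
    (a b : Ω.carrier) : Ω.d (a * b) = Ω.d a * b + gradeInv Ω.grading a * Ω.d b := by
  induction a using graded_induction Ω.grading with
  | hadd a a' h h' => simp only [add_mul, map_add, h, h']; abel
  | h n a ha => rw [gradeInv_of_mem _ ha, Ω.d_mul n a b ha, smul_mul_assoc]

namespace HopfOperation

variable {K : Type u} [Field K] {H : Type v} [Ring H] [HopfAlgebra K H]
  {Ω : GradedDiffAlgebra.{u, w} K} (op : HopfOperation H Ω)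

open Coalgebra (counit)

theorem ext_i {op op' : HopfOperation H Ω} (h : op.i = op'.i) : op = op' := by
  cases op
  cases op'
  congr

theorem L_apply (h : H) (a : Ω.carrier) :
    op.L h a = Ω.d (op.i h a) + op.i h (Ω.d a) + (counit h : K) • a := rfl

/-- The maps `L_h`, as a linear map in `h`. -/
def LHom : H →ₗ[K] Module.End K Ω.carrier where
  toFun := op.L
  map_add' h g := by ext a; simp only [L_apply, map_add, add_smul, LinearMap.add_apply]; abel
  map_smul' c h := by ext a; simp [L_apply, mul_smul]

theorem i_gradeInv (h : H) (a : Ω.carrier) :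
    op.i h (gradeInv Ω.grading a) = - gradeInv Ω.grading (op.i h a) :=
  map_gradeInv_of_degree_neg_one (op.i_degree_zero h) (op.i_mem h) a

theorem L_d (h : H) (a : Ω.carrier) : op.L h (Ω.d a) = Ω.d (op.L h a) := by
  simp [L_apply, Ω.d_d]

theorem i_d (h : H) (a : Ω.carrier) :
    op.i h (Ω.d a) = op.L h a - (counit h : K) • a - Ω.d (op.i h a) := by
  rw [L_apply]
  abel

theorem i_mul_gradeInv (h : H) (a b : Ω.carrier) : op.i h (a * b) =
    (sw K h fun x y => op.i x a * op.LHom y b) + gradeInv Ω.grading a * op.i h b := by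
  induction a using graded_induction Ω.grading with
  | hadd a a' h h' => simp only [add_mul, map_add, h, h', sw_add_fun]; abel
  | h n a ha =>
    rw [op.i_mul h n a b ha, gradeInv_of_mem _ ha, smul_mul_assoc]
    rfl

/-- Not an axiom of operations: it follows from the rule for i_h by `lieDerivative_mul`, whose error
term is zero when the action is the Lie derivative itself. -/
theorem L_mul (h : H) (a b : Ω.carrier) :
    op.L h (a * b) = sw K h fun x y => op.L x a * op.L y b := by
  have := lieDerivative_mul (d := Ω.d) (i := op.i) (L := op.LHom) Ω.d_mul_gradeInv Ω.gradeInv_d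
    op.i_gradeInv op.i_mul_gradeInv op.L_d h a b
  rw [show lieDerivative Ω.d op.i h b - op.LHom h b = 0 from sub_self _, mul_zero, add_zero] at this
  exact this

/-! ### Homomorphisms commuting with two operations -/

section Morphism

variable {Ω' : GradedDiffAlgebra.{u, w'} K} (op' : HopfOperation H Ω')
  (f : Ω.carrier →ₐ[K] Ω'.carrier)

theorem map_gradeInv {f : Ω.carrier →ₐ[K] Ω'.carrier}
    (hf : ∀ n, ∀ a ∈ Ω.grading n, f a ∈ Ω'.grading n)
    (a : Ω.carrier) : f (gradeInv Ω.grading a) = gradeInv Ω'.grading (f a) := by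
  induction a using graded_induction Ω.grading with
  | hadd a a' h h' => simp only [map_add, h, h']
  | h n a ha => rw [gradeInv_of_mem _ ha, gradeInv_of_mem _ (hf n a ha), map_smul]

/-- `f` commutes with all `i_h` and `L_h` on the element `a`. -/
def CommutesAt (a : Ω.carrier) : Prop :=
  ∀ h : H, f (op.i h a) = op'.i h (f a) ∧ f (op.L h a) = op'.L h (f a)

variable {op op' f}

theorem CommutesAt.add {a b : Ω.carrier} (ha : CommutesAt op op' f a)
    (hb : CommutesAt op op' f b) : CommutesAt op op' f (a + b) := fun h => by
  simp only [map_add, (ha h).1, (ha h).2, (hb h).1, (hb h).2, and_self]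

/-- The contraction of a product involves L on the second factor, so i and L have to be carried
along together. -/
theorem CommutesAt.mul {a b : Ω.carrier} (hf : ∀ n, ∀ a ∈ Ω.grading n, f a ∈ Ω'.grading n)
    (ha : CommutesAt op op' f a) (hb : CommutesAt op op' f b) :
    CommutesAt op op' f (a * b) := fun h => by
  have hL (y : H) : f (op.LHom y b) = op'.LHom y (f b) := (hb y).2
  constructor
  · simp only [i_mul_gradeInv, map_add, map_mul, algHom_sw, fun x => (ha x).1, hL,
      map_gradeInv hf, fun x => (hb x).1]
  · simp only [L_mul, map_mul, algHom_sw, fun x => (ha x).2, fun x => (hb x).2]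

/-- i_h(da) is determined by i_h a and L_h a, and L_h commutes with d. -/
theorem CommutesAt.d {a : Ω.carrier} (hd : ∀ a, f (Ω.d a) = Ω'.d (f a))
    (ha : CommutesAt op op' f a) : CommutesAt op op' f (Ω.d a) := fun h => by
  simp only [i_d, L_d, hd, map_sub, map_smul, (ha h).1, (ha h).2, and_self]

end Morphism

end HopfOperation

/-! ### The Weil algebra as an initial object -/

section Weil

variable {K : Type u} [Field K] {H : Type v} [Ring H] [HopfAlgebra K H]

open MultilinearForms (grading)

theorem isConnection_operation :
    IsConnection (MultilinearForms.gradedContractions K H).operation (weilConnection K H) where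
  map_mem _ _ hΨ := BimoduleTensorAlgebra.ofAlgebra_mem_grading _ _ hΨ
  i_comm h Ψ := GradedContractions.envelopeI_ofAlgebra _ h Ψ
  L_comm h Ψ := by
    rw [MultilinearForms.L, MultilinearForms.L_eq_coadjoint]
    exact (LinearMap.congr_fun (GradedContractions.lieDerivative_envelopeI _ h) _).trans
      (GradedContractions.envelopeL_ofAlgebra _ h Ψ)

variable (X : HopfOperationConn.{u, v, w} K H)

/-- The homomorphism of graded differential algebras from `W(H)` which extends a connection. -/
def weilLift : OmegaGr (grading K H) →ₐ[K] X.Ω.carrier :=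
  OmegaGr.lift (grading K H) X.α (X.Ω.d ∘ₗ X.α.toLinearMap) fun a b => by
    -- Preservation of degrees makes α compatible with the signs, so that d ∘ α is an antiderivation
    -- along α.
    have h : X.α (gradeInv (grading K H) a) = gradeInv X.Ω.grading (X.α a) := by
      induction a using graded_induction (grading K H) with
      | hadd a a' h h' => simp only [map_add, h, h']
      | h n a ha =>
        rw [gradeInv_of_mem _ ha, gradeInv_of_mem _ (X.isConnection.map_mem n a ha), map_smul]
    simp only [LinearMap.comp_apply, AlgHom.toLinearMap_apply, map_mul, X.Ω.d_mul_gradeInv, h]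

theorem weilLift_ofAlgebra (a : MultilinearForms K H) :
    weilLift X (OmegaGr.ofAlgebra (grading K H) a) = X.α a :=
  OmegaGr.lift_ofAlgebra _ _ _ _ a

theorem weilLift_dA (a : MultilinearForms K H) :
    weilLift X (OmegaGr.dA (grading K H) a) = X.Ω.d (X.α a) :=
  OmegaGr.lift_dA _ _ _ _ a

theorem weilLift_mem (n : ℕ) (w : OmegaGr (grading K H))
    (hw : w ∈ OmegaGr.grading (grading K H) n) : weilLift X w ∈ X.Ω.grading n := by
  refine OmegaGr.graded_induction_dA (grading K H) (P := fun n w => weilLift X w ∈ X.Ω.grading n)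
    ?_ ?_ ?_ ?_ ?_ n w hw
  · intro n a ha
    rw [weilLift_ofAlgebra]
    exact X.isConnection.map_mem n a ha
  · intro n a ha
    rw [weilLift_dA]
    exact X.Ω.d_mem n _ (X.isConnection.map_mem n a ha)
  · intro m n x _ y _ hx hy
    rw [map_mul]
    exact SetLike.GradedMul.mul_mem hx hy
  · intro n x y hx hy
    rw [map_add]
    exact add_mem hx hy
  · intro n r x hx
    rw [map_smul]
    exact Submodule.smul_mem _ r hx

theorem weilLift_d (w : OmegaGr (grading K H)) :
    weilLift X (OmegaGr.d (grading K H) w) = X.Ω.d (weilLift X w) := by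
  induction w using OmegaGr.induction_dA with
  | hA a => rw [GradedContractions.d_ofAlgebra, weilLift_dA, weilLift_ofAlgebra]
  | hd a => rw [OmegaGr.d_dA, weilLift_dA, X.Ω.d_d, map_zero]
  | hmul x y hx hy =>
    have h : weilLift X (gradeInv (OmegaGr.grading (grading K H)) x) =
        gradeInv X.Ω.grading (weilLift X x) :=
      HopfOperation.map_gradeInv (Ω := weilAlgebra K H) (weilLift_mem X) x
    rw [OmegaGr.d_mul, map_mul, X.Ω.d_mul_gradeInv, map_add, map_mul, map_mul, hx, hy, h]
  | hadd x y hx hy => simp only [map_add, hx, hy]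

variable (op : HopfOperation H (weilAlgebra K H)) (hop : IsConnection op (weilConnection K H))

/-- On C(H) both connections transport the same contractions and Lie derivatives; the set of
elements where the map commutes is closed under sums and products and contains dC(H). Any operation
making α_W a connection is allowed, so the result serves both for morphisms and for uniqueness of
the operation. -/
theorem weilLift_commutesAt (hop : IsConnection op (weilConnection K H))
    (w : OmegaGr (grading K H)) :
    HopfOperation.CommutesAt (Ω := weilAlgebra K H) op X.op (weilLift X) w := by
  have hα (a : MultilinearForms K H) : HopfOperation.CommutesAt (Ω := weilAlgebra K H) op X.op
      (weilLift X) (OmegaGr.ofAlgebra (grading K H) a) := fun h =>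
    ⟨(congrArg (weilLift X) (hop.i_comm h a)).trans ((weilLift_ofAlgebra X _).trans
        ((X.isConnection.i_comm h a).symm.trans
          (congrArg (X.op.i h) (weilLift_ofAlgebra X a).symm))),
      (congrArg (weilLift X) (hop.L_comm h a)).trans ((weilLift_ofAlgebra X _).trans
        ((X.isConnection.L_comm h a).symm.trans
          (congrArg (X.op.L h) (weilLift_ofAlgebra X a).symm)))⟩
  induction w using OmegaGr.induction_dA with
  | hA a => exact hα a
  | hd a =>
    rw [← GradedContractions.d_ofAlgebra]
    exact (hα a).d (weilLift_d X)
  | hmul x y hx hy => exact hx.mul (weilLift_mem X) hy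
  | hadd x y hx hy => exact hx.add hy

/-- The morphism from `W(H)` to an operation with connection. -/
def weilHom : HopfOperationConn.Hom (weilOperationConn K H op hop) X where
  toAlgHom := weilLift X
  map_mem := weilLift_mem X
  map_d := weilLift_d X
  map_i h w := (weilLift_commutesAt X op hop w h).1
  map_connection := AlgHom.ext (weilLift_ofAlgebra X)

theorem weilHom_unique (f : HopfOperationConn.Hom (weilOperationConn K H op hop) X) :
    f = weilHom X op hop := by
  refine HopfOperationConn.Hom.ext (OmegaGr.algHom_ext (𝒜 := grading K H) (fun a => ?_) fun a => ?_)
  · exact (DFunLike.congr_fun f.map_connection a).trans (weilLift_ofAlgebra X a).symm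
  · refine Eq.trans ?_ (weilLift_dA X a).symm
    rw [← GradedContractions.d_ofAlgebra]
    exact (f.map_d _).trans (congrArg X.Ω.d (DFunLike.congr_fun f.map_connection a))

/-- With W(H) and the second operation as target, the lifted homomorphism fixes C(H) and dC(H),
hence is the identity; its compatibility with the contractions then equates the two operations. -/
theorem weilOperation_unique (op' : HopfOperation H (weilAlgebra K H))
    (hop : IsConnection op (weilConnection K H)) (hop' : IsConnection op' (weilConnection K H)) :
    op = op' := by
  have h : weilLift (weilOperationConn K H op' hop') = AlgHom.id K _ :=
    OmegaGr.algHom_ext (fun a => weilLift_ofAlgebra _ a) fun a => (weilLift_dA _ a).trans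
      (GradedContractions.d_ofAlgebra a)
  refine HopfOperation.ext_i (LinearMap.ext fun g => LinearMap.ext fun w => ?_)
  have := (weilLift_commutesAt (weilOperationConn K H op' hop') op hop w g).1
  rw [h] at this
  exact this

end Weil

end

/-- Unique morphisms are asserted towards targets in an arbitrary universe; initiality in the
categorical sense concerns only targets in the universe of W(H) itself. -/
theorem theorem5p3 {K : Type u} [Field K] {H : Type v} [Ring H] [HopfAlgebra K H] :
    (∃! op : HopfOperation H (weilAlgebra K H), IsConnection op (weilConnection K H)) ∧
    ∀ (op : HopfOperation H (weilAlgebra K H)) (hop : IsConnection op (weilConnection K H)),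
      (∀ X : HopfOperationConn.{u, v, w} K H,
        ∃! _f : HopfOperationConn.Hom (weilOperationConn K H op hop) X, True) ∧
      Nonempty (CategoryTheory.Limits.IsInitial (weilOperationConn K H op hop)) :=
  ⟨⟨(MultilinearForms.gradedContractions K H).operation, isConnection_operation,
      fun op hop => weilOperation_unique op _ hop isConnection_operation⟩,
    fun op hop => ⟨fun X => ⟨weilHom X op hop, trivial, fun f _ => weilHom_unique X op hop f⟩,
      ⟨CategoryTheory.Limits.IsInitial.ofUniqueHom (fun X => weilHom X op hop)
        fun X f => weilHom_unique X op hop f⟩⟩⟩
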